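/- **Model.** The input is a finite nonempty simple undirected graph $G=(V,E)$ without isolated vertices, with $n=|V|$, $m=|E|$ and average degree $d=2m/n$. Its vertices carry distinct identifiers from an infinite universe, assigned arbitrarily; an algorithm sees vertices only through identifiers, and $n$ is unknown to it. A (randomized, adaptive) algorithm makes queries of unit cost and may stop with a real output. The *standard model* allows the queries $\mathrm{RandVert}()$, which returns a uniformly random vertex; $\mathrm{RandNbr}(x)$, which returns a uniformly random neighbor of $x$; $\mathrm{Degree}(x)$, which returns $\deg(x)$; and $\mathrm{Pair}(x,y)$, which tells whether $\{x,y\}\in E$. The *full neighborhood model* allows in addition $\mathrm{FullNbrHood}(x)$, which returns the set of all neighbors of $x$. Uniformly random edges are not available in either model. For $c\ge 1$, an algorithm is a *$c$-approximation* to $d$ if on every input graph, with probability greater than $2/3$, it stops with an output in $[d/c,\,c\,d]$. **Statement.** 1. (Upper bound.) There is a constant $C>0$ such that for every $\varepsilon\in(0,1)$ there is an algorithm in the standard model with $n$ unknown which on every input graph, with probability greater than $0.99$, makes at most $C\,\varepsilon^{-2}\min(\sqrt n,\;n/d)$ queries and outputs a value in $[(1-\varepsilon)d,\,(1+\varepsilon)d]$.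 That is, $O(\varepsilon^{-2}\min(\sqrt n,n/d))$, and in particular $\widetilde O(\varepsilon^{-2}\min(\sqrt n,n/d))$, queries suffice. 2. (Lower bound in the standard model.) For every $c\ge1$ there is $\kappa>0$ such that for every $c$-approximation algorithm in the standard model with $n$ unknown, every integer $n$ and every real $d_0$ with $1\le d_0\le n-1$, there is an input graph with $n$ vertices and average degree $d\in[d_0/2,\,2d_0]$ on which the algorithm makes more than $\kappa\min(\sqrt n,\;n/d)$ queries with probability at least $1/4$. That is, $\Omega(\min(\sqrt n,n/d))$ queries are necessary. 3. (Lower bound with full neighborhood access.) For every $c\ge1$ there is $\kappa>0$ such that for every $c$-approximation algorithm in the full neighborhood model with $n$ unknown, every integer $n$ and every real $d_0$ with $1\le d_0\le n-1$, there is an input graph with $n$ vertices and average degree $d\in[d_0/2,\,2d_0]$ on which the algorithm makes more than $\kappa\sqrt{n/d}$ queries with probability at least $1/4$. That is, $\Omega(\sqrt{n/d})$ queries are necessary. -/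

import Mathlib

open scoped ENNReal

noncomputable section

namespace DegreeEstimation

/-- An input of the estimation problem: a finite nonempty simple graph without isolated vertices,
whose vertices carry distinct identifiers from an infinite universe. Algorithms see vertices only
through their identifiers. -/
structure InputGraph where
  V : Type
  [fintypeV : Fintype V]
  [nonemptyV : Nonempty V]
  graph : SimpleGraph V
  ident : V ↪ ℕ
  exists_adj : ∀ v : V, ∃ w : V, graph.Adj v w

attribute [instance] InputGraph.fintypeV InputGraph.nonemptyV

namespace InputGraph

/-- The number `n` of vertices. -/
def numVerts (I : InputGraph) : ℕ := Fintype.card I.V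

open Classical in
/-- The number `m` of edges. -/
def numEdges (I : InputGraph) : ℕ := I.graph.edgeFinset.card

/-- The average degree `d = 2 m / n`. -/
def avgDegree (I : InputGraph) : ℝ := 2 * (I.numEdges : ℝ) / (I.numVerts : ℝ)

open Classical in
/-- The set of neighbors of a vertex. -/
def nbrs (I : InputGraph) (v : I.V) : Finset I.V := I.graph.neighborFinset v

theorem nbrs_nonempty (I : InputGraph) (v : I.V) : (I.nbrs v).Nonempty := by
  obtain ⟨w, hw⟩ := I.exists_adj v
  exact ⟨w, by simpa [nbrs] using hw⟩

/-- The vertex with a given identifier, if there is one. -/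
def find (I : InputGraph) (x : ℕ) : Option I.V := Function.partialInv I.ident x

end InputGraph

/-- The queries; vertices are named by their identifiers. -/
inductive Query where
  | randVert : Query
  | randNbr (x : ℕ) : Query
  | degree (x : ℕ) : Query
  | pair (x y : ℕ) : Query
  | fullNbrHood (x : ℕ) : Query

/-- The possible answers; `invalid` is returned when an argument of the query is not the
identifier of a vertex. -/
inductive Answer where
  | vertex (x : ℕ) : Answer
  | number (k : ℕ) : Answer
  | bit (b : Bool) : Answer
  | vertices (s : Finset ℕ) : Answer
  | invalid : Answer

open Classical in
/-- The distribution of the answer to a query on the input `I`. -/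
def oracle (I : InputGraph) : Query → PMF Answer
  | .randVert => (PMF.uniformOfFintype I.V).map fun v => .vertex (I.ident v)
  | .randNbr x =>
      match I.find x with
      | some v => (PMF.uniformOfFinset (I.nbrs v) (I.nbrs_nonempty v)).map
          fun w => .vertex (I.ident w)
      | none => PMF.pure .invalid
  | .degree x =>
      match I.find x with
      | some v => PMF.pure (.number (I.nbrs v).card)
      | none => PMF.pure .invalid
  | .pair x y =>
      match I.find x, I.find y with
      | some v, some w => PMF.pure (.bit (decide (I.graph.Adj v w)))
      | _, _ => PMF.pure .invalid
  | .fullNbrHood x =>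
      match I.find x with
      | some v => PMF.pure (.vertices ((I.nbrs v).map I.ident))
      | none => PMF.pure .invalid

/-- A randomized adaptive query algorithm: given the list of its previous queries with their
answers (most recent first), it randomly either makes a further query or stops with a real
output. It has no other access to the input; in particular it is not told `n`. -/
def Algorithm : Type := List (Query × Answer) → PMF (Query ⊕ ℝ)

namespace Algorithm

/-- The algorithm works in the standard model: it uses only the oracles RandVert, RandNbr, Degree
and Pair. -/
def IsStandard (A : Algorithm) : Prop :=
  ∀ (h : List (Query × Answer)) (x : ℕ), Sum.inl (Query.fullNbrHood x) ∉ (A h).support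

/-- Run `A` on `I` from the history `h`, with fresh oracle randomness for each query. The result
is `some y` if `A` stops with output `y` after at most `T` further queries, and `none` if `A` asks
for more than `T` further queries. -/
def run (A : Algorithm) (I : InputGraph) : ℕ → List (Query × Answer) → PMF (Option ℝ)
  | 0, h => (A h).map (Sum.elim (fun _ => none) some)
  | T + 1, h => (A h).bind (Sum.elim
      (fun q => (oracle I q).bind fun a => run A I T ((q, a) :: h))
      (fun y => PMF.pure (some y)))

/-- The probability that `A` on input `I` makes at most `T` queries and its output is in `S`. -/
def probOutput (A : Algorithm) (I : InputGraph) (T : ℕ) (S : Set ℝ) : ℝ≥0∞ :=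
  (A.run I T []).toOuterMeasure (some '' S)

/-- The probability that `A` on input `I` makes more than `T` queries. -/
def probMoreQueries (A : Algorithm) (I : InputGraph) (T : ℕ) : ℝ≥0∞ :=
  A.run I T [] none

/-- On every input, `A` outputs a `c`-factor approximation of the average degree with probability
more than `2 / 3`. No bound on the number of queries is imposed: as the probability below is
nondecreasing in `T`, some `T` works if and only if the limit as `T → ∞` exceeds `2 / 3`. -/
def Approximates (A : Algorithm) (c : ℝ) : Prop :=
  ∀ I : InputGraph, ∃ T : ℕ,
    2 / 3 < A.probOutput I T (Set.Icc (I.avgDegree / c) (c * I.avgDegree))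

end Algorithm

end DegreeEstimation

end

noncomputable section

namespace DegreeEstimation

/-! ### Averages over the answers of the oracles -/

/-! Upper bound. Order the vertices by degree, with ties broken by identifier. For a random vertex v
and a random neighbor w of v, let X be 2 deg(v) if v precedes w, and 0 otherwise. Each edge counts
from its smaller end only, so E X = d. A vertex has at most √(nd) larger neighbors, because each of
them has at least as large a degree; hence E X² ≤ 4d√(nd) (`edgeMean_estimate`,
`edgeMean_estimate_sq_le`). By Chebyshev (`le_successProb_est`) a constant times ε⁻²√(n/d) samples
suffice, and √(n/d) ≤ M := min(√n, n/d).

Since n is unknown, the order of magnitude of M has to be learned. An exploration round samples y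
and z; exploration stops when they are adjacent or when y was sampled as y before. With s distinct
vertices stored, a round stops with probability between max(s, d)/n and (s + d)/n. So exploration is
unlikely to stop before s reaches M/1000 and unlikely to survive much more than 8M rounds, and the
final s determines the number of samples.

Lower bounds. A graph that consists of cliques of size a = ⌊d⌋ + 1, up to one slightly larger
clique, is compared with a far larger graph of cliques of size a that hides one clique. The hidden
clique is a tiny fraction of the vertices, but it raises the average degree by more than the factor
c², so that no output is correct for both graphs. The second graph has a different number of
vertices, which is harmless because n is not known.

Both graphs, with random identifiers below a huge M, are compared with one ideal process: every
random vertex opens a new clique of size a, new labels are uniform below M, and guessed identifiers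
never exist. It suffices that the likelihood of every short history, averaged over the labellings,
is at least 24/25 of its ideal weight for both graphs, and that the ideal weight loses little mass
(`exists_probMoreQueries`, `mul_idealWeight_le_tsum`, `mul_idealWeight_le_meanLikelihood`). No upper
bound on a likelihood is needed.

The domination is a count of placements of the known labels. If the discovered components are placed
independently, the number of placements is an exact product (`placeSum_one`). A union bound then
shows that most placements are separated: distinct components occupy distinct vertices, and pairs
reported as non-adjacent lie in distinct cliques. If each query finds at most one label, the bad
fraction is at most (T² + Ta)/n up to constants, which gives T of order min(√n, n/d)
(`le_placeSum_separated`). With full neighborhoods, counting pairs of components instead of pairs of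
labels gives T²a/n, hence √(n/d) (`le_placeSum_separated_of_roots`). -/

theorem InputGraph.find_ident (I : InputGraph) (v : I.V) : I.find (I.ident v) = some v :=
  Function.partialInv_left I.ident.injective v

open Classical in
/-- The expectation of a function of the answer to a query. -/
def queryMean (I : InputGraph) : Query → (Answer → ℝ) → ℝ
  | .randVert, g => (∑ v : I.V, g (.vertex (I.ident v))) / I.numVerts
  | .randNbr x, g =>
      match I.find x with
      | some v => (∑ w ∈ I.nbrs v, g (.vertex (I.ident w))) / (I.nbrs v).card
      | none => g .invalid
  | .degree x, g =>
      match I.find x with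
      | some v => g (.number (I.nbrs v).card)
      | none => g .invalid
  | .pair x y, g =>
      match I.find x, I.find y with
      | some v, some w => g (.bit (decide (I.graph.Adj v w)))
      | _, _ => g .invalid
  | .fullNbrHood x, g =>
      match I.find x with
      | some v => g (.vertices ((I.nbrs v).map I.ident))
      | none => g .invalid

theorem toOuterMeasure_ne_top {α : Type*} (p : PMF α) (S : Set α) : p.toOuterMeasure S ≠ ⊤ := by
  rw [PMF.toOuterMeasure_apply]
  refine ne_top_of_le_ne_top p.tsum_coe_ne_top (ENNReal.tsum_le_tsum fun a => ?_)
  exact Set.indicator_le_self S p a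

theorem toReal_uniformOfFinset_bind {α β : Type*} (s : Finset α) (hs : s.Nonempty)
    (f : α → PMF β) (S : Set β) :
    (((PMF.uniformOfFinset s hs).bind f).toOuterMeasure S).toReal =
      (∑ a ∈ s, ((f a).toOuterMeasure S).toReal) / s.card := by
  rw [PMF.toOuterMeasure_bind_apply, tsum_eq_sum (s := s), ENNReal.toReal_sum]
  · rw [Finset.sum_div]
    refine Finset.sum_congr rfl fun a ha => ?_
    rw [PMF.uniformOfFinset_apply_of_mem hs ha, ENNReal.toReal_mul, ENNReal.toReal_inv,
      ENNReal.toReal_natCast, div_eq_inv_mul]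
  · intro a ha
    rw [PMF.uniformOfFinset_apply_of_mem hs ha]
    refine ENNReal.mul_ne_top ?_ (toOuterMeasure_ne_top _ _)
    simp only [ne_eq, ENNReal.inv_eq_top, Nat.cast_eq_zero, Finset.card_eq_zero]
    exact fun h => by simp [h] at ha
  · intro a ha
    rw [PMF.uniformOfFinset_apply_of_notMem hs ha, zero_mul]

theorem toReal_oracle_bind {β : Type*} (I : InputGraph) (q : Query) (f : Answer → PMF β)
    (S : Set β) :
    (((oracle I q).bind f).toOuterMeasure S).toReal =
      queryMean I q fun a => ((f a).toOuterMeasure S).toReal := by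
  cases q with
  | randVert =>
    simp only [oracle, queryMean, PMF.bind_map, PMF.uniformOfFintype]
    rw [toReal_uniformOfFinset_bind]
    rfl
  | randNbr x =>
    simp only [oracle, queryMean]
    cases I.find x with
    | none => simp
    | some v =>
      simp only [PMF.bind_map]
      rw [toReal_uniformOfFinset_bind]
      rfl
  | degree x =>
    simp only [oracle, queryMean]
    cases I.find x <;> simp
  | pair x y =>
    simp only [oracle, queryMean]
    cases I.find x <;> cases I.find y <;> simp
  | fullNbrHood x =>
    simp only [oracle, queryMean]
    cases I.find x <;> simp

/-! ### Deterministic state machines as algorithms -/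

section Machine

variable {σ : Type*} (query : σ → Query ⊕ ℝ) (step : σ → Answer → σ)

/-- The state reached along a history. -/
def machineState (s₀ : σ) (h : List (Query × Answer)) : σ :=
  h.foldr (fun qa s => step s qa.2) s₀

/-- The deterministic algorithm given by a state machine. -/
def machine (s₀ : σ) : Algorithm := fun h => PMF.pure (query (machineState step s₀ h))

open Classical in
/-- The probability that the machine stops with an output in `S` after at most `T` queries. -/
def successProb (I : InputGraph) (S : Set ℝ) : ℕ → σ → ℝ
  | 0, s => Sum.elim (fun _ => 0) (fun y => if y ∈ S then 1 else 0) (query s)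
  | T + 1, s => Sum.elim (fun q => queryMean I q fun a => successProb I S T (step s a))
      (fun y => if y ∈ S then 1 else 0) (query s)

/-- A history influences the machine only through the state that it leads to, so the run satisfies
the recursion of `successProb`; all probabilities of the estimation algorithm become finite averages
of reals. -/
theorem toReal_run_machine (I : InputGraph) (S : Set ℝ) (s₀ : σ) (T : ℕ)
    (h : List (Query × Answer)) :
    (((machine query step s₀).run I T h).toOuterMeasure (some '' S)).toReal =
      successProb query step I S T (machineState step s₀ h) := by
  induction T generalizing h with
  | zero =>
    simp only [Algorithm.run, machine, PMF.pure_map, successProb]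
    cases query (machineState step s₀ h) with
    | inl q => simp
    | inr y => by_cases hy : y ∈ S <;> simp [hy]
  | succ T ih =>
    simp only [Algorithm.run, machine, PMF.pure_bind, successProb]
    cases query (machineState step s₀ h) with
    | inl q =>
      simp only [Sum.elim_inl]
      rw [toReal_oracle_bind]
      congr 1
      funext a
      exact ih ((q, a) :: h)
    | inr y => by_cases hy : y ∈ S <;> simp [hy]

theorem toReal_probOutput_machine (I : InputGraph) (S : Set ℝ) (s₀ : σ) (T : ℕ) :
    ((machine query step s₀).probOutput I T S).toReal = successProb query step I S T s₀ :=
  toReal_run_machine query step I S s₀ T []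

end Machine

/-! ### Degrees -/

namespace InputGraph

variable (I : InputGraph)

theorem numVerts_pos : (0 : ℝ) < I.numVerts := by
  unfold numVerts
  exact_mod_cast Fintype.card_pos

theorem mem_nbrs (v w : I.V) : w ∈ I.nbrs v ↔ I.graph.Adj v w := by
  simp [nbrs]

theorem card_nbrs_pos (v : I.V) : 0 < (I.nbrs v).card := (I.nbrs_nonempty v).card_pos

theorem sum_card_nbrs : (∑ v : I.V, ((I.nbrs v).card : ℝ)) = I.numVerts * I.avgDegree := by
  classical
  have h := I.graph.sum_degrees_eq_twice_card_edges
  have h1 : I.numVerts * I.avgDegree = 2 * (I.numEdges : ℝ) := by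
    have := I.numVerts_pos.ne'
    unfold avgDegree
    field_simp
  rw [h1]
  have h2 : (∑ v : I.V, (I.nbrs v).card) = 2 * I.numEdges := by
    unfold numEdges nbrs
    simp only [SimpleGraph.card_neighborFinset_eq_degree]
    convert h
  exact_mod_cast h2

theorem one_le_avgDegree : 1 ≤ I.avgDegree := by
  have h := I.sum_card_nbrs
  have h1 : (∑ v : I.V, (1 : ℝ)) ≤ ∑ v : I.V, ((I.nbrs v).card : ℝ) :=
    Finset.sum_le_sum fun v _ => by exact_mod_cast I.card_nbrs_pos v
  rw [h] at h1
  simp only [Finset.sum_const, Finset.card_univ, nsmul_eq_mul, mul_one] at h1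
  have h2 := I.numVerts_pos
  change (I.numVerts : ℝ) ≤ _ at h1
  by_contra hc
  push Not at hc
  nlinarith

theorem avgDegree_le_numVerts : I.avgDegree ≤ I.numVerts := by
  have h := I.sum_card_nbrs
  have h1 : (∑ v : I.V, ((I.nbrs v).card : ℝ)) ≤ ∑ v : I.V, (I.numVerts : ℝ) :=
    Finset.sum_le_sum fun v _ => by exact_mod_cast Finset.card_le_univ _
  rw [h] at h1
  simp only [Finset.sum_const, Finset.card_univ, nsmul_eq_mul] at h1
  exact le_of_mul_le_mul_left h1 I.numVerts_pos

/-- The order on vertices by degree, ties being broken by the identifiers. -/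
def Prec (v w : I.V) : Prop :=
  (I.nbrs v).card < (I.nbrs w).card ∨ ((I.nbrs v).card = (I.nbrs w).card ∧ I.ident v < I.ident w)

open Classical in
/-- The neighbors that are larger in the order by degree. -/
def upNbrs (v : I.V) : Finset I.V := (I.nbrs v).filter (I.Prec v)

theorem prec_iff_not_prec {v w : I.V} (h : v ≠ w) : I.Prec w v ↔ ¬ I.Prec v w := by
  have : I.ident v ≠ I.ident w := fun he => h (I.ident.injective he)
  unfold Prec
  omega

/-- Of the two orientations of an edge exactly one goes upwards, as identifiers break all ties. -/
theorem two_mul_sum_card_upNbrs :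
    2 * (∑ v : I.V, ((I.upNbrs v).card : ℝ)) = I.numVerts * I.avgDegree := by
  classical
  rw [← I.sum_card_nbrs]
  have h1 : ∀ v, ((I.upNbrs v).card : ℝ) =
      ∑ w, if I.graph.Adj v w ∧ I.Prec v w then (1 : ℝ) else 0 := by
    intro v
    rw [Finset.sum_boole]
    congr 2
    ext w
    simp [upNbrs, mem_nbrs]
  have h2 : ∀ v, ((I.nbrs v).card : ℝ) = ∑ w, if I.graph.Adj v w then (1 : ℝ) else 0 := by
    intro v
    rw [Finset.sum_boole]
    congr 2
    ext w
    simp [mem_nbrs]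
  simp only [h1, h2]
  rw [two_mul]
  nth_rewrite 2 [Finset.sum_comm]
  rw [← Finset.sum_add_distrib]
  refine Finset.sum_congr rfl fun v _ => ?_
  rw [← Finset.sum_add_distrib]
  refine Finset.sum_congr rfl fun w _ => ?_
  by_cases hvw : I.graph.Adj v w
  · have := I.prec_iff_not_prec hvw.ne
    by_cases hp : I.Prec v w <;> simp [hvw, hvw.symm, this, hp]
  · have : ¬ I.graph.Adj w v := fun h => hvw h.symm
    simp [hvw, this]

/-- Each of the u larger neighbors of v has degree at least deg(v) ≥ u, and these degrees together
are at most the sum nd of all degrees. -/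
theorem card_upNbrs_sq_le (v : I.V) :
    ((I.upNbrs v).card : ℝ) ^ 2 ≤ I.numVerts * I.avgDegree := by
  rw [← I.sum_card_nbrs]
  have h1 : ∀ w ∈ I.upNbrs v, ((I.upNbrs v).card : ℝ) ≤ (I.nbrs w).card := by
    intro w hw
    have h2 : (I.upNbrs v).card ≤ (I.nbrs v).card := by
      classical exact Finset.card_filter_le _ _
    have h3 : I.Prec v w := by
      simp only [upNbrs, Finset.mem_filter] at hw
      exact hw.2
    unfold Prec at h3
    have : (I.upNbrs v).card ≤ (I.nbrs w).card := by omega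
    exact_mod_cast this
  calc ((I.upNbrs v).card : ℝ) ^ 2 = ∑ w ∈ I.upNbrs v, ((I.upNbrs v).card : ℝ) := by
        simp [sq]
    _ ≤ ∑ w ∈ I.upNbrs v, ((I.nbrs w).card : ℝ) := Finset.sum_le_sum h1
    _ ≤ _ := Finset.sum_le_univ_sum_of_nonneg fun w => by positivity

/-! ### The edge-based estimator of the average degree -/

open Classical in
/-- The value of the estimator at a vertex and a random neighbor of it. -/
def estimate (v w : I.V) : ℝ := if I.Prec v w then 2 * (I.nbrs v).card else 0

/-- The average over a random vertex and a random neighbor of it. -/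
def edgeMean (g : I.V → I.V → ℝ) : ℝ :=
  (∑ v : I.V, (∑ w ∈ I.nbrs v, g v w) / (I.nbrs v).card) / I.numVerts

theorem edgeMean_add (g g' : I.V → I.V → ℝ) :
    I.edgeMean (fun v w => g v w + g' v w) = I.edgeMean g + I.edgeMean g' := by
  simp only [edgeMean, Finset.sum_add_distrib, add_div]

theorem edgeMean_const_mul (c : ℝ) (g : I.V → I.V → ℝ) :
    I.edgeMean (fun v w => c * g v w) = c * I.edgeMean g := by
  simp only [edgeMean, ← Finset.mul_sum, mul_div_assoc]

theorem edgeMean_const (c : ℝ) : I.edgeMean (fun _ _ => c) = c := by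
  have h1 : ∀ v, ((I.nbrs v).card : ℝ) ≠ 0 := fun v => by exact_mod_cast (I.card_nbrs_pos v).ne'
  have h2 := I.numVerts_pos.ne'
  simp only [edgeMean, Finset.sum_const, nsmul_eq_mul]
  have h3 : ∀ v : I.V, ((I.nbrs v).card : ℝ) * c / (I.nbrs v).card = c := fun v => by
    rw [mul_comm, mul_div_assoc, div_self (h1 v), mul_one]
  simp only [h3, Finset.sum_const, nsmul_eq_mul, Finset.card_univ]
  change (I.numVerts : ℝ) * c / I.numVerts = c
  field_simp

theorem edgeMean_mono {g g' : I.V → I.V → ℝ} (h : ∀ v w, g v w ≤ g' v w) :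
    I.edgeMean g ≤ I.edgeMean g' := by
  unfold edgeMean
  gcongr
  exact h _ _

theorem sum_nbrs_estimate_pow (v : I.V) (k : ℕ) (hk : k ≠ 0) :
    ∑ w ∈ I.nbrs v, I.estimate v w ^ k = (I.upNbrs v).card * (2 * (I.nbrs v).card) ^ k := by
  classical
  simp only [estimate, upNbrs, Finset.card_filter, ite_pow, zero_pow hk]
  rw [← Finset.sum_filter, Finset.sum_const, nsmul_eq_mul, Finset.card_filter]

/-- The value 2 deg(v) cancels the probability 1/deg(v) of each neighbor, which leaves twice the
number of larger neighbors. -/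
theorem edgeMean_estimate : I.edgeMean I.estimate = I.avgDegree := by
  have h1 : ∀ v, ((I.nbrs v).card : ℝ) ≠ 0 := fun v => by exact_mod_cast (I.card_nbrs_pos v).ne'
  have h3 : ∀ v : I.V, (∑ w ∈ I.nbrs v, I.estimate v w) / (I.nbrs v).card =
      2 * (I.upNbrs v).card := fun v => by
    have := I.sum_nbrs_estimate_pow v 1 one_ne_zero
    simp only [pow_one] at this
    rw [this]
    field_simp [h1 v]
  simp only [edgeMean, h3]
  rw [← Finset.mul_sum, two_mul_sum_card_upNbrs]
  field_simp [I.numVerts_pos.ne']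

/-- One factor deg(v) cancels against the choice of the neighbor, the number of larger neighbors is
at most √(nd), and the remaining factor deg(v) averages to d. -/
theorem edgeMean_estimate_sq_le :
    I.edgeMean (fun v w => I.estimate v w ^ 2) ≤
      4 * I.avgDegree * Real.sqrt (I.numVerts * I.avgDegree) := by
  have h1 : ∀ v, ((I.nbrs v).card : ℝ) ≠ 0 := fun v => by exact_mod_cast (I.card_nbrs_pos v).ne'
  have h3 : ∀ v : I.V, (∑ w ∈ I.nbrs v, I.estimate v w ^ 2) / (I.nbrs v).card ≤
      4 * Real.sqrt (I.numVerts * I.avgDegree) * (I.nbrs v).card := fun v => by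
    rw [I.sum_nbrs_estimate_pow v 2 two_ne_zero]
    have h4 : ((I.upNbrs v).card : ℝ) * (2 * (I.nbrs v).card) ^ 2 / (I.nbrs v).card =
        4 * (I.upNbrs v).card * (I.nbrs v).card := by
      field_simp [h1 v]
      ring
    rw [h4]
    gcongr
    exact Real.le_sqrt_of_sq_le (I.card_upNbrs_sq_le v)
  unfold edgeMean
  rw [div_le_iff₀ I.numVerts_pos]
  refine (Finset.sum_le_sum fun v _ => h3 v).trans ?_
  rw [← Finset.mul_sum, sum_card_nbrs]
  apply le_of_eq
  ring

end InputGraph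


/-! ### The estimation algorithm -/

/-- The states of the estimation algorithm. In the exploration phase it keeps the list of the
sampled vertices; in the estimation phase it keeps the total number of samples, the number of
samples still to be taken, and the sum of the estimates. -/
inductive EstState where
  | explore (xs : List ℕ)
  | explorePair (xs : List ℕ) (y : ℕ)
  | exploreTest (xs : List ℕ) (y z : ℕ)
  | est (N k : ℕ) (acc : ℝ)
  | estNbr (N k : ℕ) (acc : ℝ) (v : ℕ)
  | estDeg (N k : ℕ) (acc : ℝ) (v w : ℕ)
  | estCompare (N k : ℕ) (acc : ℝ) (v w dv : ℕ)

namespace EstState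

/-- The query, or the output, of the algorithm in each state. -/
def query : EstState → Query ⊕ ℝ
  | explore _ => .inl .randVert
  | explorePair _ _ => .inl .randVert
  | exploreTest _ y z => .inl (.pair y z)
  | est N 0 acc => .inr (acc / N)
  | est _ (_ + 1) _ => .inl .randVert
  | estNbr _ _ _ v => .inl (.randNbr v)
  | estDeg _ _ _ v _ => .inl (.degree v)
  | estCompare _ _ _ _ w _ => .inl (.degree w)

/-- The transitions of the algorithm; `size s` is the number of samples that are taken when the
exploration phase stops with `s` vertices. -/
def step (size : ℕ → ℕ) : EstState → Answer → EstState
  | explore xs, .vertex y => explorePair xs y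
  | explorePair xs y, .vertex z => exploreTest xs y z
  | exploreTest xs y _, .bit b =>
      -- Only y is stored, and a repeated y ends the phase, so the list stays free of duplicates and
      -- its length counts distinct vertices.
      if b = true ∨ y ∈ xs then est (size xs.length) (size xs.length) 0 else explore (y :: xs)
  | est N (k + 1) acc, .vertex v => estNbr N k acc v
  | estNbr N k acc v, .vertex w => estDeg N k acc v w
  | estDeg N k acc v w, .number dv => estCompare N k acc v w dv
  | estCompare N k acc v w dv, .number dw =>
      est N k (acc + if dv < dw ∨ (dv = dw ∧ v < w) then 2 * (dv : ℝ) else 0)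
  -- A junk state: the run from the initial state never receives an answer of the wrong form.
  | _, _ => est 0 0 0

end EstState

/-! ### Success probability of the estimation phase. -/

section Analysis

variable (I : InputGraph) (S : Set ℝ) (size : ℕ → ℕ)

local notation "prob" => successProb EstState.query (EstState.step size) I S

theorem successProb_nonneg {σ : Type*} (query : σ → Query ⊕ ℝ) (step : σ → Answer → σ) (T : ℕ)
    (s : σ) : 0 ≤ successProb query step I S T s := by
  rw [← toReal_probOutput_machine]
  exact ENNReal.toReal_nonneg

/-- One sample costs four queries: a vertex, a neighbor, and the two degrees. -/
theorem successProb_est_succ (T N k : ℕ) (acc : ℝ) :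
    prob (T + 4) (.est N (k + 1) acc) =
      I.edgeMean fun v w => prob T (.est N k (acc + I.estimate v w)) := by
  simp only [successProb, EstState.query, EstState.step, Sum.elim_inl, queryMean,
    InputGraph.find_ident, InputGraph.edgeMean, InputGraph.estimate, InputGraph.Prec]
  congr! 9
  congr 1

open Classical in
theorem successProb_explore (T : ℕ) (l : List I.V) :
    prob (T + 3) (.explore (l.map I.ident)) =
      (∑ y, (∑ z, if I.graph.Adj y z ∨ y ∈ l then prob T (.est (size l.length) (size l.length) 0)
        else prob T (.explore ((y :: l).map I.ident))) / I.numVerts) / I.numVerts := by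
  have hmem : ∀ y, I.ident y ∈ l.map I.ident ↔ y ∈ l := fun y =>
    List.mem_map_of_injective I.ident.injective
  simp only [successProb, EstState.query, EstState.step, Sum.elim_inl, queryMean,
    InputGraph.find_ident, hmem, decide_eq_true_eq, List.length_map, List.map_cons]
  congr 1
  refine Finset.sum_congr rfl fun y _ => ?_
  congr 1
  refine Finset.sum_congr rfl fun z _ => ?_
  split_ifs <;> rfl

/-- Chebyshev's inequality for the estimation phase. -/
theorem le_successProb_est (ε : ℝ) (hε : 0 < ε) (N : ℕ) (hN : 0 < N) (k T : ℕ) (acc : ℝ) :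
    1 - ((acc + k * I.avgDegree - N * I.avgDegree) ^ 2 +
        k * (4 * I.avgDegree * Real.sqrt (I.numVerts * I.avgDegree))) /
          (N * (ε * I.avgDegree)) ^ 2 ≤
      successProb EstState.query (EstState.step size) I
        (Set.Icc ((1 - ε) * I.avgDegree) ((1 + ε) * I.avgDegree)) (T + 4 * k) (.est N k acc) := by
  have hμ : 0 < I.avgDegree := lt_of_lt_of_le one_pos I.one_le_avgDegree
  have hN' : (0 : ℝ) < N := by exact_mod_cast hN
  have hB : (0 : ℝ) < (N * (ε * I.avgDegree)) ^ 2 := by positivity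
  induction k generalizing acc with
  | zero =>
    have hval : successProb EstState.query (EstState.step size) I
        (Set.Icc ((1 - ε) * I.avgDegree) ((1 + ε) * I.avgDegree)) (T + 4 * 0) (.est N 0 acc) =
        if acc / N ∈ Set.Icc ((1 - ε) * I.avgDegree) ((1 + ε) * I.avgDegree) then 1 else 0 := by
      cases T <;> simp [successProb, EstState.query]
    rw [hval]
    split_ifs with h
    · simp only [Nat.cast_zero, zero_mul, add_zero]
      have := div_nonneg (sq_nonneg (acc - N * I.avgDegree)) hB.le
      linarith
    · simp only [Nat.cast_zero, zero_mul, add_zero]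
      -- If the output misses the interval, the deviation is at least Nεd, so the claimed lower
      -- bound is at most 0.
      rw [sub_nonpos, one_le_div hB, sq_le_sq, abs_of_pos (by positivity)]
      by_contra hc
      push Not at hc
      rw [abs_lt] at hc
      refine h ⟨?_, ?_⟩
      · rw [le_div_iff₀ hN']
        nlinarith
      · rw [div_le_iff₀ hN']
        nlinarith
  | succ k ih =>
    rw [show T + 4 * (k + 1) = (T + 4 * k) + 4 by ring, successProb_est_succ]
    refine le_trans ?_ (I.edgeMean_mono fun v w => ih (acc + I.estimate v w))
    set μ := I.avgDegree
    set V := 4 * μ * Real.sqrt (I.numVerts * μ) with hV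
    set B := (N * (ε * μ)) ^ 2
    have hE2 := I.edgeMean_estimate_sq_le
    have hE1 := I.edgeMean_estimate
    change _ ≤ V at hE2
    set c := acc + k * μ - N * μ with hc
    -- The bound is a quadratic polynomial in the next sample, so its average needs only the first
    -- two moments.
    have hexp : (fun v w => 1 - ((acc + I.estimate v w + k * μ - N * μ) ^ 2 + k * V) / B) =
        fun v w => (1 - (c ^ 2 + k * V) / B) +
          ((-(2 * c) / B) * I.estimate v w + (-1 / B) * I.estimate v w ^ 2) := by
      funext v w
      rw [hc]
      field_simp
      ring
    rw [hexp, I.edgeMean_add, I.edgeMean_const,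
      I.edgeMean_add (fun v w => (-(2 * c) / B) * I.estimate v w)
        (fun v w => (-1 / B) * I.estimate v w ^ 2),
      I.edgeMean_const_mul, I.edgeMean_const_mul, hE1]
    have h1 : 1 - (c ^ 2 + k * V) / B +
        (-(2 * c) / B * I.avgDegree +
          -1 / B * I.edgeMean (fun v w => I.estimate v w ^ 2)) =
        1 - (c ^ 2 + k * V + 2 * c * μ + I.edgeMean (fun v w => I.estimate v w ^ 2)) / B := by
      ring
    rw [h1]
    have h2 : acc + ((k + 1 : ℕ) : ℝ) * μ - N * μ = c + μ := by
      rw [hc]; push_cast; ring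
    rw [h2, sub_le_sub_iff_left]
    refine div_le_div_of_nonneg_right ?_ hB.le
    push_cast
    -- The raw second moment V replaces the variance; the term μ² that is lost has the favorable
    -- sign.
    nlinarith [sq_nonneg μ]

/-! ### Length of the exploration phase. -/

open Classical in
/-- The probability that the exploration phase stops in the round that starts with the list
`l`. -/
def stopProb (l : List I.V) : ℝ :=
  (∑ y : I.V, (∑ z : I.V, if I.graph.Adj y z ∨ y ∈ l then (1 : ℝ) else 0) / I.numVerts) /
    I.numVerts

theorem stopProb_nonneg (l : List I.V) : 0 ≤ stopProb I l := by
  classical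
  unfold stopProb
  refine div_nonneg (Finset.sum_nonneg fun y _ => div_nonneg (Finset.sum_nonneg fun z _ => ?_) ?_) ?_
  · split_ifs <;> norm_num
  · positivity
  · positivity

theorem sum_adj (y : I.V) [DecidableRel I.graph.Adj] :
    (∑ z : I.V, if I.graph.Adj y z then (1 : ℝ) else 0) = (I.nbrs y).card := by
  rw [Finset.sum_boole]
  congr 2
  ext z
  simp [I.mem_nbrs]

/-- Union bound: a random pair is adjacent with probability d/n, and y lies in the list with
probability at most its length over n. -/
theorem stopProb_le (l : List I.V) :
    stopProb I l ≤ (l.length + I.avgDegree) / I.numVerts := by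
  classical
  have hn := I.numVerts_pos
  have h1 : stopProb I l ≤ (∑ y : I.V, ((I.nbrs y).card / I.numVerts +
      if y ∈ l then (1 : ℝ) else 0)) / I.numVerts := by
    unfold stopProb
    gcongr with y
    rw [div_add' _ _ _ hn.ne']
    gcongr
    rw [← sum_adj I y]
    have h2 : (if y ∈ l then (1 : ℝ) else 0) * I.numVerts =
        ∑ z : I.V, if y ∈ l then (1 : ℝ) else 0 := by
      simp [InputGraph.numVerts, mul_comm]
    rw [h2, ← Finset.sum_add_distrib]
    gcongr with z
    split_ifs <;> simp_all
  refine h1.trans ?_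
  gcongr
  rw [Finset.sum_add_distrib, ← Finset.sum_div, I.sum_card_nbrs, Finset.sum_boole, add_comm,
    mul_div_assoc, mul_div_cancel₀ _ hn.ne']
  gcongr
  have h3 : (Finset.univ.filter fun y => y ∈ l) = l.toFinset := by ext; simp
  rw [h3]
  exact_mod_cast l.toFinset_card_le

theorem avgDegree_le_stopProb (l : List I.V) : I.avgDegree / I.numVerts ≤ stopProb I l := by
  classical
  have hn := I.numVerts_pos
  have h1 : (∑ y : I.V, ((I.nbrs y).card : ℝ) / I.numVerts) / I.numVerts ≤ stopProb I l := by
    unfold stopProb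
    gcongr with y
    rw [← sum_adj I y]
    gcongr with z
    split_ifs <;> simp_all
  refine le_trans (le_of_eq ?_) h1
  rw [← Finset.sum_div, I.sum_card_nbrs, mul_div_assoc, mul_div_cancel₀ _ hn.ne']

theorem length_le_stopProb (l : List I.V) (hl : l.Nodup) :
    l.length / I.numVerts ≤ stopProb I l := by
  classical
  have hn := I.numVerts_pos
  have h1 : (∑ y : I.V, if y ∈ l then (1 : ℝ) else 0) / I.numVerts ≤ stopProb I l := by
    unfold stopProb
    gcongr with y
    rw [le_div_iff₀ hn]
    have h2 : (if y ∈ l then (1 : ℝ) else 0) * I.numVerts =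
        ∑ z : I.V, if y ∈ l then (1 : ℝ) else 0 := by
      simp [InputGraph.numVerts, mul_comm]
    rw [h2]
    gcongr with z
    split_ifs <;> simp_all
  refine le_trans (le_of_eq ?_) h1
  rw [Finset.sum_boole]
  have h3 : (Finset.univ.filter fun y => y ∈ l) = l.toFinset := by ext; simp
  rw [h3, List.toFinset_card_of_nodup hl]

/-- Condition on whether the round stops; the value after stopping is the same for all y and z, and
a round that continues has y outside the list. -/
theorem le_successProb_explore (T : ℕ) (l : List I.V) (P Q : ℝ)
    (hP : P ≤ prob T (.est (size l.length) (size l.length) 0))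
    (hQ : ∀ y, y ∉ l → Q ≤ prob T (.explore ((y :: l).map I.ident))) :
    stopProb I l * P + (1 - stopProb I l) * Q ≤ prob (T + 3) (.explore (l.map I.ident)) := by
  classical
  have hn := I.numVerts_pos
  rw [successProb_explore]
  have h1 : stopProb I l * P + (1 - stopProb I l) * Q =
      (∑ y : I.V, (∑ z : I.V, (((if I.graph.Adj y z ∨ y ∈ l then (1 : ℝ) else 0) * (P - Q)) + Q)) /
        I.numVerts) / I.numVerts := by
    simp only [Finset.sum_add_distrib, ← Finset.sum_mul, add_div, mul_div_right_comm,
      Finset.sum_const, Finset.card_univ, nsmul_eq_mul]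
    have h2 : ((Fintype.card I.V : ℕ) : ℝ) = I.numVerts := rfl
    rw [h2, div_self hn.ne', one_mul]
    unfold stopProb
    ring
  rw [h1]
  gcongr with y _ z _
  split_ifs with h
  · linarith
  · have := hQ y fun hy => h (Or.inr hy)
    linarith

/-- A lower bound for the success probability from the point of the exploration phase where the
number of samples is large enough. -/
theorem le_successProb_explore_late (s₀ s₁ B : ℕ) (p : ℝ) (hp : 0 ≤ p)
    (hest : ∀ s, s₀ ≤ s → s < s₁ → ∀ T, 1 - p ≤ prob (T + B) (.est (size s) (size s) 0))
    (j : ℕ) (l : List I.V) (hl : l.Nodup) (hj : l.length + j = s₁) (hs : s₀ ≤ l.length) (T : ℕ) :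
    1 - p - Real.exp (-∑ i ∈ Finset.range j,
        max ((l.length + i : ℕ) : ℝ) I.avgDegree / I.numVerts) ≤
      prob (T + B + 3 * j) (.explore (l.map I.ident)) := by
  induction j generalizing l with
  | zero =>
    -- With no rounds left the exponential is 1 and the claimed bound is −p, at most 0.
    have := successProb_nonneg I S EstState.query (EstState.step size) (T + B + 3 * 0)
      (.explore (l.map I.ident))
    simp only [Finset.range_zero, Finset.sum_empty, neg_zero, Real.exp_zero]
    linarith
  | succ j ih =>
    have hest' := hest l.length hs (by omega) (T + 3 * j)
    rw [show T + 3 * j + B = T + B + 3 * j by ring] at hest'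
    set E := Real.exp (-∑ i ∈ Finset.range j,
        max ((l.length + 1 + i : ℕ) : ℝ) I.avgDegree / I.numVerts) with hE
    have hnext : ∀ y, y ∉ l → 1 - p - E ≤
        prob (T + B + 3 * j) (.explore ((y :: l).map I.ident)) := fun y hy =>
      ih (y :: l) (List.nodup_cons.2 ⟨hy, hl⟩) (by simp; omega) (by simp; omega)
    have h := le_successProb_explore I S size _ l _ _ hest' hnext
    rw [show T + B + 3 * (j + 1) = T + B + 3 * j + 3 by ring]
    refine le_trans ?_ h
    have hle : max (l.length : ℝ) I.avgDegree / I.numVerts ≤ stopProb I l := by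
      rw [div_le_iff₀ I.numVerts_pos]
      refine max_le ?_ ?_
      · rw [← div_le_iff₀ I.numVerts_pos]
        exact length_le_stopProb I l hl
      · rw [← div_le_iff₀ I.numVerts_pos]
        exact avgDegree_le_stopProb I l
    -- By 1 − x ≤ exp(−x), the probability of surviving all rounds is at most the exponential of
    -- minus the sum of the stopping rates.
    have h1 : 1 - stopProb I l ≤ Real.exp (-(max (l.length : ℝ) I.avgDegree / I.numVerts)) := by
      have := Real.add_one_le_exp (-stopProb I l)
      have h2 := Real.exp_le_exp.2 (neg_le_neg hle)
      linarith
    have h3 : Real.exp (-∑ i ∈ Finset.range (j + 1),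
        max ((l.length + i : ℕ) : ℝ) I.avgDegree / I.numVerts) =
        Real.exp (-(max (l.length : ℝ) I.avgDegree / I.numVerts)) * E := by
      rw [hE, ← Real.exp_add, Finset.sum_range_succ', add_zero, neg_add, add_comm]
      simp only [add_assoc, add_comm 1]
    rw [h3]
    have := mul_le_mul_of_nonneg_right h1 (Real.exp_pos _ : 0 < E).le
    linarith

/-- It is unlikely that the exploration phase stops early. -/
theorem le_successProb_explore_early (s₀ B : ℕ) (Q : ℝ) (hQ1 : Q ≤ 1)
    (hQ : ∀ l : List I.V, l.Nodup → l.length = s₀ → Q ≤ prob B (.explore (l.map I.ident)))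
    (j : ℕ) (l : List I.V) (hl : l.Nodup) (hj : l.length + j = s₀) :
    Q - j * ((s₀ + I.avgDegree) / I.numVerts) ≤ prob (B + 3 * j) (.explore (l.map I.ident)) := by
  have hμ : 0 < I.avgDegree := lt_of_lt_of_le one_pos I.one_le_avgDegree
  have hn := I.numVerts_pos
  have hpos : 0 ≤ (s₀ + I.avgDegree) / I.numVerts := by positivity
  induction j generalizing l with
  | zero => simpa using hQ l hl (by omega)
  | succ j ih =>
    -- Stopping this early counts as a failure, hence the value 0 for the stopping case.
    have h := le_successProb_explore I S size (B + 3 * j) l 0 _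
      (successProb_nonneg I S _ _ _ _)
      (fun y hy => ih (y :: l) (List.nodup_cons.2 ⟨hy, hl⟩) (by simp; omega))
    rw [show B + 3 * (j + 1) = B + 3 * j + 3 by ring]
    refine le_trans ?_ h
    have h1 : stopProb I l ≤ (s₀ + I.avgDegree) / I.numVerts := by
      refine (stopProb_le I l).trans ?_
      gcongr
      omega
    have h2 := stopProb_nonneg I l
    have h3 : Q - j * ((s₀ + I.avgDegree) / I.numVerts) ≤ 1 := by
      have : 0 ≤ j * ((s₀ + I.avgDegree) / I.numVerts) := by positivity
      linarith
    push_cast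
    nlinarith

end Analysis

/-! ### Constants and query budget of the algorithm. -/

/-- The number of samples in the estimation phase. -/
def sampleSize (ε : ℝ) (s : ℕ) : ℕ := ⌈4000000 * (s + 1) / ε ^ 2⌉₊

/-- From s + 1 ≥ M/1000 the number N of samples satisfies Nε² ≥ 4000M. The Chebyshev error is
4√(nd)/(Nε²d), which is at most 4M/(Nε²) ≤ 1/1000. -/
theorem estimation_succeeds (ε : ℝ) (hε : 0 < ε) (hε1 : ε < 1) (I : InputGraph) (M : ℝ)
    (hM : M = min (Real.sqrt I.numVerts) (I.numVerts / I.avgDegree)) (s : ℕ)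
    (hs : M / 1000 ≤ s + 1) (T : ℕ) :
    1 - 1 / 1000 ≤ successProb EstState.query (EstState.step (sampleSize ε)) I
        (Set.Icc ((1 - ε) * I.avgDegree) ((1 + ε) * I.avgDegree)) (T + 4 * sampleSize ε s)
        (.est (sampleSize ε s) (sampleSize ε s) 0) := by
  have hμ : 1 ≤ I.avgDegree := I.one_le_avgDegree
  have hn := I.numVerts_pos
  have hN : 4000000 * (s + 1) / ε ^ 2 ≤ sampleSize ε s := Nat.le_ceil _
  have hN0 : (0 : ℝ) < sampleSize ε s := lt_of_lt_of_le (by positivity) hN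
  refine le_trans ?_ (le_successProb_est I (sampleSize ε) ε hε (sampleSize ε s)
    (by exact_mod_cast hN0) (sampleSize ε s) T 0)
  set N : ℝ := (sampleSize ε s : ℝ)
  set μ := I.avgDegree
  set n : ℝ := (I.numVerts : ℝ)
  rw [div_le_iff₀ (by positivity)] at hN
  -- For M = √n this uses d ≥ 1, and for M = n/d it uses d ≤ n.
  have hR : Real.sqrt (n * μ) ≤ M * μ := by
    have hμn : μ ≤ n := I.avgDegree_le_numVerts
    rw [hM]
    rcases min_choice (Real.sqrt n) (n / μ) with h | h <;> rw [h]
    · rw [Real.sqrt_mul hn.le]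
      gcongr
      rw [Real.sqrt_le_left (by linarith)]
      nlinarith
    · rw [div_mul_cancel₀ _ (by positivity), Real.sqrt_le_left hn.le]
      nlinarith
  refine sub_le_sub_left ?_ 1
  rw [zero_add, sub_self, zero_pow two_ne_zero, zero_add, div_le_div_iff₀ (by positivity) (by norm_num)]
  have h1 : 4000 * M ≤ N * ε ^ 2 := by linarith
  have h2 : 4000 * Real.sqrt (n * μ) ≤ N * ε ^ 2 * μ := by nlinarith
  have h3 : 0 ≤ N * μ := by positivity
  nlinarith [mul_le_mul_of_nonneg_left h2 h3]

theorem exp_neg_eight_le : Real.exp (-8) ≤ 1 / 1000 := by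
  have h1 := Real.exp_one_gt_d9
  have h2 : Real.exp 8 = Real.exp 1 ^ 8 := by
    rw [← Real.exp_nat_mul]; norm_num
  rw [Real.exp_neg, inv_eq_one_div]
  refine one_div_le_one_div_of_le (by norm_num) ?_
  rw [h2]
  calc (1000 : ℝ) ≤ 2.7 ^ 8 := by norm_num
    _ ≤ _ := by gcongr; linarith

theorem query_ne_fullNbrHood (s : EstState) (x : ℕ) :
    s.query ≠ Sum.inl (Query.fullNbrHood x) := by
  rcases s with _ | _ | _ | ⟨N, _ | k, acc⟩ | _ | _ | _ <;> simp [EstState.query]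

/-- Exploration followed by estimation approximates the average degree within the stated number
of queries. -/
theorem exists_estimation_algorithm :
    ∃ C : ℝ, 0 < C ∧ ∀ ε : ℝ, 0 < ε → ε < 1 →
      ∃ A : Algorithm, A.IsStandard ∧
        ∀ I : InputGraph,
          99 / 100 < A.probOutput I
            ⌊C * (ε ^ 2)⁻¹ * min (Real.sqrt I.numVerts) (I.numVerts / I.avgDegree)⌋₊
            (Set.Icc ((1 - ε) * I.avgDegree) ((1 + ε) * I.avgDegree)) := by
  -- The dominant cost is four queries for each of about 4000000 · 12M/ε² samples, that is 192000000
  -- M/ε²; the rest covers exploration and rounding.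
  refine ⟨200000000, by norm_num, fun ε hε hε1 =>
    ⟨machine EstState.query (EstState.step (sampleSize ε)) (.explore []), ?_, fun I => ?_⟩⟩
  · intro h x hx
    simp only [machine, PMF.support_pure, Set.mem_singleton_iff] at hx
    exact query_ne_fullNbrHood _ _ hx.symm
  have hμ : 1 ≤ I.avgDegree := I.one_le_avgDegree
  have hn := I.numVerts_pos
  have hμn : I.avgDegree ≤ I.numVerts := I.avgDegree_le_numVerts
  set M := min (Real.sqrt I.numVerts) (I.numVerts / I.avgDegree) with hM
  have hM1 : 1 ≤ M := by
    refine le_min ?_ ?_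
    · rw [Real.one_le_sqrt]
      linarith
    · rw [le_div_iff₀ (by linarith)]
      linarith
  have hMn : M ^ 2 ≤ I.numVerts := by
    rw [← Real.sq_sqrt hn.le]
    gcongr
    exact min_le_left _ _
  have hMd : M * I.avgDegree ≤ I.numVerts := by
    rw [← le_div_iff₀ (by linarith)]
    exact min_le_right _ _
  -- The list should reach length s₀ to make the sample large enough, and should not reach length s₀
  -- + j, which bounds the cost.
  set s₀ := ⌊M / 1000⌋₊ with hs₀
  set j := ⌈8 * M⌉₊ + 1 with hj
  set B := 4 * sampleSize ε (s₀ + j) with hB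
  have hs₀M : (s₀ : ℝ) ≤ M / 1000 := Nat.floor_le (by positivity)
  have hMs₀ : M / 1000 < s₀ + 1 := Nat.lt_floor_add_one _
  have hj1 : 8 * M + 1 ≤ j := by
    rw [hj]; push_cast; linarith [Nat.le_ceil (8 * M)]
  have hj2 : (j : ℝ) ≤ 8 * M + 2 := by
    rw [hj]; push_cast; linarith [Nat.ceil_lt_add_one (show 0 ≤ 8 * M by positivity)]
  set budget := ⌊200000000 * (ε ^ 2)⁻¹ * M⌋₊ with hbudget
  have hε2 : 1 ≤ (ε ^ 2)⁻¹ := by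
    rw [one_le_inv₀ (by positivity)]
    nlinarith
  have hbud : B + 3 * j + 3 * s₀ ≤ budget := by
    apply Nat.le_floor
    have hsz : (sampleSize ε (s₀ + j) : ℝ) ≤ 4000000 * (s₀ + j + 1) * (ε ^ 2)⁻¹ + 1 := by
      have := Nat.ceil_lt_add_one (show 0 ≤ 4000000 * (((s₀ + j : ℕ) : ℝ) + 1) / ε ^ 2 by positivity)
      unfold sampleSize
      push_cast at this ⊢
      rw [div_eq_mul_inv] at this
      exact this.le
    rw [hB]
    push_cast
    have h1 : (s₀ : ℝ) + j + 1 ≤ 12 * M := by linarith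
    have h2 : (s₀ + j + 1) * (ε ^ 2)⁻¹ ≤ 12 * M * (ε ^ 2)⁻¹ := by gcongr
    have h3 : M * 1 ≤ M * (ε ^ 2)⁻¹ := by gcongr
    linarith
  obtain ⟨T, hT⟩ := Nat.exists_eq_add_of_le hbud
  have hmono : ∀ s, s < s₀ + j → sampleSize ε s ≤ sampleSize ε (s₀ + j) := by
    intro s hs
    unfold sampleSize
    gcongr
  set S := Set.Icc ((1 - ε) * I.avgDegree) ((1 + ε) * I.avgDegree)
  have hest : ∀ s, s₀ ≤ s → s < s₀ + j → ∀ T', 1 - 1 / 1000 ≤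
      successProb EstState.query (EstState.step (sampleSize ε)) I S (T' + B)
        (.est (sampleSize ε s) (sampleSize ε s) 0) := by
    intro s hs hs' T'
    obtain ⟨e, he⟩ := Nat.exists_eq_add_of_le (hmono s hs')
    have h1 : (s₀ : ℝ) ≤ s := by exact_mod_cast hs
    have := estimation_succeeds ε hε hε1 I M hM s (by linarith) (T' + 4 * e)
    rwa [show T' + 4 * e + 4 * sampleSize ε s = T' + B by rw [hB, he]; ring] at this
  have hexp : ∀ s : ℕ, Real.exp (-∑ i ∈ Finset.range j,
      max ((s + i : ℕ) : ℝ) I.avgDegree / I.numVerts) ≤ 1 / 1000 := by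
    intro s
    refine le_trans (Real.exp_le_exp.2 (neg_le_neg ?_)) exp_neg_eight_le
    rw [← Finset.sum_div, le_div_iff₀ hn]
    -- If M = √n, the growing list forces a repetition: the sum of i over i < j is at least 8M². If
    -- M = n/d, adjacent pairs do it: j · d ≥ 8Md.
    rcases min_choice (Real.sqrt I.numVerts) (I.numVerts / I.avgDegree) with h | h
    · have h1 : ∑ i ∈ Finset.range j, (i : ℝ) ≤
          ∑ i ∈ Finset.range j, max ((s + i : ℕ) : ℝ) I.avgDegree := by
        gcongr with i
        refine le_max_of_le_left ?_
        push_cast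
        linarith [(Nat.cast_nonneg s : (0 : ℝ) ≤ s)]
      refine le_trans ?_ h1
      have h2 : (∑ i ∈ Finset.range j, (i : ℝ)) * 2 = j * (j - 1) := by
        have := Finset.sum_range_id_mul_two j
        have h3 : ((j - 1 : ℕ) : ℝ) = (j : ℝ) - 1 := by
          rw [Nat.cast_sub (by omega)]; simp
        rw [← h3, ← Nat.cast_sum]
        exact_mod_cast this
      have h4 : (I.numVerts : ℝ) = M ^ 2 := by
        rw [hM, h, Real.sq_sqrt hn.le]
      rw [h4]
      nlinarith
    · have h1 : ∑ i ∈ Finset.range j, I.avgDegree ≤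
          ∑ i ∈ Finset.range j, max ((s + i : ℕ) : ℝ) I.avgDegree := by
        gcongr with i
        exact le_max_right _ _
      refine le_trans ?_ h1
      have h4 : (I.numVerts : ℝ) = M * I.avgDegree := by
        rw [hM, h]; field_simp
      rw [Finset.sum_const, Finset.card_range, nsmul_eq_mul, h4]
      nlinarith
  have hlate : ∀ l : List I.V, l.Nodup → l.length = s₀ → 1 - 2 / 1000 ≤
      successProb EstState.query (EstState.step (sampleSize ε)) I S (T + B + 3 * j)
        (.explore (l.map I.ident)) := by
    intro l hl hls
    have := le_successProb_explore_late I S (sampleSize ε) s₀ (s₀ + j) B (1 / 1000) (by norm_num)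
      hest j l hl (by omega) hls.ge T
    linarith [hexp l.length]
  have hearly := le_successProb_explore_early I S (sampleSize ε) s₀ (T + B + 3 * j) _
    (by norm_num) hlate s₀ [] List.nodup_nil (by simp)
  -- Here s₀² ≤ M²/10⁶ ≤ n/10⁶ and s₀d ≤ Md/1000 ≤ n/1000.
  have hfail : s₀ * ((s₀ + I.avgDegree) / I.numVerts) ≤ 2 / 1000 := by
    rw [← mul_div_assoc, div_le_iff₀ hn]
    have h0 : (0 : ℝ) ≤ s₀ := Nat.cast_nonneg _
    nlinarith
  rw [show T + B + 3 * j + 3 * s₀ = budget by omega, List.map_nil,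
    ← toReal_probOutput_machine] at hearly
  have hfin : (99 / 100 : ℝ) < ((machine EstState.query (EstState.step (sampleSize ε))
      (.explore [])).probOutput I budget S).toReal := by linarith
  have hfin' := (ENNReal.ofReal_lt_iff_lt_toReal (by norm_num) (toOuterMeasure_ne_top _ _)).2 hfin
  refine lt_of_eq_of_lt ?_ hfin'
  rw [ENNReal.ofReal_div_of_pos (by norm_num)]
  norm_num


/-! ### Dependence of the outcome on the number of allowed queries -/

theorem Algorithm.run_zero (A : Algorithm) (I : InputGraph) (h : List (Query × Answer)) :
    A.run I 0 h =
      (A h).bind (Sum.elim (fun _ => PMF.pure none) (fun y => PMF.pure (some y))) := by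
  rw [Algorithm.run, ← PMF.bind_pure_comp]
  congr 1
  funext x
  cases x <;> rfl

theorem Algorithm.run_succ (A : Algorithm) (I : InputGraph) (T : ℕ) (h : List (Query × Answer)) :
    A.run I (T + 1) h =
      (A h).bind (Sum.elim
        (fun q => (oracle I q).bind fun a => A.run I T ((q, a) :: h))
        (fun y => PMF.pure (some y))) := rfl

theorem toOuterMeasure_bind_mono {α β : Type*} (p : PMF α) (f g : α → PMF β) (E : Set β)
    (h : ∀ a, (f a).toOuterMeasure E ≤ (g a).toOuterMeasure E) :
    (p.bind f).toOuterMeasure E ≤ (p.bind g).toOuterMeasure E := by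
  rw [PMF.toOuterMeasure_bind_apply, PMF.toOuterMeasure_bind_apply]
  exact ENNReal.tsum_le_tsum fun a => mul_le_mul_right (h a) _

theorem toOuterMeasure_le_one {α : Type*} (p : PMF α) (E : Set α) : p.toOuterMeasure E ≤ 1 := by
  rw [PMF.toOuterMeasure_apply, ← p.tsum_coe]
  exact ENNReal.tsum_le_tsum fun a => Set.indicator_le_self _ _ a

theorem toOuterMeasure_add_compl {α : Type*} (p : PMF α) (E : Set α) :
    p.toOuterMeasure E + p.toOuterMeasure Eᶜ = 1 := by
  rw [PMF.toOuterMeasure_apply, PMF.toOuterMeasure_apply, ← ENNReal.tsum_add, ← p.tsum_coe]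
  exact tsum_congr fun a => congrFun (Set.indicator_self_add_compl E p) a

/-- A larger query limit changes only the runs with outcome `none`, so events that exclude `none`
cannot lose probability. -/
theorem Algorithm.run_mono (A : Algorithm) (I : InputGraph) {T T' : ℕ} (hT : T ≤ T')
    (h : List (Query × Answer)) {E : Set (Option ℝ)} (hE : none ∉ E) :
    (A.run I T h).toOuterMeasure E ≤ (A.run I T' h).toOuterMeasure E := by
  induction T generalizing T' h with
  | zero =>
    cases T' with
    | zero => exact le_rfl
    | succ T' =>
      rw [Algorithm.run_zero, Algorithm.run_succ]
      refine toOuterMeasure_bind_mono _ _ _ _ fun x => ?_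
      cases x <;> simp [hE]
  | succ T ih =>
    obtain ⟨T', rfl⟩ : ∃ S, T' = S + 1 := ⟨T' - 1, by omega⟩
    rw [Algorithm.run_succ, Algorithm.run_succ]
    refine toOuterMeasure_bind_mono _ _ _ _ fun x => ?_
    cases x with
    | inl q => exact toOuterMeasure_bind_mono _ _ _ _ fun a => ih (by omega) _
    | inr y => exact le_rfl

/-- Runs that stop within T queries keep their output under any larger limit; only the mass of
`none` can still move into S. Thus correctness without a query limit says something about truncated
runs. -/
theorem Algorithm.probOutput_le_add (A : Algorithm) (I : InputGraph) (T T' : ℕ) (S : Set ℝ) :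
    A.probOutput I T' S ≤ A.probOutput I T S + A.probMoreQueries I T := by
  have hm : A.probOutput I T' S ≤ A.probOutput I (max T T') S :=
    A.run_mono I (le_max_right _ _) _ (by simp)
  have h1 := toOuterMeasure_add_compl (A.run I (max T T') []) (some '' S)
  have h2 := toOuterMeasure_add_compl (A.run I T []) (some '' S)
  have h3 : (A.run I T []).toOuterMeasure (some '' S)ᶜ ≤
      (A.run I T []).toOuterMeasure (some '' Sᶜ) + A.probMoreQueries I T := by
    rw [Algorithm.probMoreQueries, ← PMF.toOuterMeasure_apply_singleton]
    refine le_trans (MeasureTheory.OuterMeasure.mono _ ?_) (MeasureTheory.measure_union_le _ _)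
    rintro (_ | y) hy
    · simp
    · simp_all
  have h4 : (A.run I T []).toOuterMeasure (some '' Sᶜ) ≤
      (A.run I (max T T') []).toOuterMeasure (some '' Sᶜ) :=
    A.run_mono I (le_max_left _ _) _ (by simp)
  have h5 : (A.run I (max T T') []).toOuterMeasure (some '' Sᶜ) ≤
      (A.run I (max T T') []).toOuterMeasure (some '' S)ᶜ := by
    refine MeasureTheory.OuterMeasure.mono _ ?_
    rintro _ ⟨y, hy, rfl⟩
    simpa using hy
  change (A.run I T' []).toOuterMeasure (some '' S) ≤ (A.run I (max T T') []).toOuterMeasure _ at hm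
  change (A.run I T' []).toOuterMeasure (some '' S) ≤ (A.run I T []).toOuterMeasure _ + _
  set c := (A.run I (max T T') []).toOuterMeasure (some '' S)ᶜ
  have hc : c ≠ ⊤ := toOuterMeasure_ne_top _ _
  refine hm.trans ((ENNReal.add_le_add_iff_right hc).1 ?_)
  rw [h1, ← h2, add_assoc]
  gcongr
  rw [add_comm]
  exact h3.trans (by gcongr; exact h4.trans h5)

theorem Algorithm.probOutput_add_le_one (A : Algorithm) (I : InputGraph) (T T' : ℕ)
    {S S' : Set ℝ} (hS : Disjoint S S') : A.probOutput I T S + A.probOutput I T' S' ≤ 1 := by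
  have hm : A.probOutput I T S ≤ A.probOutput I (max T T') S :=
    A.run_mono I (le_max_left _ _) _ (by simp)
  have hm' : A.probOutput I T' S' ≤ A.probOutput I (max T T') S' :=
    A.run_mono I (le_max_right _ _) _ (by simp)
  refine (add_le_add hm hm').trans ?_
  rw [← toOuterMeasure_add_compl (A.run I (max T T') []) (some '' S)]
  refine add_le_add le_rfl (MeasureTheory.OuterMeasure.mono _ ?_)
  rintro _ ⟨y, hy, rfl⟩
  simpa using fun hy' => Set.disjoint_left.1 hS hy' hy

/-! ### Runs weighted by the likelihood of the history -/

/-- The probability that the oracles answer as in the history to the queries in it. -/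
def likelihood (I : InputGraph) (h : List (Query × Answer)) : ℝ≥0∞ :=
  (h.map fun qa => oracle I qa.1 qa.2).prod

/-- The weight of the event `E` for an algorithm whose queries are answered such that a history
has the weight `Φ`. -/
def weightedRun (A : Algorithm) (Φ : List (Query × Answer) → ℝ≥0∞) (E : Set (Option ℝ)) :
    ℕ → List (Query × Answer) → ℝ≥0∞
  | 0, h => Φ h *
      ((A h).bind (Sum.elim (fun _ => PMF.pure none) (fun y => PMF.pure (some y)))).toOuterMeasure E
  | T + 1, h => ∑' x, A h x * Sum.elim (fun q => ∑' a, weightedRun A Φ E T ((q, a) :: h))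
      (fun y => Φ h * (PMF.pure (some y)).toOuterMeasure E) x

/-- The probability of a transcript factors into the choices of the algorithm, which do not depend
on the input, and the likelihood of the answers. -/
theorem weightedRun_likelihood (A : Algorithm) (I : InputGraph) (E : Set (Option ℝ)) (T : ℕ)
    (h : List (Query × Answer)) :
    weightedRun A (likelihood I) E T h =
      likelihood I h * (A.run I T h).toOuterMeasure E := by
  induction T generalizing h with
  | zero => rw [weightedRun, Algorithm.run_zero]
  | succ T ih =>
    rw [weightedRun, Algorithm.run_succ, PMF.toOuterMeasure_bind_apply, ← ENNReal.tsum_mul_left]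
    refine tsum_congr fun x => ?_
    rw [mul_left_comm]
    congr 1
    cases x with
    | inr y => rfl
    | inl q =>
      simp only [Sum.elim_inl]
      rw [PMF.toOuterMeasure_bind_apply, ← ENNReal.tsum_mul_left]
      refine tsum_congr fun a => ?_
      rw [ih, likelihood, likelihood, List.map_cons, List.prod_cons]
      ring

/-- Linearity in the weight lets an average over inputs be treated as a single averaged likelihood.
-/
theorem weightedRun_sum {ι : Type*} (s : Finset ι) (A : Algorithm)
    (Φ : ι → List (Query × Answer) → ℝ≥0∞) (E : Set (Option ℝ)) (T : ℕ)
    (h : List (Query × Answer)) :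
    weightedRun A (fun h => ∑ i ∈ s, Φ i h) E T h = ∑ i ∈ s, weightedRun A (Φ i) E T h := by
  induction T generalizing h with
  | zero => simp only [weightedRun, Finset.sum_mul]
  | succ T ih =>
    simp only [weightedRun]
    rw [← Summable.tsum_finsetSum fun i _ => ENNReal.summable]
    refine tsum_congr fun x => ?_
    rw [← Finset.mul_sum]
    congr 1
    cases x with
    | inr y => simp only [Sum.elim_inr, Finset.sum_mul]
    | inl q =>
      simp only [Sum.elim_inl]
      rw [← Summable.tsum_finsetSum fun i _ => ENNReal.summable]
      exact tsum_congr fun a => ih _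

theorem weightedRun_const_mul (c : ℝ≥0∞) (A : Algorithm) (Φ : List (Query × Answer) → ℝ≥0∞)
    (E : Set (Option ℝ)) (T : ℕ) (h : List (Query × Answer)) :
    weightedRun A (fun h => c * Φ h) E T h = c * weightedRun A Φ E T h := by
  induction T generalizing h with
  | zero => simp only [weightedRun, mul_assoc]
  | succ T ih =>
    simp only [weightedRun]
    rw [← ENNReal.tsum_mul_left]
    refine tsum_congr fun x => ?_
    rw [mul_left_comm]
    congr 1
    cases x with
    | inr y => simp only [Sum.elim_inr, mul_assoc]
    | inl q =>
      simp only [Sum.elim_inl]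
      rw [← ENNReal.tsum_mul_left]
      exact tsum_congr fun a => ih _

/-- The choices of the algorithm contribute the same factors for every weight, so it is enough to
compare weights history by history. The invariant P restricts this to histories that the algorithm
can produce, such as those without full neighborhood queries. -/
theorem weightedRun_mono (A : Algorithm) {Φ Ψ : List (Query × Answer) → ℝ≥0∞}
    (P : List (Query × Answer) → Prop) (n : ℕ)
    (hP : ∀ h q a, P h → Sum.inl q ∈ (A h).support → P ((q, a) :: h))
    (hle : ∀ h, P h → h.length ≤ n → Ψ h ≤ Φ h) (E : Set (Option ℝ)) (T : ℕ)
    (h : List (Query × Answer)) (hPh : P h) (hn : h.length + T ≤ n) :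
    weightedRun A Ψ E T h ≤ weightedRun A Φ E T h := by
  induction T generalizing h with
  | zero => exact mul_le_mul_left (hle h hPh (by omega)) _
  | succ T ih =>
    simp only [weightedRun]
    refine ENNReal.tsum_le_tsum fun x => ?_
    by_cases hx : x ∈ (A h).support
    · refine mul_le_mul_right ?_ _
      cases x with
      | inr y => exact mul_le_mul_left (hle h hPh (by omega)) _
      | inl q =>
        refine ENNReal.tsum_le_tsum fun a => ih _ (hP h q a hPh hx) ?_
        simp only [List.length_cons]
        omega
    · rw [PMF.mem_support_iff, not_not] at hx
      rw [hx, zero_mul, zero_mul]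

theorem weightedRun_univ_le (A : Algorithm) (Φ : List (Query × Answer) → ℝ≥0∞)
    (E : Set (Option ℝ)) (T : ℕ) (h : List (Query × Answer)) :
    weightedRun A Φ Set.univ T h ≤ weightedRun A Φ E T h + weightedRun A Φ Eᶜ T h := by
  induction T generalizing h with
  | zero =>
    simp only [weightedRun]
    rw [← mul_add, toOuterMeasure_add_compl]
    exact mul_le_mul_right (toOuterMeasure_le_one _ _) _
  | succ T ih =>
    simp only [weightedRun]
    rw [← ENNReal.tsum_add]
    refine ENNReal.tsum_le_tsum fun x => ?_
    rw [← mul_add]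
    refine mul_le_mul_right ?_ _
    cases x with
    | inr y =>
      simp only [Sum.elim_inr]
      rw [← mul_add, toOuterMeasure_add_compl]
      exact mul_le_mul_right (toOuterMeasure_le_one _ _) _
    | inl q =>
      simp only [Sum.elim_inl]
      rw [← ENNReal.tsum_add]
      exact ENNReal.tsum_le_tsum fun a => ih _

/-- If each further answer preserves at least the fraction ρ of the weight, T answers preserve ρ^T,
and stopping earlier loses less. -/
theorem le_weightedRun_univ (A : Algorithm) {Ψ : List (Query × Answer) → ℝ≥0∞} (ρ : ℝ≥0∞)
    (hρ : ρ ≤ 1) (n : ℕ)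
    (hΨ : ∀ h q, h.length < n → ρ * Ψ h ≤ ∑' a, Ψ ((q, a) :: h)) (T : ℕ)
    (h : List (Query × Answer)) (hn : h.length + T ≤ n) :
    ρ ^ T * Ψ h ≤ weightedRun A Ψ Set.univ T h := by
  have huniv : ∀ {α : Type} (p : PMF α), p.toOuterMeasure Set.univ = 1 := fun p => by
    simpa using toOuterMeasure_add_compl p Set.univ
  induction T generalizing h with
  | zero => simp only [weightedRun, huniv, pow_zero, one_mul, mul_one, le_refl]
  | succ T ih =>
    simp only [weightedRun, huniv, mul_one]
    calc ρ ^ (T + 1) * Ψ h = ∑' x, A h x * (ρ ^ (T + 1) * Ψ h) := by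
          rw [ENNReal.tsum_mul_right, (A h).tsum_coe, one_mul]
      _ ≤ _ := ENNReal.tsum_le_tsum fun x => mul_le_mul_right ?_ _
    cases x with
    | inr y =>
      simp only [Sum.elim_inr]
      calc ρ ^ (T + 1) * Ψ h ≤ 1 * Ψ h := by gcongr; exact pow_le_one₀ (by simp) hρ
        _ = Ψ h := one_mul _
    | inl q =>
      simp only [Sum.elim_inl]
      calc ρ ^ (T + 1) * Ψ h = ρ ^ T * (ρ * Ψ h) := by ring
        _ ≤ ρ ^ T * ∑' a, Ψ ((q, a) :: h) := by gcongr; exact hΨ h q (by omega)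
        _ = ∑' a, ρ ^ T * Ψ ((q, a) :: h) := ENNReal.tsum_mul_left.symm
        _ ≤ _ := ENNReal.tsum_le_tsum fun a => ih _ (by simp only [List.length_cons]; omega)

/-! ### The indistinguishability argument -/

/-- The average likelihood over a finite family of inputs. -/
def meanLikelihood {Ω : Type*} [Fintype Ω] (I : Ω → InputGraph) (h : List (Query × Answer)) :
    ℝ≥0∞ :=
  (Fintype.card Ω : ℝ≥0∞)⁻¹ * ∑ ω, likelihood (I ω) h

theorem weightedRun_meanLikelihood {Ω : Type*} [Fintype Ω] (A : Algorithm) (I : Ω → InputGraph)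
    (E : Set (Option ℝ)) (T : ℕ) :
    weightedRun A (meanLikelihood I) E T [] =
      (Fintype.card Ω : ℝ≥0∞)⁻¹ * ∑ ω, ((A.run (I ω) T []).toOuterMeasure E) := by
  unfold meanLikelihood
  rw [weightedRun_const_mul, weightedRun_sum]
  congr 1
  refine Finset.sum_congr rfl fun ω _ => ?_
  rw [weightedRun_likelihood]
  simp [likelihood]

theorem inv_card_mul_sum_le {Ω : Type*} [Fintype Ω] [Nonempty Ω] (f : Ω → ℝ≥0∞) (c : ℝ≥0∞)
    (h : ∀ ω, f ω ≤ c) : (Fintype.card Ω : ℝ≥0∞)⁻¹ * ∑ ω, f ω ≤ c := by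
  calc (Fintype.card Ω : ℝ≥0∞)⁻¹ * ∑ ω, f ω ≤ (Fintype.card Ω : ℝ≥0∞)⁻¹ * ∑ ω : Ω, c := by
        gcongr with ω; exact h ω
    _ = c := by
      rw [Finset.sum_const, Finset.card_univ, nsmul_eq_mul, ← mul_assoc,
        ENNReal.inv_mul_cancel (by simp) (by simp), one_mul]

theorem le_inv_card_mul_sum {Ω : Type*} [Fintype Ω] [Nonempty Ω] (f : Ω → ℝ≥0∞) (c : ℝ≥0∞)
    (h : ∀ ω, c ≤ f ω) : c ≤ (Fintype.card Ω : ℝ≥0∞)⁻¹ * ∑ ω, f ω := by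
  calc c = (Fintype.card Ω : ℝ≥0∞)⁻¹ * ∑ ω : Ω, c := by
          rw [Finset.sum_const, Finset.card_univ, nsmul_eq_mul, ← mul_assoc,
            ENNReal.inv_mul_cancel (by simp) (by simp), one_mul]
    _ ≤ _ := by gcongr with ω; exact h ω

/-- If the histories of two families of inputs both dominate the same weight of almost full mass,
and the sets of correct outputs are disjoint, then many queries are needed on some input of the
first family. -/
theorem exists_probMoreQueries {Ω Ω' : Type*} [Fintype Ω] [Nonempty Ω] [Fintype Ω'] [Nonempty Ω']
    (A : Algorithm) (I : Ω → InputGraph) (I' : Ω' → InputGraph) (T : ℕ) {S S' : Set ℝ}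
    (hS : Disjoint S S')
    (hI : ∀ ω, ∃ t, 2 / 3 < A.probOutput (I ω) t S)
    (hI' : ∀ ω, ∃ t, 2 / 3 < A.probOutput (I' ω) t S')
    (P : List (Query × Answer) → Prop) (hP0 : P [])
    (hP : ∀ h q a, P h → Sum.inl q ∈ (A h).support → P ((q, a) :: h))
    (Ψ : List (Query × Answer) → ℝ≥0∞)
    (hle : ∀ h, P h → h.length ≤ T → ENNReal.ofReal (24 / 25) * Ψ h ≤ meanLikelihood I h)
    (hle' : ∀ h, P h → h.length ≤ T → ENNReal.ofReal (24 / 25) * Ψ h ≤ meanLikelihood I' h)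
    (hmass : ENNReal.ofReal (24 / 25) ≤ weightedRun A Ψ Set.univ T []) :
    ∃ ω, 1 / 4 ≤ A.probMoreQueries (I ω) T := by
  by_contra hc
  push Not at hc
  set E : Set (Option ℝ) := some '' S
  set c := ENNReal.ofReal (24 / 25) with hcdef
  have hf := weightedRun_mono A P T hP hle' E T [] hP0 (by simp)
  have hg := weightedRun_mono A P T hP hle Eᶜ T [] hP0 (by simp)
  rw [weightedRun_const_mul, weightedRun_meanLikelihood] at hf hg
  have h1 := hmass.trans (weightedRun_univ_le A Ψ E T [])
  have h2 : c * c ≤ c * weightedRun A Ψ E T [] + c * weightedRun A Ψ Eᶜ T [] := by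
    rw [← mul_add]
    exact mul_le_mul_right h1 _
  set p := (Fintype.card Ω : ℝ≥0∞)⁻¹ * ∑ ω, ((A.run (I ω) T []).toOuterMeasure E) with hp
  have h3 : (Fintype.card Ω : ℝ≥0∞)⁻¹ * ∑ ω, ((A.run (I ω) T []).toOuterMeasure Eᶜ) + p = 1 := by
    rw [hp, ← mul_add, ← Finset.sum_add_distrib]
    simp only [add_comm, toOuterMeasure_add_compl]
    rw [Finset.sum_const, Finset.card_univ, nsmul_eq_mul, mul_one,
      ENNReal.inv_mul_cancel (by simp) (by simp)]
  have h4 : ENNReal.ofReal (5 / 12) ≤ p := by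
    refine le_inv_card_mul_sum _ _ fun ω => ?_
    obtain ⟨t, ht⟩ := hI ω
    have h5 := (ht.le.trans (A.probOutput_le_add (I ω) T t S)).trans (add_le_add_right (hc ω).le _)
    have h6 : (2 / 3 : ℝ≥0∞) = ENNReal.ofReal (5 / 12) + 1 / 4 := by
      have e1 : (1 / 4 : ℝ≥0∞) = ENNReal.ofReal (1 / 4) := by
        rw [ENNReal.ofReal_div_of_pos (by norm_num)]; norm_num
      have e2 : (2 / 3 : ℝ≥0∞) = ENNReal.ofReal (2 / 3) := by
        rw [ENNReal.ofReal_div_of_pos (by norm_num)]; norm_num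
      rw [e1, e2, ← ENNReal.ofReal_add (by norm_num) (by norm_num)]
      norm_num
    rw [h6] at h5
    exact (ENNReal.add_le_add_iff_right (by finiteness)).1 h5
  have h7 : (Fintype.card Ω' : ℝ≥0∞)⁻¹ * ∑ ω, ((A.run (I' ω) T []).toOuterMeasure E) ≤
      ENNReal.ofReal (1 / 3) := by
    refine inv_card_mul_sum_le _ _ fun ω => ?_
    obtain ⟨t, ht⟩ := hI' ω
    have h5 := A.probOutput_add_le_one (I' ω) T t hS
    have h6 : (1 : ℝ≥0∞) = ENNReal.ofReal (1 / 3) + 2 / 3 := by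
      have e2 : (2 / 3 : ℝ≥0∞) = ENNReal.ofReal (2 / 3) := by
        rw [ENNReal.ofReal_div_of_pos (by norm_num)]; norm_num
      rw [e2, ← ENNReal.ofReal_add (by norm_num) (by norm_num)]
      norm_num
    rw [h6] at h5
    have h8 := (add_le_add_right ht.le _).trans h5
    exact (ENNReal.add_le_add_iff_right (ENNReal.div_ne_top (by simp) (by simp))).1 h8
  -- Within T queries the first family outputs a value in S with probability at least 2/3 − 1/4 =
  -- 5/12, and the second with probability at most 1/3. So the common part has mass at most 1/3 +
  -- 7/12 = 11/12, whereas (24/25)² = 0.9216 is larger.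
  have h9 : c * c + ENNReal.ofReal (5 / 12) ≤ ENNReal.ofReal (1 / 3) + 1 := by
    calc c * c + ENNReal.ofReal (5 / 12) ≤
          (c * weightedRun A Ψ E T [] + c * weightedRun A Ψ Eᶜ T []) + p := by gcongr
      _ ≤ _ := by
        rw [← h3, ← add_assoc]
        gcongr
        exact hf.trans h7
  rw [hcdef, ← ENNReal.ofReal_mul (by norm_num), ← ENNReal.ofReal_add (by norm_num) (by norm_num),
    ← ENNReal.ofReal_one, ← ENNReal.ofReal_add (by norm_num) (by norm_num),
    ENNReal.ofReal_le_ofReal_iff (by norm_num)] at h9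
  norm_num at h9


/-! ### Components found by an algorithm

The knowledge of an algorithm about a disjoint union of cliques is a list of pairs `(x, r)` of a
known label `x` and a label `r`, the root, which is the first known label in the clique
of `x`. -/

/-- The known labels in the component with root `r`. -/
def members (cs : List (ℕ × ℕ)) (r : ℕ) : List ℕ := (cs.filter fun p => p.2 = r).map Prod.fst

/-- Labels are distinct, and roots come first. -/
def ValidComps : List (ℕ × ℕ) → Prop
  | [] => True
  | p :: cs => p.1 ∉ cs.map Prod.fst ∧ (p.1 = p.2 ∨ (p.2, p.2) ∈ cs) ∧ ValidComps cs

theorem mem_members {cs : List (ℕ × ℕ)} {x r : ℕ} : x ∈ members cs r ↔ (x, r) ∈ cs := by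
  simp [members]

namespace ValidComps

theorem nodup_labels {cs : List (ℕ × ℕ)} (h : ValidComps cs) : (cs.map Prod.fst).Nodup := by
  induction cs with
  | nil => simp
  | cons p cs ih => exact List.nodup_cons.2 ⟨h.1, ih h.2.2⟩

theorem root_mem {cs : List (ℕ × ℕ)} (h : ValidComps cs) {x r : ℕ} (hx : (x, r) ∈ cs) :
    (r, r) ∈ cs := by
  induction cs with
  | nil => simp at hx
  | cons p cs ih =>
    rcases List.mem_cons.1 hx with rfl | hx
    · rcases h.2.1 with h' | h'
      · simp only at h'
        subst h'
        exact List.mem_cons_self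
      · exact List.mem_cons_of_mem _ h'
    · exact List.mem_cons_of_mem _ (ih h.2.2 hx)

theorem nodup_members {cs : List (ℕ × ℕ)} (h : ValidComps cs) (r : ℕ) : (members cs r).Nodup := by
  refine List.Nodup.sublist ?_ h.nodup_labels
  exact List.Sublist.map _ List.filter_sublist

theorem ne_of_cons {p : ℕ × ℕ} {cs : List (ℕ × ℕ)} (h : ValidComps (p :: cs)) {x r : ℕ}
    (hx : (x, r) ∈ cs) : x ≠ p.1 ∧ r ≠ p.1 := by
  refine ⟨fun he => h.1 ?_, fun he => h.1 ?_⟩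
  · exact List.mem_map.2 ⟨_, hx, he⟩
  · exact List.mem_map.2 ⟨_, h.2.2.root_mem hx, he⟩

end ValidComps

/-! ### Independent placements of the known components in the classes of size a. -/

section Placements

variable {V K : Type} [Fintype V] [DecidableEq K] (cls : V → K) (a : ℕ)

/-- The class of a vertex. -/
def cluster (v : V) : Finset V := Finset.univ.filter fun w => cls w = cls v

/-- The vertices in the classes of size `a`. -/
def regularVerts : Finset V := Finset.univ.filter fun v => (cluster cls v).card = a

variable {cls a} in
theorem mem_cluster {v w : V} : w ∈ cluster cls v ↔ cls w = cls v := by simp [cluster]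

variable {cls a} in
theorem cluster_congr {v w : V} (h : cls v = cls w) : cluster cls v = cluster cls w := by
  simp [cluster, h]

variable {cls a} in
theorem mem_regularVerts {v : V} : v ∈ regularVerts cls a ↔ (cluster cls v).card = a := by
  simp [regularVerts]

variable [Nonempty V] [DecidableEq V]

/-- The vertices that can carry the label `p.1` in the component with root `p.2`, given the
placement `φ` of the labels that were found earlier. -/
def candidates (cs : List (ℕ × ℕ)) (φ : ℕ → V) (p : ℕ × ℕ) : Finset V :=
  if p.1 = p.2 then regularVerts cls a
  else cluster cls (φ p.2) \ (members cs p.2).toFinset.image φ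

/-- The sum of a function over all placements of the labels in the classes of size `a`, where the
components are placed independently of each other. -/
def placeSum : List (ℕ × ℕ) → ((ℕ → V) → ℝ) → ℝ
  | [], f => f fun _ => Classical.arbitrary V
  | p :: cs, f => placeSum cs fun φ => ∑ v ∈ candidates cls a cs φ p, f (Function.update φ p.1 v)

/-- The labels in a component are in the same class of size `a`, at distinct vertices. -/
def IsPlacement (cs : List (ℕ × ℕ)) (φ : ℕ → V) : Prop :=
  (∀ x r, (x, r) ∈ cs → φ x ∈ regularVerts cls a ∧ cls (φ x) = cls (φ r)) ∧
    ∀ x y r, (x, r) ∈ cs → (y, r) ∈ cs → φ x = φ y → x = y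

variable {cls a}

set_option linter.unusedSectionVars false

/-- The number of positions for the next label does not depend on the placement of the earlier
labels; this is what makes the total count a product. -/
theorem IsPlacement.card_candidates {cs : List (ℕ × ℕ)} {φ : ℕ → V} (hφ : IsPlacement cls a cs φ)
    {p : ℕ × ℕ} (h : ValidComps (p :: cs)) :
    (candidates cls a cs φ p).card + (if p.1 = p.2 then 0 else (members cs p.2).length) =
      if p.1 = p.2 then (regularVerts cls a).card else a := by
  unfold candidates
  split_ifs with hp
  · rfl
  · have hr : (p.2, p.2) ∈ cs := h.2.1.resolve_left hp
    have hsub : (members cs p.2).toFinset.image φ ⊆ cluster cls (φ p.2) := by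
      intro v hv
      simp only [Finset.mem_image, List.mem_toFinset, mem_members] at hv
      obtain ⟨x, hx, rfl⟩ := hv
      exact mem_cluster.2 (hφ.1 x _ hx).2
    have hcard : ((members cs p.2).toFinset.image φ).card = (members cs p.2).length := by
      rw [Finset.card_image_of_injOn, List.toFinset_card_of_nodup (h.2.2.nodup_members _)]
      intro x hx y hy hxy
      simp only [List.coe_toFinset, Set.mem_ofPred_eq, mem_members] at hx hy
      exact hφ.2 x y _ hx hy hxy
    rw [Finset.card_sdiff_of_subset hsub, hcard, ← hcard,
      Nat.sub_add_cancel (Finset.card_le_card hsub)]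
    exact mem_regularVerts.1 (hφ.1 _ _ hr).1

theorem IsPlacement.cast_card_candidates {cs : List (ℕ × ℕ)} {φ : ℕ → V}
    (hφ : IsPlacement cls a cs φ) {p : ℕ × ℕ} (h : ValidComps (p :: cs)) :
    ((candidates cls a cs φ p).card : ℝ) =
      if p.1 = p.2 then ((regularVerts cls a).card : ℝ) else a - (members cs p.2).length := by
  have := hφ.card_candidates h
  split_ifs with hp
  · simpa [hp] using this
  · rw [if_neg hp, if_neg hp] at this
    rw [eq_sub_iff_add_eq]
    exact_mod_cast this

theorem IsPlacement.update {cs : List (ℕ × ℕ)} {φ : ℕ → V} (hφ : IsPlacement cls a cs φ)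
    {p : ℕ × ℕ} (h : ValidComps (p :: cs)) {v : V} (hv : v ∈ candidates cls a cs φ p) :
    IsPlacement cls a (p :: cs) (Function.update φ p.1 v) := by
  obtain ⟨u, r₀⟩ := p
  have hne : ∀ {x r}, (x, r) ∈ cs → x ≠ u ∧ r ≠ u := fun hx => h.ne_of_cons hx
  have hnew : v ∈ regularVerts cls a ∧
      cls v = cls (Function.update φ u v r₀) ∧ ∀ y, (y, r₀) ∈ cs → φ y ≠ v := by
    unfold candidates at hv
    split_ifs at hv with hu
    · simp only at hu
      subst hu
      refine ⟨hv, by simp, fun y hy => absurd rfl (hne hy).2⟩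
    · have hr : (r₀, r₀) ∈ cs := h.2.1.resolve_left hu
      simp only [Finset.mem_sdiff, mem_cluster, Finset.mem_image, List.mem_toFinset,
        mem_members, not_exists, not_and] at hv
      refine ⟨?_, ?_, fun y hy => hv.2 y hy⟩
      · rw [mem_regularVerts, cluster_congr hv.1]
        exact mem_regularVerts.1 (hφ.1 _ _ hr).1
      · rw [Function.update_of_ne (hne hr).1]
        exact hv.1
  refine ⟨fun x r hx => ?_, fun x y r hx hy hxy => ?_⟩
  · rcases List.mem_cons.1 hx with hx | hx
    · simp only [Prod.mk.injEq] at hx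
      obtain ⟨rfl, rfl⟩ := hx
      simpa using ⟨hnew.1, hnew.2.1⟩
    · simp only [Function.update_of_ne (hne hx).1, Function.update_of_ne (hne hx).2]
      exact hφ.1 x r hx
  · rw [List.mem_cons] at hx hy
    rcases hx with hx | hx <;> rcases hy with hy | hy
    · simp only [Prod.mk.injEq] at hx hy
      rw [hx.1, hy.1]
    · simp only [Prod.mk.injEq] at hx
      obtain ⟨rfl, rfl⟩ := hx
      simp only [Function.update_self, Function.update_of_ne (hne hy).1] at hxy
      exact absurd hxy.symm (hnew.2.2 y hy)
    · simp only [Prod.mk.injEq] at hy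
      obtain ⟨rfl, rfl⟩ := hy
      simp only [Function.update_self, Function.update_of_ne (hne hx).1] at hxy
      exact absurd hxy (hnew.2.2 x hx)
    · simp only [Function.update_of_ne (hne hx).1, Function.update_of_ne (hne hy).1] at hxy
      exact hφ.2 x y r hx hy hxy

theorem placeSum_mono {cs : List (ℕ × ℕ)} (h : ValidComps cs) {f g : (ℕ → V) → ℝ}
    (hfg : ∀ φ, IsPlacement cls a cs φ → f φ ≤ g φ) :
    placeSum cls a cs f ≤ placeSum cls a cs g := by
  induction cs generalizing f g with
  | nil => exact hfg _ ⟨by simp, by simp⟩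
  | cons p cs ih =>
    exact ih h.2.2 fun φ hφ => Finset.sum_le_sum fun v hv => hfg _ (hφ.update h hv)

theorem placeSum_congr {cs : List (ℕ × ℕ)} (h : ValidComps cs) {f g : (ℕ → V) → ℝ}
    (hfg : ∀ φ, IsPlacement cls a cs φ → f φ = g φ) :
    placeSum cls a cs f = placeSum cls a cs g :=
  le_antisymm (placeSum_mono h fun φ hφ => (hfg φ hφ).le)
    (placeSum_mono h fun φ hφ => (hfg φ hφ).ge)

variable (cls a)

theorem placeSum_sum {ι : Type*} (cs : List (ℕ × ℕ)) (s : Finset ι) (f : ι → (ℕ → V) → ℝ) :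
    placeSum cls a cs (fun φ => ∑ i ∈ s, f i φ) = ∑ i ∈ s, placeSum cls a cs (f i) := by
  induction cs generalizing f with
  | nil => rfl
  | cons p cs ih =>
    simp only [placeSum]
    rw [← ih]
    congr 1
    funext φ
    exact Finset.sum_comm

theorem placeSum_mul (cs : List (ℕ × ℕ)) (c : ℝ) (f : (ℕ → V) → ℝ) :
    placeSum cls a cs (fun φ => c * f φ) = c * placeSum cls a cs f := by
  induction cs generalizing f with
  | nil => rfl
  | cons p cs ih =>
    simp only [placeSum]
    rw [← ih]
    simp only [Finset.mul_sum]

theorem placeSum_add (cs : List (ℕ × ℕ)) (f g : (ℕ → V) → ℝ) :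
    placeSum cls a cs (fun φ => f φ + g φ) = placeSum cls a cs f + placeSum cls a cs g := by
  have := placeSum_sum cls a cs Finset.univ (fun b : Bool => bif b then f else g)
  simpa using this

theorem placeSum_sub (cs : List (ℕ × ℕ)) (f g : (ℕ → V) → ℝ) :
    placeSum cls a cs (fun φ => f φ - g φ) = placeSum cls a cs f - placeSum cls a cs g := by
  have := placeSum_add cls a cs f (fun φ => (-1) * g φ)
  rw [placeSum_mul] at this
  rw [sub_eq_add_neg, neg_eq_neg_one_mul, ← this]
  congr 1
  funext φ
  ring

theorem placeSum_nonneg {cs : List (ℕ × ℕ)} (h : ValidComps cs) {f : (ℕ → V) → ℝ}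
    (hf : ∀ φ, 0 ≤ f φ) : 0 ≤ placeSum cls a cs f := by
  have := placeSum_mono (cls := cls) (a := a) h (f := fun φ => 0 * f φ) (g := f)
    fun φ _ => by simpa using hf φ
  rw [placeSum_mul] at this
  simpa using this

/-- A function of the earlier labels only. -/
theorem placeSum_cons_of_old {p : ℕ × ℕ} {cs : List (ℕ × ℕ)} (h : ValidComps (p :: cs))
    (f : (ℕ → V) → ℝ) (hf : ∀ φ v, f (Function.update φ p.1 v) = f φ) :
    placeSum cls a (p :: cs) f =
      (if p.1 = p.2 then ((regularVerts cls a).card : ℝ) else a - (members cs p.2).length) *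
        placeSum cls a cs f := by
  simp only [placeSum, hf, Finset.sum_const, nsmul_eq_mul]
  rw [← placeSum_mul]
  refine placeSum_congr h.2.2 fun φ hφ => ?_
  rw [hφ.cast_card_candidates h]

/-- Under the uniform distribution on placements, the new label hits the vertex of y with
probability 1 over the number of regular vertices, and its class with a times that. For a root this
is a direct count. A non-root is uniform on the class of its root minus the vertices of known
members, so both statements about those members are used together. -/
theorem sum_candidates_eq (cs : List (ℕ × ℕ)) (p : ℕ × ℕ) (h : ValidComps (p :: cs)) {y r' : ℕ}
    (hy : (y, r') ∈ cs) (hroot : p.1 ≠ p.2 → ∀ z, (z, p.2) ∈ cs →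
      ((regularVerts cls a).card : ℝ) * placeSum cls a cs (fun φ => if φ z = φ y then 1 else 0) =
          placeSum cls a cs (fun _ => 1) ∧
        ((regularVerts cls a).card : ℝ) *
          placeSum cls a cs (fun φ => if cls (φ z) = cls (φ y) then 1 else 0) =
          a * placeSum cls a cs (fun _ => 1)) :
    ((regularVerts cls a).card : ℝ) *
        placeSum cls a (p :: cs) (fun φ => if φ p.1 = φ y then 1 else 0) =
          placeSum cls a (p :: cs) (fun _ => 1) ∧
      ((regularVerts cls a).card : ℝ) *
        placeSum cls a (p :: cs) (fun φ => if cls (φ p.1) = cls (φ y) then 1 else 0) =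
          a * placeSum cls a (p :: cs) (fun _ => 1) := by
  have hyp : y ≠ p.1 := (h.ne_of_cons hy).1
  rw [placeSum_cons_of_old cls a h (fun _ => 1) (fun _ _ => rfl)]
  simp only [placeSum, Function.update_self, Function.update_of_ne hyp]
  by_cases hp : p.1 = p.2
  · simp only [if_pos hp, candidates]
    constructor
    · congr 1
      refine placeSum_congr h.2.2 fun φ hφ => ?_
      rw [Finset.sum_ite_eq', if_pos (hφ.1 _ _ hy).1]
    · rw [mul_left_comm]
      congr 1
      rw [← placeSum_mul]
      refine placeSum_congr h.2.2 fun φ hφ => ?_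
      rw [Finset.sum_boole, mul_one, ← mem_regularVerts.1 (hφ.1 _ _ hy).1]
      congr 2
      ext v
      simp only [Finset.mem_filter, mem_cluster, and_iff_right_iff_imp]
      intro hv
      rw [mem_regularVerts, cluster_congr hv]
  · have hr₀ : (p.2, p.2) ∈ cs := h.2.1.resolve_left hp
    rw [if_neg hp]
    constructor
    · have h1 : placeSum cls a cs (fun φ => ∑ v ∈ candidates cls a cs φ p,
          if v = φ y then (1 : ℝ) else 0) =
          placeSum cls a cs (fun φ => if cls (φ p.2) = cls (φ y) then 1 else 0) -
          ∑ z ∈ (members cs p.2).toFinset,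
            placeSum cls a cs (fun φ => if φ z = φ y then 1 else 0) := by
        rw [← placeSum_sum, ← placeSum_sub]
        refine placeSum_congr h.2.2 fun φ hφ => ?_
        have hsub : (members cs p.2).toFinset.image φ ⊆ cluster cls (φ p.2) := by
          intro v hv
          simp only [Finset.mem_image, List.mem_toFinset, mem_members] at hv
          obtain ⟨x, hx, rfl⟩ := hv
          exact mem_cluster.2 (hφ.1 x _ hx).2
        simp only [candidates, if_neg hp]
        rw [Finset.sum_sdiff_eq_sub hsub, Finset.sum_ite_eq', Finset.sum_image]
        · simp only [mem_cluster, eq_comm]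
        · intro x hx y hy hxy
          simp only [List.coe_toFinset, Set.mem_ofPred_eq, mem_members] at hx hy
          exact hφ.2 x y _ hx hy hxy
      rw [h1, mul_sub, (hroot hp _ hr₀).2, Finset.mul_sum,
        Finset.sum_congr rfl fun z hz => (hroot hp z (by simpa [mem_members] using hz)).1,
        Finset.sum_const, List.toFinset_card_of_nodup (h.2.2.nodup_members _), nsmul_eq_mul]
      ring
    · have h1 : placeSum cls a cs (fun φ => ∑ v ∈ candidates cls a cs φ p,
          if cls v = cls (φ y) then (1 : ℝ) else 0) =
          (a - (members cs p.2).length : ℝ) *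
            placeSum cls a cs (fun φ => if cls (φ p.2) = cls (φ y) then 1 else 0) := by
        rw [← placeSum_mul]
        refine placeSum_congr h.2.2 fun φ hφ => ?_
        have hc := hφ.cast_card_candidates h
        rw [if_neg hp] at hc
        rw [← hc, ← nsmul_eq_mul, ← Finset.sum_const]
        refine Finset.sum_congr rfl fun v hv => ?_
        simp only [candidates, if_neg hp, Finset.mem_sdiff, mem_cluster] at hv
        rw [hv.1]
      rw [h1, mul_left_comm, (hroot hp _ hr₀).2]
      ring

/-- Labels in different components are placed independently. -/
theorem placeSum_cross {cs : List (ℕ × ℕ)} (h : ValidComps cs) {x r y r' : ℕ}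
    (hx : (x, r) ∈ cs) (hy : (y, r') ∈ cs) (hr : r ≠ r') :
    ((regularVerts cls a).card : ℝ) * placeSum cls a cs (fun φ => if φ x = φ y then 1 else 0) =
        placeSum cls a cs (fun _ => 1) ∧
      ((regularVerts cls a).card : ℝ) *
        placeSum cls a cs (fun φ => if cls (φ x) = cls (φ y) then 1 else 0) =
        a * placeSum cls a cs (fun _ => 1) := by
  induction cs generalizing x r y r' with
  | nil => simp at hx
  | cons p cs ih =>
    obtain ⟨u, r₀⟩ := p
    rw [List.mem_cons] at hx hy
    rcases hx with hx | hx <;> rcases hy with hy | hy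
    · simp only [Prod.mk.injEq] at hx hy
      exact absurd (hx.2.trans hy.2.symm) hr
    · simp only [Prod.mk.injEq] at hx
      obtain ⟨rfl, rfl⟩ := hx
      exact sum_candidates_eq cls a cs _ h hy fun _ z hz => ih h.2.2 hz hy hr
    · simp only [Prod.mk.injEq] at hy
      obtain ⟨rfl, rfl⟩ := hy
      have := sum_candidates_eq cls a cs _ h hx fun _ z hz => ih h.2.2 hz hx hr.symm
      simpa only [eq_comm] using this
    · have hx' := (h.ne_of_cons hx).1
      have hy' := (h.ne_of_cons hy).1
      rw [placeSum_cons_of_old cls a h (fun _ => 1) (fun _ _ => rfl),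
        placeSum_cons_of_old cls a h _ fun φ v => by
          rw [Function.update_of_ne hx', Function.update_of_ne hy'],
        placeSum_cons_of_old cls a h _ fun φ v => by
          rw [Function.update_of_ne hx', Function.update_of_ne hy']]
      obtain ⟨h1, h2⟩ := ih h.2.2 hx hy hr
      constructor
      · rw [mul_left_comm, h1]
      · rw [mul_left_comm, h2, mul_left_comm]

open Classical in
/-- Different components are at different vertices, and the pairs in `sep` are in different
classes. -/
def Separated (cs sep : List (ℕ × ℕ)) (φ : ℕ → V) : Prop :=
  (∀ x r y r', (x, r) ∈ cs → (y, r') ∈ cs → r ≠ r' → φ x ≠ φ y) ∧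
    ∀ x y, (x, y) ∈ sep → cls (φ x) ≠ cls (φ y)

/-- The pairs in `sep` are pairs of labels in different components. -/
def ValidSep (cs sep : List (ℕ × ℕ)) : Prop :=
  ∀ x y, (x, y) ∈ sep → ∃ r r', (x, r) ∈ cs ∧ (y, r') ∈ cs ∧ r ≠ r'

-- Union bound over pairs of labels: each pair from different components coincides with probability
-- 1 over the number of regular vertices, and each pair in `sep` shares a class with a times that
-- probability.
open Classical in
theorem le_placeSum_separated {cs sep : List (ℕ × ℕ)} (h : ValidComps cs) (hs : ValidSep cs sep) :
    ((regularVerts cls a).card - (cs.length : ℝ) ^ 2 - sep.length * a) *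
        placeSum cls a cs (fun _ => 1) ≤
      (regularVerts cls a).card *
        placeSum cls a cs (fun φ => if Separated cls cs sep φ then 1 else 0) := by
  set w : ℝ := ((regularVerts cls a).card : ℝ)
  have hw : 0 ≤ w := Nat.cast_nonneg _
  set k := placeSum cls a cs (fun _ => 1) with hk
  have hk0 : 0 ≤ k := placeSum_nonneg cls a h fun _ => zero_le_one
  have hpt : k - (∑ p ∈ cs.toFinset, ∑ p' ∈ cs.toFinset, placeSum cls a cs
        (fun φ => if p.2 ≠ p'.2 ∧ φ p.1 = φ p'.1 then 1 else 0)) -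
      ∑ q ∈ sep.toFinset, placeSum cls a cs (fun φ => if cls (φ q.1) = cls (φ q.2) then 1 else 0) ≤
      placeSum cls a cs (fun φ => if Separated cls cs sep φ then 1 else 0) := by
    simp only [← placeSum_sum]
    rw [hk, ← placeSum_sub, ← placeSum_sub]
    refine placeSum_mono h fun φ _ => ?_
    have hn1 : ∀ p ∈ cs.toFinset, (0 : ℝ) ≤ ∑ p' ∈ cs.toFinset,
        if p.2 ≠ p'.2 ∧ φ p.1 = φ p'.1 then (1 : ℝ) else 0 :=
      fun p _ => Finset.sum_nonneg fun p' _ => by split_ifs <;> norm_num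
    have hn2 : ∀ q ∈ sep.toFinset, (0 : ℝ) ≤ if cls (φ q.1) = cls (φ q.2) then (1 : ℝ) else 0 :=
      fun q _ => by split_ifs <;> norm_num
    have hs1 := Finset.sum_nonneg hn1
    have hs2 := Finset.sum_nonneg hn2
    split_ifs with hsep
    · linarith
    · rw [Separated, not_and_or] at hsep
      rcases hsep with hsep | hsep
      · push Not at hsep
        obtain ⟨x, r, y, r', hx, hy, hr, he⟩ := hsep
        have h1 := Finset.single_le_sum hn1 (List.mem_toFinset.2 hx)
        have h2 := Finset.single_le_sum (f := fun p' : ℕ × ℕ =>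
          if (x, r).2 ≠ p'.2 ∧ φ (x, r).1 = φ p'.1 then (1 : ℝ) else 0)
          (fun p' _ => by split_ifs <;> norm_num) (List.mem_toFinset.2 hy)
        simp only [ne_eq, hr, not_false_eq_true, he, and_self, if_true] at h1 h2
        linarith
      · push Not at hsep
        obtain ⟨x, y, hxy, he⟩ := hsep
        have h1 := Finset.single_le_sum hn2 (List.mem_toFinset.2 hxy)
        simp only [he, if_true] at h1
        linarith
  have h1 : w * (∑ p ∈ cs.toFinset, ∑ p' ∈ cs.toFinset, placeSum cls a cs
        (fun φ => if p.2 ≠ p'.2 ∧ φ p.1 = φ p'.1 then 1 else 0)) ≤ (cs.length : ℝ) ^ 2 * k := by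
    have hb : ∀ p ∈ cs.toFinset, ∀ p' ∈ cs.toFinset, w * placeSum cls a cs
        (fun φ => if p.2 ≠ p'.2 ∧ φ p.1 = φ p'.1 then 1 else 0) ≤ k := by
      intro p hp p' hp'
      by_cases hr : p.2 = p'.2
      · have : placeSum cls a cs (fun φ => if p.2 ≠ p'.2 ∧ φ p.1 = φ p'.1 then (1 : ℝ) else 0) =
            placeSum cls a cs (fun φ => 0 * 1) := by simp [hr]
        rw [this, placeSum_mul]
        simpa using hk0
      · simp only [ne_eq, hr, not_false_eq_true, true_and]
        exact (placeSum_cross cls a h (List.mem_toFinset.1 hp) (List.mem_toFinset.1 hp') hr).1.le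
    rw [Finset.mul_sum]
    simp only [Finset.mul_sum]
    refine (Finset.sum_le_sum fun p hp => Finset.sum_le_sum fun p' hp' => hb p hp p' hp').trans ?_
    simp only [Finset.sum_const, nsmul_eq_mul]
    have hl : (cs.toFinset.card : ℝ) ≤ cs.length := by exact_mod_cast cs.toFinset_card_le
    rw [← mul_assoc, sq]
    gcongr
  have h2 : w * ∑ q ∈ sep.toFinset,
      placeSum cls a cs (fun φ => if cls (φ q.1) = cls (φ q.2) then 1 else 0) ≤
        sep.length * a * k := by
    rw [Finset.mul_sum]
    have hb : ∀ q ∈ sep.toFinset, w * placeSum cls a cs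
        (fun φ => if cls (φ q.1) = cls (φ q.2) then 1 else 0) ≤ a * k := by
      intro q hq
      obtain ⟨r, r', hx, hy, hr⟩ := hs q.1 q.2 (List.mem_toFinset.1 hq)
      exact (placeSum_cross cls a h hx hy hr).2.le
    refine (Finset.sum_le_sum hb).trans ?_
    simp only [Finset.sum_const, nsmul_eq_mul]
    have hl : (sep.toFinset.card : ℝ) ≤ sep.length := by exact_mod_cast sep.toFinset_card_le
    rw [mul_assoc]
    gcongr
  have := mul_le_mul_of_nonneg_left hpt hw
  linarith

-- If separation fails, two components share a class, and then so do their roots. A union bound over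
-- pairs of roots thus covers both kinds of failure, however many labels a component has.
open Classical in
theorem le_placeSum_separated_of_roots {cs sep : List (ℕ × ℕ)} (h : ValidComps cs)
    (hs : ValidSep cs sep) :
    ((regularVerts cls a).card - ((cs.filter fun p => p.1 = p.2).length : ℝ) ^ 2 * a) *
        placeSum cls a cs (fun _ => 1) ≤
      (regularVerts cls a).card *
        placeSum cls a cs (fun φ => if Separated cls cs sep φ then 1 else 0) := by
  set w : ℝ := ((regularVerts cls a).card : ℝ)
  have hw : 0 ≤ w := Nat.cast_nonneg _
  set k := placeSum cls a cs (fun _ => 1) with hk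
  have hk0 : 0 ≤ k := placeSum_nonneg cls a h fun _ => zero_le_one
  set R := (cs.filter fun p => p.1 = p.2).toFinset with hR
  have hmemR : ∀ p, p ∈ R ↔ p ∈ cs ∧ p.1 = p.2 := fun p => by simp [hR]
  have hpt : k - (∑ p ∈ R, ∑ p' ∈ R, placeSum cls a cs
        (fun φ => if p.2 ≠ p'.2 ∧ cls (φ p.1) = cls (φ p'.1) then 1 else 0)) ≤
      placeSum cls a cs (fun φ => if Separated cls cs sep φ then 1 else 0) := by
    simp only [← placeSum_sum]
    rw [hk, ← placeSum_sub]
    refine placeSum_mono h fun φ hφ => ?_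
    have hn1 : ∀ p ∈ R, (0 : ℝ) ≤ ∑ p' ∈ R,
        if p.2 ≠ p'.2 ∧ cls (φ p.1) = cls (φ p'.1) then (1 : ℝ) else 0 :=
      fun p _ => Finset.sum_nonneg fun p' _ => by split_ifs <;> norm_num
    have hs1 := Finset.sum_nonneg hn1
    split_ifs with hsep
    · linarith
    · obtain ⟨x, r, y, r', hx, hy, hr, he⟩ : ∃ x r y r', (x, r) ∈ cs ∧ (y, r') ∈ cs ∧ r ≠ r' ∧
          cls (φ x) = cls (φ y) := by
        rw [Separated, not_and_or] at hsep
        rcases hsep with hsep | hsep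
        · push Not at hsep
          obtain ⟨x, r, y, r', hx, hy, hr, he⟩ := hsep
          exact ⟨x, r, y, r', hx, hy, hr, by rw [he]⟩
        · push Not at hsep
          obtain ⟨x, y, hxy, he⟩ := hsep
          obtain ⟨r, r', hx, hy, hr⟩ := hs x y hxy
          exact ⟨x, r, y, r', hx, hy, hr, he⟩
      have he' : cls (φ r) = cls (φ r') := by
        rw [← (hφ.1 _ _ hx).2, ← (hφ.1 _ _ hy).2, he]
      have h1 := Finset.single_le_sum hn1 ((hmemR _).2 ⟨h.root_mem hx, rfl⟩)
      have h2 := Finset.single_le_sum (f := fun p' : ℕ × ℕ =>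
        if (r, r).2 ≠ p'.2 ∧ cls (φ (r, r).1) = cls (φ p'.1) then (1 : ℝ) else 0)
        (fun p' _ => by split_ifs <;> norm_num) ((hmemR _).2 ⟨h.root_mem hy, rfl⟩)
      simp only [ne_eq, hr, not_false_eq_true, he', and_self, if_true] at h1 h2
      linarith
  have h1 : w * (∑ p ∈ R, ∑ p' ∈ R, placeSum cls a cs
        (fun φ => if p.2 ≠ p'.2 ∧ cls (φ p.1) = cls (φ p'.1) then 1 else 0)) ≤
      ((cs.filter fun p => p.1 = p.2).length : ℝ) ^ 2 * a * k := by
    have hb : ∀ p ∈ R, ∀ p' ∈ R, w * placeSum cls a cs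
        (fun φ => if p.2 ≠ p'.2 ∧ cls (φ p.1) = cls (φ p'.1) then 1 else 0) ≤ a * k := by
      intro p hp p' hp'
      by_cases hr : p.2 = p'.2
      · have : placeSum cls a cs (fun φ => if p.2 ≠ p'.2 ∧ cls (φ p.1) = cls (φ p'.1)
            then (1 : ℝ) else 0) = placeSum cls a cs (fun φ => 0 * 1) := by simp [hr]
        rw [this, placeSum_mul, zero_mul, mul_zero]
        positivity
      · simp only [ne_eq, hr, not_false_eq_true, true_and]
        exact (placeSum_cross cls a h ((hmemR _).1 hp).1 ((hmemR _).1 hp').1 hr).2.le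
    simp only [Finset.mul_sum]
    refine (Finset.sum_le_sum fun p hp => Finset.sum_le_sum fun p' hp' => hb p hp p' hp').trans ?_
    simp only [Finset.sum_const, nsmul_eq_mul]
    have hl : (R.card : ℝ) ≤ (cs.filter fun p => p.1 = p.2).length := by
      exact_mod_cast List.toFinset_card_le _
    calc (R.card : ℝ) * (R.card * (a * k)) = (R.card : ℝ) ^ 2 * a * k := by ring
      _ ≤ _ := by gcongr
  have := mul_le_mul_of_nonneg_left hpt hw
  linarith

/-- An injective labelling agrees with at most one placement. -/
theorem placeSum_agree_le_one {cs : List (ℕ × ℕ)} (h : ValidComps cs) (ident : V → ℕ)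
    (hi : Function.Injective ident) :
    placeSum cls a cs (fun φ => if ∀ x ∈ cs.map Prod.fst, ident (φ x) = x then 1 else 0) ≤ 1 := by
  induction cs with
  | nil => simp [placeSum]
  | cons p cs ih =>
    refine le_trans (placeSum_mono h.2.2 fun φ _ => ?_) (ih h.2.2)
    have hle : ∀ v, (if ∀ x ∈ (p :: cs).map Prod.fst, ident (Function.update φ p.1 v x) = x
        then (1 : ℝ) else 0) ≤
        (if ident v = p.1 then 1 else 0) *
          (if ∀ x ∈ cs.map Prod.fst, ident (φ x) = x then 1 else 0) := by
      intro v
      by_cases hc : ∀ x ∈ (p :: cs).map Prod.fst, ident (Function.update φ p.1 v x) = x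
      · have h1 : ident v = p.1 := by simpa using hc p.1 (by simp)
        have h2 : ∀ x ∈ cs.map Prod.fst, ident (φ x) = x := by
          intro x hx
          have := hc x (by rw [List.map_cons]; exact List.mem_cons_of_mem _ hx)
          rwa [Function.update_of_ne (by rintro rfl; exact h.1 hx)] at this
        rw [if_pos hc, if_pos h1, if_pos h2, mul_one]
      · rw [if_neg hc]
        split_ifs <;> norm_num
    refine (Finset.sum_le_sum fun v _ => hle v).trans ?_
    rw [← Finset.sum_mul]
    refine mul_le_of_le_one_left (by split_ifs <;> norm_num) ?_
    rw [Finset.sum_boole]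
    have : ((candidates cls a cs φ p).filter fun v => ident v = p.1).card ≤ 1 :=
      Finset.card_le_one.2 fun v hv w hw => hi (by
        rw [(Finset.mem_filter.1 hv).2, (Finset.mem_filter.1 hw).2])
    exact_mod_cast this

end Placements


/-! ### The ideal answers

In the ideal process all classes have size `a`, every random vertex is in a new class, and every
new label is uniformly random below `M`. -/

/-- What an algorithm knows: the components that it found, labels that do not belong to vertices,
and pairs of labels that are in different classes. -/
structure Knowledge where
  comps : List (ℕ × ℕ)
  absent : List ℕ
  sep : List (ℕ × ℕ)

/-- The known labels. -/
def Knowledge.labels (k : Knowledge) : List ℕ := k.comps.map Prod.fst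

/-- The knowledge that is gained from the ideal answers in a history, with the probability of the
choices among known and unknown neighbors. -/
inductive Reveals (M a : ℕ) : List (Query × Answer) → Knowledge → ℝ → Prop
  | nil : Reveals M a [] ⟨[], [], []⟩ 1
  | randVert {h k w} (u : ℕ) : Reveals M a h k w → u < M → u ∉ k.labels → u ∉ k.absent →
      Reveals M a ((.randVert, .vertex u) :: h) ⟨(u, u) :: k.comps, k.absent, k.sep⟩ w
  | randNbr_old {h k w} (x r u : ℕ) : Reveals M a h k w → (x, r) ∈ k.comps → (u, r) ∈ k.comps →
      u ≠ x → Reveals M a ((.randNbr x, .vertex u) :: h) k (w / (a - 1))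
  | randNbr_new {h k w} (x r u : ℕ) : Reveals M a h k w → (x, r) ∈ k.comps →
      (members k.comps r).length < a → u < M → u ∉ k.labels → u ∉ k.absent →
      Reveals M a ((.randNbr x, .vertex u) :: h) ⟨(u, r) :: k.comps, k.absent, k.sep⟩ (w / (a - 1))
  | randNbr_absent {h k w} (x : ℕ) : Reveals M a h k w → x ∉ k.labels →
      Reveals M a ((.randNbr x, .invalid) :: h) ⟨k.comps, x :: k.absent, k.sep⟩ w
  | degree {h k w} (x r : ℕ) : Reveals M a h k w → (x, r) ∈ k.comps →
      Reveals M a ((.degree x, .number (a - 1)) :: h) k w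
  | degree_absent {h k w} (x : ℕ) : Reveals M a h k w → x ∉ k.labels →
      Reveals M a ((.degree x, .invalid) :: h) ⟨k.comps, x :: k.absent, k.sep⟩ w
  | pair_same {h k w} (x y r : ℕ) : Reveals M a h k w → (x, r) ∈ k.comps → (y, r) ∈ k.comps →
      Reveals M a ((.pair x y, .bit (decide (x ≠ y))) :: h) k w
  | pair_sep {h k w} (x y r r' : ℕ) : Reveals M a h k w → (x, r) ∈ k.comps →
      (y, r') ∈ k.comps → r ≠ r' →
      Reveals M a ((.pair x y, .bit false) :: h) ⟨k.comps, k.absent, (x, y) :: k.sep⟩ w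
  | pair_absent_left {h k w} (x y : ℕ) : Reveals M a h k w → x ∉ k.labels →
      Reveals M a ((.pair x y, .invalid) :: h) ⟨k.comps, x :: k.absent, k.sep⟩ w
  | pair_absent_right {h k w} (x y : ℕ) : Reveals M a h k w → y ∉ k.labels →
      Reveals M a ((.pair x y, .invalid) :: h) ⟨k.comps, y :: k.absent, k.sep⟩ w
  | fullNbrHood {h k w} (x r : ℕ) (l : List ℕ) : Reveals M a h k w → (x, r) ∈ k.comps →
      l.Nodup → (∀ u ∈ l, u < M ∧ u ∉ k.labels ∧ u ∉ k.absent) →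
      l.length + (members k.comps r).length = a →
      Reveals M a
        ((.fullNbrHood x, .vertices (l.toFinset ∪ (members k.comps r).toFinset.erase x)) :: h)
        ⟨l.map (fun u => (u, r)) ++ k.comps, k.absent, k.sep⟩ w
  | fullNbrHood_absent {h k w} (x : ℕ) : Reveals M a h k w → x ∉ k.labels →
      Reveals M a ((.fullNbrHood x, .invalid) :: h) ⟨k.comps, x :: k.absent, k.sep⟩ w

/-- The probability of the labels in the ideal process. -/
def compWeight (M a : ℕ) : List (ℕ × ℕ) → ℝ
  | [] => 1
  | p :: cs => compWeight M a cs *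
      ((if p.1 = p.2 then 1 else (a : ℝ) - (members cs p.2).length) / M)

/-- The weight of a history in the ideal process. -/
def idealWeight (M a : ℕ) (h : List (Query × Answer)) : ℝ≥0∞ :=
  ⨆ (k : Knowledge) (w : ℝ) (_ : Reveals M a h k w), ENNReal.ofReal (w * compWeight M a k.comps)

/-- The number of components. -/
def numRoots (cs : List (ℕ × ℕ)) : ℕ := (cs.filter fun p => p.1 = p.2).length

theorem Knowledge.mem_labels {k : Knowledge} {x : ℕ} : x ∈ k.labels ↔ ∃ r, (x, r) ∈ k.comps := by
  simp [Knowledge.labels]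

theorem members_cons (p : ℕ × ℕ) (cs : List (ℕ × ℕ)) (r : ℕ) :
    members (p :: cs) r = if p.2 = r then p.1 :: members cs r else members cs r := by
  unfold members
  rw [List.filter_cons]
  by_cases h : p.2 = r <;> simp [h]

theorem members_append (l : List ℕ) (cs : List (ℕ × ℕ)) (r s : ℕ) :
    members (l.map (fun u => (u, r)) ++ cs) s =
      if r = s then l ++ members cs s else members cs s := by
  induction l with
  | nil => simp
  | cons u l ih =>
    rw [List.map_cons, List.cons_append, members_cons, ih]
    split_ifs <;> simp

theorem numRoots_append {l : List ℕ} {cs : List (ℕ × ℕ)} {r : ℕ} (h : r ∉ l) :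
    numRoots (l.map (fun u => (u, r)) ++ cs) = numRoots cs := by
  unfold numRoots
  rw [List.filter_append, List.length_append, add_eq_right, List.length_eq_zero_iff,
    List.filter_eq_nil_iff]
  intro p hp
  obtain ⟨u, hu, rfl⟩ := List.mem_map.1 hp
  simp only [decide_eq_true_eq]
  rintro rfl
  exact h hu

theorem ValidComps.append {l : List ℕ} {cs : List (ℕ × ℕ)} {r : ℕ} (h : ValidComps cs)
    (hr : (r, r) ∈ cs) (hl : l.Nodup) (hd : ∀ u ∈ l, u ∉ cs.map Prod.fst) :
    ValidComps (l.map (fun u => (u, r)) ++ cs) := by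
  induction l with
  | nil => exact h
  | cons u l ih =>
    rw [List.nodup_cons] at hl
    refine ⟨?_, Or.inr ?_, ih hl.2 fun v hv => hd v (List.mem_cons_of_mem _ hv)⟩
    · change u ∉ (l.map (fun u => (u, r)) ++ cs).map Prod.fst
      simp only [List.map_append, List.map_map, List.mem_append, not_or]
      refine ⟨?_, hd u List.mem_cons_self⟩
      intro hu
      obtain ⟨v, hv, he⟩ := List.mem_map.1 hu
      simp only [Function.comp_apply] at he
      subst he
      exact hl.1 hv
    · exact List.mem_append_right _ hr

/-- Adding labels one by one to a component fills its free places in order, which gives a falling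
factorial. -/
theorem compWeight_append (M a : ℕ) {l : List ℕ} {cs : List (ℕ × ℕ)} {r : ℕ} (hr : r ∉ l)
    (hl : l.length + (members cs r).length ≤ a) :
    compWeight M a (l.map (fun u => (u, r)) ++ cs) =
      compWeight M a cs * (((a - (members cs r).length).descFactorial l.length : ℕ) /
        (M : ℝ) ^ l.length) := by
  induction l with
  | nil => simp
  | cons u l ih =>
    simp only [List.length_cons] at hl
    rw [List.mem_cons, not_or] at hr
    rw [List.map_cons, List.cons_append, compWeight, ih hr.2 (by omega), if_neg (Ne.symm hr.1),
      members_append, if_pos rfl, List.length_cons, Nat.descFactorial_succ, List.length_append]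
    have h1 : ((a - (members cs r).length - l.length : ℕ) : ℝ) =
        a - (l.length + (members cs r).length) := by
      rw [Nat.sub_sub, Nat.cast_sub (by omega)]
      push_cast
      ring
    push_cast
    rw [h1, pow_succ]
    rw [mul_assoc, div_mul_div_comm]
    congr 2
    ring

/-- The invariants of the knowledge. -/
structure Knowledge.Valid (M a n : ℕ) (k : Knowledge) : Prop where
  comps : ValidComps k.comps
  labels : ∀ x ∈ k.labels, x < M ∧ x ∉ k.absent
  length_members : ∀ r, (members k.comps r).length ≤ a
  sep : ValidSep k.comps k.sep
  weight : 0 ≤ compWeight M a k.comps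
  length_comps : k.comps.length ≤ n * a
  length_absent : k.absent.length ≤ n
  length_sep : k.sep.length ≤ n
  roots : numRoots k.comps ≤ n

theorem ValidSep.mono {cs cs' sep : List (ℕ × ℕ)} (h : ValidSep cs sep) (hs : cs ⊆ cs') :
    ValidSep cs' sep := fun x y hxy => by
  obtain ⟨r, r', hx, hy, hr⟩ := h x y hxy
  exact ⟨r, r', hs hx, hs hy, hr⟩

theorem Knowledge.Valid.succ {M a n : ℕ} {k : Knowledge} (h : k.Valid M a n) :
    k.Valid M a (n + 1) where
  comps := h.comps
  labels := h.labels
  length_members := h.length_members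
  sep := h.sep
  weight := h.weight
  length_comps := h.length_comps.trans (by gcongr; omega)
  length_absent := h.length_absent.trans (by omega)
  length_sep := h.length_sep.trans (by omega)
  roots := h.roots.trans (by omega)

theorem Knowledge.Valid.absent_cons {M a n : ℕ} {k : Knowledge} (h : k.Valid M a n) {x : ℕ}
    (hx : x ∉ k.labels) : Knowledge.Valid M a (n + 1) ⟨k.comps, x :: k.absent, k.sep⟩ where
  __ := h.succ
  labels := fun y hy => by
    change y ∈ k.labels at hy
    refine ⟨(h.labels y hy).1, ?_⟩
    rw [List.mem_cons, not_or]
    exact ⟨by rintro rfl; exact hx hy, (h.labels y hy).2⟩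
  length_absent := by simpa using h.length_absent

theorem Knowledge.Valid.sep_cons {M a n : ℕ} {k : Knowledge} (h : k.Valid M a n) {x y r r' : ℕ}
    (hx : (x, r) ∈ k.comps) (hy : (y, r') ∈ k.comps) (hr : r ≠ r') :
    Knowledge.Valid M a (n + 1) ⟨k.comps, k.absent, (x, y) :: k.sep⟩ where
  __ := h.succ
  sep := fun x' y' hxy => by
    rcases List.mem_cons.1 hxy with he | hxy
    · simp only [Prod.mk.injEq] at he
      obtain ⟨rfl, rfl⟩ := he
      exact ⟨r, r', hx, hy, hr⟩
    · exact h.sep x' y' hxy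
  length_sep := by simpa using h.length_sep

theorem Knowledge.Valid.root_cons {M a n : ℕ} (ha : 1 ≤ a) {k : Knowledge} (h : k.Valid M a n)
    {u : ℕ} (hM : u < M) (hu : u ∉ k.labels) (hu' : u ∉ k.absent) :
    Knowledge.Valid M a (n + 1) ⟨(u, u) :: k.comps, k.absent, k.sep⟩ where
  comps := ⟨hu, Or.inl rfl, h.comps⟩
  labels := fun y hy => by
    rw [Knowledge.labels, List.map_cons, List.mem_cons] at hy
    rcases hy with rfl | hy
    · exact ⟨hM, hu'⟩
    · exact h.labels y hy
  length_members := fun r => by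
    rw [members_cons]
    split_ifs with hr
    · simp only at hr
      subst hr
      have : members k.comps u = [] := by
        rw [List.eq_nil_iff_forall_not_mem]
        intro x hx
        exact hu (k.mem_labels.2 ⟨u, h.comps.root_mem (mem_members.1 hx)⟩)
      simpa [this] using ha
    · exact h.length_members r
  sep := h.sep.mono (List.subset_cons_self _ _)
  weight := mul_nonneg h.weight (by simp)
  length_comps := by
    have := h.length_comps
    simp only [List.length_cons]
    nlinarith
  length_absent := h.length_absent.trans (by omega)
  length_sep := h.length_sep.trans (by omega)
  roots := by
    have := h.roots
    unfold numRoots at this ⊢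
    simpa using this

theorem Knowledge.Valid.append {M a n : ℕ} {k : Knowledge} (h : k.Valid M a n)
    {r : ℕ} {l : List ℕ} (hr : (r, r) ∈ k.comps) (hl : l.Nodup)
    (hd : ∀ u ∈ l, u < M ∧ u ∉ k.labels ∧ u ∉ k.absent)
    (hlen : l.length + (members k.comps r).length ≤ a) :
    Knowledge.Valid M a (n + 1) ⟨l.map (fun u => (u, r)) ++ k.comps, k.absent, k.sep⟩ where
  comps := h.comps.append hr hl fun u hu => (hd u hu).2.1
  labels := fun y hy => by
    simp only [Knowledge.labels, List.map_append, List.map_map, List.mem_append] at hy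
    rcases hy with hy | hy
    · obtain ⟨u, hu, rfl⟩ := List.mem_map.1 hy
      exact ⟨(hd u hu).1, (hd u hu).2.2⟩
    · exact h.labels y hy
  length_members := fun s => by
    rw [members_append]
    split_ifs with hs
    · subst hs
      simpa using hlen
    · exact h.length_members s
  sep := h.sep.mono (List.subset_append_right _ _)
  weight := by
    rw [compWeight_append M a _ hlen]
    · exact mul_nonneg h.weight (by positivity)
    · exact fun hrl => (hd r hrl).2.1 (k.mem_labels.2 ⟨r, hr⟩)
  length_comps := by
    have := h.length_comps
    simp only [List.length_append, List.length_map]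
    have : l.length ≤ a := by omega
    nlinarith
  length_absent := h.length_absent.trans (by omega)
  length_sep := h.length_sep.trans (by omega)
  roots := by
    rw [numRoots_append fun hrl => (hd r hrl).2.1 (k.mem_labels.2 ⟨r, hr⟩)]
    exact h.roots.trans (by omega)

/-- A query opens at most one component, excludes or separates at most once, and finds at most a
labels. -/
theorem Reveals.valid {M a : ℕ} (ha : 1 ≤ a) {h : List (Query × Answer)} {k : Knowledge} {w : ℝ}
    (hk : Reveals M a h k w) : k.Valid M a h.length := by
  induction hk with
  | nil => exact ⟨trivial, by simp [Knowledge.labels], by simp [members],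
      fun x y hxy => by simp at hxy, by simp [compWeight], by simp, by simp, by simp,
      by simp [numRoots]⟩
  | randVert u _ hM hu hu' ih => exact ih.root_cons ha hM hu hu'
  | randNbr_old x r u _ _ _ _ ih => exact ih.succ
  | randNbr_new x r u _ hx hlen hM hu hu' ih =>
    exact ih.append (l := [u]) (ih.comps.root_mem hx) (by simp) (by simpa using ⟨hM, hu, hu'⟩)
      (by simpa [add_comm] using hlen)
  | randNbr_absent x _ hx ih => exact ih.absent_cons hx
  | degree x r _ _ ih => exact ih.succ
  | degree_absent x _ hx ih => exact ih.absent_cons hx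
  | pair_same x y r _ _ _ ih => exact ih.succ
  | pair_sep x y r r' _ hx hy hr ih => exact ih.sep_cons hx hy hr
  | pair_absent_left x y _ hx ih => exact ih.absent_cons hx
  | pair_absent_right x y _ hx ih => exact ih.absent_cons hx
  | fullNbrHood x r l _ hx hl hd hlen ih => exact ih.append (ih.comps.root_mem hx) hl hd hlen.le
  | fullNbrHood_absent x _ hx ih => exact ih.absent_cons hx

theorem Reveals.nonneg {M a : ℕ} (ha : 1 ≤ a) {h : List (Query × Answer)} {k : Knowledge} {w : ℝ}
    (hk : Reveals M a h k w) : 0 ≤ w := by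
  have ha' : (0 : ℝ) ≤ a - 1 := by
    rw [sub_nonneg]
    exact_mod_cast ha
  induction hk with
  | nil => exact zero_le_one
  | randNbr_old _ _ _ _ _ _ _ ih => exact div_nonneg ih ha'
  | randNbr_new _ _ _ _ _ _ _ _ _ ih => exact div_nonneg ih ha'
  | _ => assumption

/-- Without full neighborhood queries, every query finds at most one label. -/
theorem Reveals.length_comps_le {M a : ℕ} {h : List (Query × Answer)} {k : Knowledge} {w : ℝ}
    (hk : Reveals M a h k w) (hh : ∀ qa ∈ h, ∀ x, qa.1 ≠ .fullNbrHood x) :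
    k.comps.length ≤ h.length := by
  induction hk with
  | nil => simp
  | fullNbrHood x r l _ _ _ _ _ _ => exact absurd rfl (hh _ List.mem_cons_self x)
  | _ =>
    rename_i ih
    have := ih fun qa hqa => hh qa (List.mem_cons_of_mem _ hqa)
    simp only [List.length_cons] at this ⊢
    omega

theorem Reveals.le_idealWeight {M a : ℕ} {h : List (Query × Answer)} {k : Knowledge} {w : ℝ}
    (hk : Reveals M a h k w) :
    ENNReal.ofReal (w * compWeight M a k.comps) ≤ idealWeight M a h :=
  le_iSup_of_le k (le_iSup_of_le w (le_iSup_of_le hk le_rfl))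

/-! ### Mass of the ideal process. -/

theorem ofReal_card_mul_le_tsum {α : Type*} (f : α → ℝ≥0∞) (s : Finset α) (c : ℝ)
    (h : ∀ a ∈ s, ENNReal.ofReal c ≤ f a) : ENNReal.ofReal (s.card * c) ≤ ∑' a, f a := by
  refine le_trans ?_ (ENNReal.sum_le_tsum s)
  refine le_trans ?_ (Finset.sum_le_sum h)
  rw [Finset.sum_const, nsmul_eq_mul, ENNReal.ofReal_mul (by positivity), ENNReal.ofReal_natCast]

/-- The labels that can be found next. -/
def Knowledge.fresh (k : Knowledge) (M : ℕ) : Finset ℕ :=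
  Finset.range M \ (k.labels.toFinset ∪ k.absent.toFinset)

theorem Knowledge.mem_fresh {k : Knowledge} {M u : ℕ} :
    u ∈ k.fresh M ↔ u < M ∧ u ∉ k.labels ∧ u ∉ k.absent := by
  simp [Knowledge.fresh]

theorem Knowledge.Valid.le_card_fresh {M a n : ℕ} {k : Knowledge} (h : k.Valid M a n) :
    M ≤ (k.fresh M).card + (n * a + n) := by
  have h1 : (Finset.range M).card ≤ (k.fresh M).card + (k.labels.toFinset ∪ k.absent.toFinset).card := by
    unfold Knowledge.fresh
    rw [← tsub_le_iff_right]
    exact Finset.le_card_sdiff _ _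
  have h2 := Finset.card_union_le k.labels.toFinset k.absent.toFinset
  have h3 := k.labels.toFinset_card_le
  have h4 := k.absent.toFinset_card_le
  have h5 : k.labels.length = k.comps.length := by simp [Knowledge.labels]
  have h6 := h.length_comps
  have h7 := h.length_absent
  rw [Finset.card_range] at h1
  omega

theorem vertex_injective : Function.Injective Answer.vertex := fun _ _ h => by
  injection h

/-- The ideal weight of a history is almost equally distributed over the next answers. -/
theorem mul_idealWeight_le_tsum {M a n : ℕ} (ha : 2 ≤ a) (hM : n * a + n + a ≤ M) (hM0 : 0 < M)
    (h : List (Query × Answer)) (hn : h.length ≤ n) (q : Query) :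
    ENNReal.ofReal ((1 - ((n * a + n + a : ℕ) : ℝ) / M) ^ a) * idealWeight M a h ≤
      ∑' ans, idealWeight M a ((q, ans) :: h) := by
  classical
  set X := n * a + n + a with hX
  have hMr : (0 : ℝ) < M := by exact_mod_cast hM0
  set ρ : ℝ := 1 - (X : ℝ) / M with hρ
  have hρ0 : 0 ≤ ρ := by
    rw [hρ, sub_nonneg, div_le_one hMr]
    exact_mod_cast hM
  have hρ1 : ρ ≤ 1 := by
    rw [hρ]
    have : 0 ≤ (X : ℝ) / M := by positivity
    linarith
  have hρa : ρ ^ a ≤ ρ := pow_le_of_le_one hρ0 hρ1 (by omega)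
  have hρa1 : ρ ^ a ≤ 1 := hρa.trans hρ1
  have ha1 : (0 : ℝ) < a - 1 := by
    have : (2 : ℝ) ≤ a := by exact_mod_cast ha
    linarith
  rw [idealWeight]
  simp only [ENNReal.mul_iSup]
  -- It suffices to extend one derivation of the history at a time, since the supremum dominates all
  -- extensions.
  refine iSup_le fun k => iSup_le fun w => iSup_le fun hk => ?_
  have hv := hk.valid (by omega)
  have hw := hk.nonneg (by omega)
  set W := w * compWeight M a k.comps with hW
  have hW0 : 0 ≤ W := mul_nonneg hw hv.weight
  have hfresh : ρ * M ≤ (k.fresh M).card := by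
    have h1 := hv.le_card_fresh
    have h2 : M ≤ (k.fresh M).card + X := by nlinarith
    have h3 : (M : ℝ) ≤ (k.fresh M).card + X := by exact_mod_cast h2
    rw [hρ, sub_mul, div_mul_cancel₀ _ hMr.ne']
    linarith
  rw [← ENNReal.ofReal_mul (by positivity)]
  have hsingle : ∀ ans, ENNReal.ofReal W ≤ idealWeight M a ((q, ans) :: h) →
      ENNReal.ofReal (ρ ^ a * W) ≤ ∑' ans, idealWeight M a ((q, ans) :: h) := by
    intro ans hans
    refine le_trans (ENNReal.ofReal_le_ofReal ?_) (hans.trans (ENNReal.le_tsum ans))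
    exact mul_le_of_le_one_left hW0 hρa1
  cases q with
  | randVert =>
    refine le_trans (ENNReal.ofReal_le_ofReal ?_)
      (ofReal_card_mul_le_tsum _ ((k.fresh M).map ⟨_, vertex_injective⟩) (W / M) ?_)
    · rw [Finset.card_map]
      calc ρ ^ a * W ≤ ρ * W := by gcongr
        _ = (ρ * M) * (W / M) := by field_simp
        _ ≤ _ := by gcongr
    · intro ans hans
      obtain ⟨u, hu, rfl⟩ := Finset.mem_map.1 hans
      rw [Knowledge.mem_fresh] at hu
      refine le_trans (le_of_eq ?_) (Reveals.randVert u hk hu.1 hu.2.1 hu.2.2).le_idealWeight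
      rw [compWeight, if_pos rfl, ← mul_assoc, ← hW, mul_one_div]
  | randNbr x =>
    by_cases hx : x ∈ k.labels
    · obtain ⟨r, hr⟩ := k.mem_labels.1 hx
      set m := (members k.comps r).length with hm
      have hma := hv.length_members r
      set old := (members k.comps r).toFinset.erase x with hold
      have hcold : (old.card : ℝ) = m - 1 := by
        rw [hold, Finset.card_erase_of_mem (by simpa [mem_members] using hr),
          List.toFinset_card_of_nodup (hv.comps.nodup_members r), Nat.cast_sub, Nat.cast_one]
        exact List.length_pos_of_mem (mem_members.2 hr)
      have hdisj : Disjoint (old.map ⟨_, vertex_injective⟩)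
          ((k.fresh M).map ⟨_, vertex_injective⟩) := by
        rw [Finset.disjoint_map, Finset.disjoint_left]
        intro u hu hu'
        rw [hold, Finset.mem_erase, List.mem_toFinset, mem_members] at hu
        exact (Knowledge.mem_fresh.1 hu').2.1 (k.mem_labels.2 ⟨r, hu.2⟩)
      refine le_trans ?_ (ENNReal.sum_le_tsum
        (old.map ⟨_, vertex_injective⟩ ∪ (k.fresh M).map ⟨_, vertex_injective⟩))
      rw [Finset.sum_union hdisj, Finset.sum_map, Finset.sum_map]
      have h1 : ENNReal.ofReal (old.card * (W / (a - 1))) ≤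
          ∑ u ∈ old, idealWeight M a ((.randNbr x, .vertex u) :: h) := by
        rw [ENNReal.ofReal_mul (by positivity), ENNReal.ofReal_natCast, ← nsmul_eq_mul,
          ← Finset.sum_const]
        refine Finset.sum_le_sum fun u hu => ?_
        rw [hold, Finset.mem_erase, List.mem_toFinset, mem_members] at hu
        refine le_trans (le_of_eq ?_) (Reveals.randNbr_old x r u hk hr hu.2 hu.1).le_idealWeight
        rw [hW, div_mul_eq_mul_div]
      have h2 : ENNReal.ofReal ((k.fresh M).card * (W / (a - 1) * ((a - m) / M))) ≤
          ∑ u ∈ k.fresh M, idealWeight M a ((.randNbr x, .vertex u) :: h) := by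
        rw [ENNReal.ofReal_mul (by positivity), ENNReal.ofReal_natCast, ← nsmul_eq_mul,
          ← Finset.sum_const]
        refine Finset.sum_le_sum fun u hu => ?_
        rw [Knowledge.mem_fresh] at hu
        rcases hma.lt_or_eq with hlt | heq
        · refine le_trans (le_of_eq ?_)
            (Reveals.randNbr_new x r u hk hr hlt hu.1 hu.2.1 hu.2.2).le_idealWeight
          have hur : u ≠ r := by
            rintro rfl
            exact hu.2.1 (k.mem_labels.2 ⟨u, hv.comps.root_mem hr⟩)
          rw [compWeight, if_neg hur, hW]
          congr 1
          ring
        -- In a fully known component the factor a − m vanishes, so new neighbors contribute nothing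
        -- to the lower bound.
        · rw [← hm] at heq
          rw [heq]
          simp
      refine le_trans ?_ (add_le_add h1 h2)
      have hma' : (0 : ℝ) ≤ a - m := by
        rw [sub_nonneg]
        exact_mod_cast hma
      have hm1 : (0 : ℝ) ≤ m - 1 := by rw [← hcold]; positivity
      rw [← ENNReal.ofReal_add (by positivity) (by positivity)]
      refine ENNReal.ofReal_le_ofReal ?_
      rw [hcold]
      -- Of the a − 1 neighbors of x, m − 1 are known and a − m are not; only the latter lose the
      -- factor ρ through labels that are already used or excluded.
      have h3 : ρ * (a - 1) ≤ (m - 1) + (k.fresh M).card * ((a - m) / M) := by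
        have h4 : ρ * M * ((a - m) / M) ≤ (k.fresh M).card * ((a - m) / M) := by gcongr
        have h5 : ρ * M * ((a - m) / M) = ρ * (a - m) := by field_simp
        nlinarith
      calc ρ ^ a * W ≤ ρ * W := by gcongr
        _ = (ρ * (a - 1)) * (W / (a - 1)) := by field_simp
        _ ≤ ((m - 1) + (k.fresh M).card * ((a - m) / M)) * (W / (a - 1)) := by gcongr
        _ = _ := by ring
    · exact hsingle .invalid (Reveals.randNbr_absent x hk hx).le_idealWeight
  | degree x =>
    by_cases hx : x ∈ k.labels
    · obtain ⟨r, hr⟩ := k.mem_labels.1 hx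
      exact hsingle _ (Reveals.degree x r hk hr).le_idealWeight
    · exact hsingle .invalid (Reveals.degree_absent x hk hx).le_idealWeight
  | pair x y =>
    by_cases hx : x ∈ k.labels
    · by_cases hy : y ∈ k.labels
      · obtain ⟨r, hr⟩ := k.mem_labels.1 hx
        obtain ⟨r', hr'⟩ := k.mem_labels.1 hy
        by_cases hrr : r = r'
        · subst hrr
          exact hsingle _ (Reveals.pair_same x y r hk hr hr').le_idealWeight
        · exact hsingle _ (Reveals.pair_sep x y r r' hk hr hr' hrr).le_idealWeight
      · exact hsingle .invalid (Reveals.pair_absent_right x y hk hy).le_idealWeight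
    · exact hsingle .invalid (Reveals.pair_absent_left x y hk hx).le_idealWeight
  | fullNbrHood x =>
    by_cases hx : x ∈ k.labels
    · obtain ⟨r, hr⟩ := k.mem_labels.1 hx
      have hma := hv.length_members r
      set m := a - (members k.comps r).length with hm
      set old := (members k.comps r).toFinset.erase x with hold
      have hinj : Set.InjOn (fun s : Finset ℕ => Answer.vertices (s ∪ old))
          ((k.fresh M).powersetCard m : Set (Finset ℕ)) := by
        intro s hs t ht hst
        have hsub : ∀ s ∈ (k.fresh M).powersetCard m, Disjoint s old := by
          intro s hs
          rw [Finset.disjoint_left]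
          intro u hu hu'
          rw [hold, Finset.mem_erase, List.mem_toFinset, mem_members] at hu'
          exact (Knowledge.mem_fresh.1 ((Finset.mem_powersetCard.1 hs).1 hu)).2.1
            (k.mem_labels.2 ⟨r, hu'.2⟩)
        simp only [Answer.vertices.injEq] at hst
        rw [← Finset.union_sdiff_cancel_right (hsub s hs),
          ← Finset.union_sdiff_cancel_right (hsub t ht), hst]
      refine le_trans (ENNReal.ofReal_le_ofReal ?_)
        (ofReal_card_mul_le_tsum _
          (((k.fresh M).powersetCard m).image fun s => Answer.vertices (s ∪ old))
          (W * ((m.factorial : ℕ) / (M : ℝ) ^ m)) ?_)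
      · rw [Finset.card_image_of_injOn hinj, Finset.card_powersetCard]
        -- Even the smallest factor of the falling factorial that counts ordered choices of m fresh
        -- labels is at least ρM; the summand a in X leaves room for this.
        have h1 : ρ * M ≤ ((k.fresh M).card + 1 - m : ℕ) := by
          have h1 := hv.le_card_fresh
          have h2 : M ≤ ((k.fresh M).card + 1 - m) + X := by
            have : h.length * a ≤ n * a := by gcongr
            omega
          have h3 : (M : ℝ) ≤ ((k.fresh M).card + 1 - m : ℕ) + X := by exact_mod_cast h2
          rw [hρ, sub_mul, div_mul_cancel₀ _ hMr.ne']
          linarith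
        have h2 : (ρ * M) ^ m ≤ ((k.fresh M).card.choose m : ℝ) * (m.factorial : ℕ) := by
          calc (ρ * M) ^ m ≤ (((k.fresh M).card + 1 - m : ℕ) : ℝ) ^ m := by gcongr
            _ ≤ (((k.fresh M).card.descFactorial m : ℕ) : ℝ) := by
              exact_mod_cast Nat.pow_sub_le_descFactorial _ _
            _ = _ := by
              rw [Nat.descFactorial_eq_factorial_mul_choose]
              push_cast
              ring
        calc ρ ^ a * W ≤ ρ ^ m * W := by
              gcongr ?_ * W
              exact pow_le_pow_of_le_one hρ0 hρ1 (by omega)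
          _ = (ρ * M) ^ m * (W / (M : ℝ) ^ m) := by
            rw [mul_pow]
            field_simp
          _ ≤ ((k.fresh M).card.choose m : ℝ) * (m.factorial : ℕ) * (W / (M : ℝ) ^ m) := by
            gcongr
          _ = _ := by ring
      · intro ans hans
        obtain ⟨s, hs, rfl⟩ := Finset.mem_image.1 hans
        rw [Finset.mem_powersetCard] at hs
        have hlen : s.toList.length + (members k.comps r).length = a := by
          rw [Finset.length_toList, hs.2]
          omega
        have hd : ∀ u ∈ s.toList, u < M ∧ u ∉ k.labels ∧ u ∉ k.absent := fun u hu =>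
          Knowledge.mem_fresh.1 (hs.1 (Finset.mem_toList.1 hu))
        have hkey := Reveals.fullNbrHood x r s.toList hk hr s.nodup_toList hd hlen
        rw [Finset.toList_toFinset] at hkey
        refine le_trans (le_of_eq ?_) hkey.le_idealWeight
        -- All m free places are filled at once, so the falling factorial is m!, the number of ways
        -- to place a given set of labels.
        rw [compWeight_append M a _ hlen.le, Finset.length_toList, hs.2, ← hm,
          Nat.descFactorial_self, ← mul_assoc]
        exact fun hrl => (hd r hrl).2.1 (k.mem_labels.2 ⟨r, hv.comps.root_mem hr⟩)
    · exact hsingle .invalid (Reveals.fullNbrHood_absent x hk hx).le_idealWeight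

theorem idealWeight_nil (M a : ℕ) : 1 ≤ idealWeight M a [] := by
  refine le_trans (le_of_eq ?_) (Reveals.nil (M := M) (a := a)).le_idealWeight
  simp [compWeight]


/-! ### Disjoint unions of cliques as inputs -/

section ClusterInput

variable {V K : Type} [Fintype V] [Nonempty V] [DecidableEq V] [DecidableEq K]

/-- The disjoint union of the cliques on the fibers of `cls`. -/
def clusterInput (cls : V → K) (hcls : ∀ v, ∃ w, w ≠ v ∧ cls w = cls v) (ident : V ↪ ℕ) :
    InputGraph where
  V := V
  graph :=
    { Adj := fun v w => v ≠ w ∧ cls v = cls w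
      symm := ⟨fun _ _ h => ⟨h.1.symm, h.2.symm⟩⟩
      loopless := ⟨fun _ h => h.1 rfl⟩ }
  ident := ident
  exists_adj := fun v => by
    obtain ⟨w, hw, hc⟩ := hcls v
    exact ⟨w, hw.symm, hc.symm⟩

variable (cls : V → K) (hcls : ∀ v, ∃ w, w ≠ v ∧ cls w = cls v) (ident : V ↪ ℕ)

set_option linter.unusedSectionVars false

theorem clusterInput_adj (v w : V) :
    (clusterInput cls hcls ident).graph.Adj v w ↔ v ≠ w ∧ cls v = cls w := Iff.rfl

theorem clusterInput_mem_nbrs (v w : V) :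
    w ∈ (clusterInput cls hcls ident).nbrs v ↔ v ≠ w ∧ cls v = cls w :=
  (clusterInput cls hcls ident).mem_nbrs v w

theorem clusterInput_card_nbrs (v : V) :
    ((clusterInput cls hcls ident).nbrs v).card = (cluster cls v).card - 1 := by
  have h : @Eq (Finset V) ((clusterInput cls hcls ident).nbrs v) ((cluster cls v).erase v) :=
    Finset.ext (α := V) fun (w : V) => (clusterInput_mem_nbrs cls hcls ident v w).trans (by
      rw [Finset.mem_erase, mem_cluster, ne_comm, @eq_comm _ (cls v)])
  have h' : ((cluster cls v).erase v).card = (cluster cls v).card - 1 :=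
    Finset.card_erase_of_mem (mem_cluster.2 rfl)
  exact (congrArg (Finset.card (α := V)) h).trans h'

theorem InputGraph.find_eq_none (I : InputGraph) {x : ℕ} (hx : ∀ v, I.ident v ≠ x) :
    I.find x = none := by
  unfold InputGraph.find Function.partialInv
  rw [dif_neg]
  rintro ⟨v, hv⟩
  exact hx v hv

theorem InputGraph.find_eq_some (I : InputGraph) {x : ℕ} {v : I.V} (hx : I.ident v = x) :
    I.find x = some v := by
  rw [← hx, I.find_ident]

theorem le_map_apply {α β : Type*} (p : PMF α) (f : α → β) (x : α) (y : β) (hy : f x = y) :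
    p x ≤ (p.map f) y := by
  rw [PMF.map_apply]
  refine le_trans ?_ (ENNReal.le_tsum x)
  rw [if_pos hy.symm]

theorem InputGraph.oracle_randVert (I : InputGraph) (v : I.V) {x : ℕ} (hx : I.ident v = x) :
    (I.numVerts : ℝ≥0∞)⁻¹ ≤ oracle I .randVert (.vertex x) := by
  refine le_trans ?_ (le_map_apply _ _ v _ (by rw [hx]))
  rw [PMF.uniformOfFintype_apply]
  rfl

theorem InputGraph.oracle_randNbr (I : InputGraph) {v w : I.V} {x y : ℕ} (hx : I.ident v = x)
    (hy : I.ident w = y) (h : I.graph.Adj v w) :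
    ((I.nbrs v).card : ℝ≥0∞)⁻¹ ≤ oracle I (.randNbr x) (.vertex y) := by
  simp only [oracle, I.find_eq_some hx]
  refine le_trans ?_ (le_map_apply _ _ w _ (by rw [hy]))
  rw [PMF.uniformOfFinset_apply_of_mem _ ((I.mem_nbrs v w).2 h)]

theorem InputGraph.oracle_degree (I : InputGraph) {v : I.V} {x : ℕ} (hx : I.ident v = x) :
    oracle I (.degree x) (.number (I.nbrs v).card) = 1 := by
  simp only [oracle, I.find_eq_some hx, PMF.pure_apply_self]

theorem InputGraph.oracle_pair (I : InputGraph) {v w : I.V} {x y : ℕ} (hx : I.ident v = x)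
    (hy : I.ident w = y) {b : Bool} (hb : b = true ↔ I.graph.Adj v w) :
    oracle I (.pair x y) (.bit b) = 1 := by
  classical
  simp only [oracle, I.find_eq_some hx, I.find_eq_some hy]
  have : b = decide (I.graph.Adj v w) := by
    rw [Bool.eq_iff_iff, hb, decide_eq_true_iff]
  rw [this]
  convert PMF.pure_apply_self _

theorem InputGraph.oracle_fullNbrHood (I : InputGraph) {v : I.V} {x : ℕ} (hx : I.ident v = x)
    {s : Finset ℕ} (hs : s = (I.nbrs v).map I.ident) :
    oracle I (.fullNbrHood x) (.vertices s) = 1 := by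
  simp only [oracle, I.find_eq_some hx, hs, PMF.pure_apply_self]

variable {cls}

theorem IsPlacement.mono {a : ℕ} {cs cs' : List (ℕ × ℕ)} {φ : ℕ → V}
    (h : IsPlacement cls a cs' φ) (hs : cs ⊆ cs') : IsPlacement cls a cs φ :=
  ⟨fun x r hx => h.1 x r (hs hx), fun x y r hx hy => h.2 x y r (hs hx) (hs hy)⟩

theorem Separated.mono {cs cs' sep sep' : List (ℕ × ℕ)} {φ : ℕ → V}
    (h : Separated cls cs' sep' φ) (hs : cs ⊆ cs') (hs' : sep ⊆ sep') :
    Separated cls cs sep φ :=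
  ⟨fun x r y r' hx hy => h.1 x r y r' (hs hx) (hs hy), fun x y hxy => h.2 x y (hs' hxy)⟩

/-- The labelling agrees with the placement of the known labels. -/
def Agrees (ident : V → ℕ) (k : Knowledge) (φ : ℕ → V) : Prop :=
  (∀ x ∈ k.labels, ident (φ x) = x) ∧ ∀ y ∈ k.absent, ∀ v, ident v ≠ y

theorem Agrees.mono {ident : V → ℕ} {k k' : Knowledge} {φ : ℕ → V} (h : Agrees ident k' φ)
    (hs : k.comps ⊆ k'.comps) (hs' : k.absent ⊆ k'.absent) : Agrees ident k φ := by
  refine ⟨fun x hx => h.1 x ?_, fun y hy => h.2 y (hs' hy)⟩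
  obtain ⟨r, hr⟩ := k.mem_labels.1 hx
  exact k'.mem_labels.2 ⟨r, hs hr⟩

theorem likelihood_cons (I : InputGraph) (q : Query) (ans : Answer) (h : List (Query × Answer)) :
    likelihood I ((q, ans) :: h) = oracle I q ans * likelihood I h := by
  simp [likelihood]

theorem le_likelihood_cons {I : InputGraph} {q : Query} {ans : Answer}
    {h : List (Query × Answer)} {x : ℝ} (hx : ENNReal.ofReal x ≤ likelihood I h)
    (hq : oracle I q ans = 1) : ENNReal.ofReal x ≤ likelihood I ((q, ans) :: h) := by
  rwa [likelihood_cons, hq, one_mul]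

theorem le_likelihood_cons_div {I : InputGraph} {q : Query} {ans : Answer}
    {h : List (Query × Answer)} {x y : ℝ} {m : ℕ} (hm : 0 < m)
    (hx : ENNReal.ofReal x ≤ likelihood I h)
    (hq : (m : ℝ≥0∞)⁻¹ ≤ oracle I q ans) (hy : y = x / m) :
    ENNReal.ofReal y ≤ likelihood I ((q, ans) :: h) := by
  rw [likelihood_cons, hy, div_eq_inv_mul, ENNReal.ofReal_mul (by positivity),
    ENNReal.ofReal_inv_of_pos (by exact_mod_cast hm), ENNReal.ofReal_natCast]
  exact mul_le_mul' hq hx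

/-- If a labelling agrees with a separated placement, then the answers in the history are at
least as likely as in the ideal process. -/
theorem Reveals.le_likelihood {M a : ℕ} (ha : 2 ≤ a) {h : List (Query × Answer)} {k : Knowledge}
    {w : ℝ} (hk : Reveals M a h k w) {φ : ℕ → V} (hφ : IsPlacement cls a k.comps φ)
    (hsep : Separated cls k.comps k.sep φ) (hag : Agrees ident k φ) :
    ENNReal.ofReal (w / (Fintype.card V : ℝ) ^ numRoots k.comps) ≤
      likelihood (clusterInput cls hcls ident) h := by
  have hnbrs : ∀ {k : Knowledge}, IsPlacement cls a k.comps φ → ∀ {x r}, (x, r) ∈ k.comps →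
      ((clusterInput cls hcls ident).nbrs (φ x)).card = a - 1 := by
    intro k hφ x r hx
    rw [clusterInput_card_nbrs, mem_regularVerts.1 (hφ.1 x r hx).1]
  have hadj : ∀ {k : Knowledge}, IsPlacement cls a k.comps φ → ∀ {x y r}, (x, r) ∈ k.comps →
      (y, r) ∈ k.comps → ((clusterInput cls hcls ident).graph.Adj (φ x) (φ y) ↔ x ≠ y) := by
    intro k hφ x y r hx hy
    rw [clusterInput_adj, (hφ.1 _ _ hx).2, (hφ.1 _ _ hy).2]
    exact ⟨fun h he => h.1 (by rw [he]), fun h => ⟨fun he => h (hφ.2 x y r hx hy he), rfl⟩⟩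
  have hcast : ((a - 1 : ℕ) : ℝ) = (a : ℝ) - 1 := by
    rw [Nat.cast_sub (by omega), Nat.cast_one]
  have hnone : ∀ {k : Knowledge} {x : ℕ}, Agrees ident k φ → x ∈ k.absent →
      (clusterInput cls hcls ident).find x = none := fun hag hx =>
    InputGraph.find_eq_none _ (hag.2 _ hx)
  induction hk with
  | nil => simp [likelihood, numRoots]
  | @randVert h k w u hk _ _ _ ih =>
    have h1 := ih (hφ.mono (List.subset_cons_self _ _))
      (hsep.mono (List.subset_cons_self _ _) (List.Subset.refl _))
      (hag.mono (List.subset_cons_self _ _) (List.Subset.refl _))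
    refine le_likelihood_cons_div Fintype.card_pos h1
      (InputGraph.oracle_randVert (clusterInput cls hcls ident) (φ u) (hag.1 u ?_)) ?_
    · simp [Knowledge.labels]
    · have : numRoots ((u, u) :: k.comps) = numRoots k.comps + 1 := by simp [numRoots]
      simp only [this, pow_succ, div_mul_eq_div_div]
      rfl
  | @randNbr_old h k w x r u hk hx hu hne ih =>
    have hq := InputGraph.oracle_randNbr (clusterInput cls hcls ident)
      (hag.1 x (k.mem_labels.2 ⟨r, hx⟩)) (hag.1 u (k.mem_labels.2 ⟨r, hu⟩))
      ((hadj hφ hx hu).2 hne.symm)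
    rw [hnbrs hφ hx] at hq
    refine le_likelihood_cons_div (by omega) (ih hφ hsep hag) hq ?_
    rw [hcast, div_right_comm]
  | @randNbr_new h k w x r u hk hx _ _ hu _ ih =>
    have hr := (hk.valid (by omega)).comps.root_mem hx
    have h1 := ih (hφ.mono (List.subset_cons_self _ _))
      (hsep.mono (List.subset_cons_self _ _) (List.Subset.refl _))
      (hag.mono (List.subset_cons_self _ _) (List.Subset.refl _))
    have hx' : (x, r) ∈ (u, r) :: k.comps := List.mem_cons_of_mem _ hx
    have hu' : (u, r) ∈ (u, r) :: k.comps := List.mem_cons_self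
    have hxu : x ≠ u := by
      rintro rfl
      exact hu (k.mem_labels.2 ⟨r, hx⟩)
    have hq := InputGraph.oracle_randNbr (clusterInput cls hcls ident)
      (hag.1 x (Knowledge.mem_labels.2 ⟨r, hx'⟩)) (hag.1 u (Knowledge.mem_labels.2 ⟨r, hu'⟩))
      ((hadj hφ hx' hu').2 hxu)
    rw [hnbrs hφ hx'] at hq
    refine le_likelihood_cons_div (by omega) h1 hq ?_
    have hur : u ≠ r := by
      rintro rfl
      exact hu (k.mem_labels.2 ⟨u, hr⟩)
    have : numRoots ((u, r) :: k.comps) = numRoots k.comps := by simp [numRoots, hur]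
    simp only [this]
    rw [hcast, div_right_comm]
  | @randNbr_absent h k w x hk _ ih =>
    have h1 := ih hφ hsep (hag.mono (List.Subset.refl _) (List.subset_cons_self _ _))
    refine le_likelihood_cons h1 ?_
    simp only [oracle, hnone hag (List.mem_cons_self), PMF.pure_apply_self]
  | @degree h k w x r hk hx ih =>
    have hq := InputGraph.oracle_degree (clusterInput cls hcls ident)
      (hag.1 x (k.mem_labels.2 ⟨r, hx⟩))
    rw [hnbrs hφ hx] at hq
    exact le_likelihood_cons (ih hφ hsep hag) hq
  | @degree_absent h k w x hk _ ih =>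
    have h1 := ih hφ hsep (hag.mono (List.Subset.refl _) (List.subset_cons_self _ _))
    refine le_likelihood_cons h1 ?_
    simp only [oracle, hnone hag (List.mem_cons_self), PMF.pure_apply_self]
  | @pair_same h k w x y r hk hx hy ih =>
    refine le_likelihood_cons (ih hφ hsep hag)
      (InputGraph.oracle_pair (clusterInput cls hcls ident)
        (hag.1 x (k.mem_labels.2 ⟨r, hx⟩)) (hag.1 y (k.mem_labels.2 ⟨r, hy⟩)) ?_)
    rw [hadj hφ hx hy, decide_eq_true_iff]
  | @pair_sep h k w x y r r' hk hx hy _ ih =>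
    have h1 := ih hφ (hsep.mono (List.Subset.refl _) (List.subset_cons_self _ _)) hag
    refine le_likelihood_cons h1 (InputGraph.oracle_pair (clusterInput cls hcls ident)
        (hag.1 x (k.mem_labels.2 ⟨r, hx⟩)) (hag.1 y (k.mem_labels.2 ⟨r', hy⟩)) ?_)
    rw [clusterInput_adj]
    simp [hsep.2 x y List.mem_cons_self]
  | @pair_absent_left h k w x y hk _ ih =>
    have h1 := ih hφ hsep (hag.mono (List.Subset.refl _) (List.subset_cons_self _ _))
    refine le_likelihood_cons h1 ?_
    simp only [oracle, hnone hag (List.mem_cons_self), PMF.pure_apply_self]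
  | @pair_absent_right h k w x y hk _ ih =>
    have h1 := ih hφ hsep (hag.mono (List.Subset.refl _) (List.subset_cons_self _ _))
    refine le_likelihood_cons h1 ?_
    simp only [oracle, hnone hag (List.mem_cons_self)]
    cases (clusterInput cls hcls ident).find x <;> simp
  | @fullNbrHood h k w x r l hk hx hl hd hlen ih =>
    have hv := hk.valid (by omega)
    have hr := hv.comps.root_mem hx
    have h1 := ih (hφ.mono (List.subset_append_right _ _))
      (hsep.mono (List.subset_append_right _ _) (List.Subset.refl _))
      (hag.mono (List.subset_append_right _ _) (List.Subset.refl _))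
    have hrl : r ∉ l := fun hrl => (hd r hrl).2.1 (k.mem_labels.2 ⟨r, hr⟩)
    simp only [numRoots_append hrl]
    have hx' : (x, r) ∈ l.map (fun u => (u, r)) ++ k.comps := List.mem_append_right _ hx
    refine le_likelihood_cons h1
      (InputGraph.oracle_fullNbrHood (clusterInput cls hcls ident)
        (hag.1 x (Knowledge.mem_labels.2 ⟨r, hx'⟩)) ?_)
    set s := l.toFinset ∪ (members k.comps r).toFinset with hs
    have hmem : ∀ u ∈ s, (u, r) ∈ l.map (fun u => (u, r)) ++ k.comps := by
      intro u hu
      rw [hs, Finset.mem_union, List.mem_toFinset, List.mem_toFinset, mem_members] at hu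
      rcases hu with hu | hu
      · exact List.mem_append_left _ (List.mem_map.2 ⟨u, hu, rfl⟩)
      · exact List.mem_append_right _ hu
    have hdisj : Disjoint l.toFinset (members k.comps r).toFinset := by
      rw [Finset.disjoint_left]
      intro u hu hu'
      rw [List.mem_toFinset] at hu hu'
      exact (hd u hu).2.1 (k.mem_labels.2 ⟨r, mem_members.1 hu'⟩)
    have hcard : s.card = a := by
      rw [hs, Finset.card_union_of_disjoint hdisj, List.toFinset_card_of_nodup hl,
        List.toFinset_card_of_nodup (hv.comps.nodup_members r), hlen]
    -- The placed labels are a distinct vertices of one class of size a, hence the whole class; so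
    -- the answer has to be exactly their set of labels without x.
    have himg : s.image φ = cluster cls (φ x) := by
      refine Finset.eq_of_subset_of_card_le ?_ ?_
      · intro v hv
        obtain ⟨u, hu, rfl⟩ := Finset.mem_image.1 hv
        rw [mem_cluster, (hφ.1 _ _ (hmem u hu)).2, (hφ.1 _ _ hx').2]
      · rw [Finset.card_image_of_injOn, hcard, mem_regularVerts.1 (hφ.1 _ _ hx').1]
        exact fun u hu v hv he => hφ.2 u v r (hmem u hu) (hmem v hv) he
    have hxl : x ∉ l.toFinset := by
      rw [List.mem_toFinset]
      exact fun hxl => (hd x hxl).2.1 (k.mem_labels.2 ⟨r, hx⟩)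
    have hse : l.toFinset ∪ (members k.comps r).toFinset.erase x = s.erase x := by
      rw [hs, Finset.erase_union_distrib, Finset.erase_eq_of_notMem hxl]
    rw [hse]
    have hxs : x ∈ s := by
      rw [hs, Finset.mem_union, List.mem_toFinset, List.mem_toFinset, mem_members]
      exact Or.inr hx
    have hlab : ∀ u ∈ s, ident (φ u) = u := fun u hu =>
      hag.1 u (Knowledge.mem_labels.2 ⟨r, hmem u hu⟩)
    ext y
    rw [Finset.mem_map, Finset.mem_erase]
    constructor
    · rintro ⟨hyx, hys⟩
      refine ⟨φ y, (InputGraph.mem_nbrs _ _ _).2 ?_, hlab y hys⟩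
      exact (hadj hφ hx' (hmem y hys)).2 hyx.symm
    · rintro ⟨(v : V), hv, hvy⟩
      have hv' := (clusterInput_mem_nbrs cls hcls ident (φ x) v).1 hv
      have hvc : v ∈ cluster cls (φ x) := mem_cluster.2 hv'.2.symm
      rw [← himg] at hvc
      obtain ⟨u, hu, rfl⟩ := Finset.mem_image.1 hvc
      have huy : u = y := (hlab u hu).symm.trans hvy
      subst huy
      exact ⟨fun he => hv'.1 (by rw [he]), hu⟩
  | @fullNbrHood_absent h k w x hk _ ih =>
    have h1 := ih hφ hsep (hag.mono (List.Subset.refl _) (List.subset_cons_self _ _))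
    refine le_likelihood_cons h1 ?_
    simp only [oracle, hnone hag (List.mem_cons_self), PMF.pure_apply_self]

/-! ### Random labellings -/

/-- A labelling with values in `Fin M` as a labelling with natural numbers. -/
def finIdent {M : ℕ} (ι : V ↪ Fin M) : V ↪ ℕ := ι.trans Fin.valEmbedding

open Classical in
/-- Many labellings extend a given partial labelling. -/
theorem pow_le_card_agrees {M : ℕ} {k : Knowledge} {φ : ℕ → V}
    (hl : ∀ x ∈ k.labels, x < M ∧ x ∉ k.absent)
    (hnd : k.labels.Nodup) (hφ : ∀ x ∈ k.labels, ∀ y ∈ k.labels, φ x = φ y → x = y) :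
    (M - (k.labels.length + k.absent.length + Fintype.card V)) ^
        (Fintype.card V - k.labels.length) ≤
      (Finset.univ.filter fun ι : V ↪ Fin M => Agrees (finIdent ι) k φ).card := by
  set im : Finset V := k.labels.toFinset.image φ with him
  have hcim : im.card = k.labels.length := by
    rw [him, Finset.card_image_of_injOn, List.toFinset_card_of_nodup hnd]
    intro x hx y hy he
    simp only [List.coe_toFinset, Set.mem_ofPred_eq] at hx hy
    exact hφ x hx y hy he
  let U := {v : V // v ∉ im}
  let F := {y : Fin M // (y : ℕ) ∉ k.labels ∧ (y : ℕ) ∉ k.absent}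
  have hcU : Fintype.card U = Fintype.card V - k.labels.length := by
    rw [Fintype.card_subtype_compl, Fintype.card_coe, hcim]
  have hcF : M ≤ Fintype.card F + (k.labels.length + k.absent.length) := by
    have h1 : Fintype.card F = (k.fresh M).card := by
      rw [Fintype.card_subtype]
      refine Finset.card_bij (fun y _ => (y : ℕ)) ?_ ?_ ?_
      · intro y hy
        rw [Knowledge.mem_fresh]
        exact ⟨y.2, (Finset.mem_filter.1 hy).2⟩
      · intro y _ z _ he
        exact Fin.ext he
      · intro u hu
        rw [Knowledge.mem_fresh] at hu
        exact ⟨⟨u, hu.1⟩, by simpa using hu.2, rfl⟩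
    have h2 : (Finset.range M).card ≤
        (k.fresh M).card + (k.labels.toFinset ∪ k.absent.toFinset).card := by
      unfold Knowledge.fresh
      rw [← tsub_le_iff_right]
      exact Finset.le_card_sdiff _ _
    have h3 := Finset.card_union_le k.labels.toFinset k.absent.toFinset
    have h4 := k.labels.toFinset_card_le
    have h5 := k.absent.toFinset_card_le
    rw [Finset.card_range] at h2
    omega
  have hex : ∀ v : V, ∃ x : ℕ, v ∈ im → x ∈ k.labels ∧ φ x = v := by
    intro v
    by_cases hv : v ∈ im
    · obtain ⟨x, hx, he⟩ := Finset.mem_image.1 hv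
      exact ⟨x, fun _ => ⟨by simpa using hx, he⟩⟩
    · exact ⟨0, fun h => absurd h hv⟩
  choose lab hlab using hex
  -- On occupied vertices the label is forced; the other vertices receive, through g, labels that
  -- are neither known nor excluded, which keeps the extension injective.
  let ext (g : U ↪ F) (v : V) : Fin M :=
    if hv : v ∈ im then ⟨lab v, (hl _ (hlab v hv).1).1⟩ else (g ⟨v, hv⟩).1
  have hext_in : ∀ g v, v ∈ im → ((ext g v : Fin M) : ℕ) = lab v := fun g v hv => by
    simp only [ext, dif_pos hv]
  have hext_out : ∀ g v (hv : v ∉ im), ext g v = (g ⟨v, hv⟩).1 := fun g v hv => by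
    simp only [ext, dif_neg hv]
  have hinj : ∀ g, Function.Injective (ext g) := by
    intro g v w he
    by_cases hv : v ∈ im <;> by_cases hw : w ∈ im
    · have h1 : lab v = lab w := by rw [← hext_in g v hv, he, hext_in g w hw]
      rw [← (hlab v hv).2, ← (hlab w hw).2, h1]
    · exfalso
      have h1 := (g ⟨w, hw⟩).2.1
      rw [← hext_out g w hw, ← he, hext_in g v hv] at h1
      exact h1 (hlab v hv).1
    · exfalso
      have h1 := (g ⟨v, hv⟩).2.1
      rw [← hext_out g v hv, he, hext_in g w hw] at h1
      exact h1 (hlab w hw).1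
    · rw [hext_out g v hv, hext_out g w hw] at he
      exact congrArg Subtype.val (g.injective (Subtype.ext he))
  have hag : ∀ g, Agrees (finIdent ⟨ext g, hinj g⟩) k φ := by
    intro g
    refine ⟨fun x hx => ?_, fun y hy v he => ?_⟩
    · have hv : φ x ∈ im := Finset.mem_image.2 ⟨x, by simpa using hx, rfl⟩
      change ((ext g (φ x) : Fin M) : ℕ) = x
      rw [hext_in g _ hv]
      exact hφ _ (hlab _ hv).1 _ hx (hlab _ hv).2
    · change ((ext g v : Fin M) : ℕ) = y at he
      by_cases hv : v ∈ im
      · rw [hext_in g v hv] at he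
        exact (hl _ (hlab v hv).1).2 (by rwa [he])
      · rw [hext_out g v hv] at he
        exact (g ⟨v, hv⟩).2.2 (by rwa [he])
  have hcard : Fintype.card (U ↪ F) ≤
      (Finset.univ.filter fun ι : V ↪ Fin M => Agrees (finIdent ι) k φ).card := by
    rw [← Finset.card_univ]
    refine Finset.card_le_card_of_injOn (fun g => ⟨ext g, hinj g⟩) ?_ ?_
    · intro g _
      simpa using hag g
    · intro g _ g' _ he
      ext v
      have h1 : ext g v.1 = ext g' v.1 := congrFun (congrArg DFunLike.coe he) v.1
      rw [hext_out g _ v.2, hext_out g' _ v.2] at h1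
      exact congrArg Fin.val h1
  refine le_trans ?_ hcard
  rw [Fintype.card_embedding_eq, hcU]
  refine le_trans (Nat.pow_le_pow_left ?_ _) (Nat.pow_sub_le_descFactorial _ _)
  omega

-- A random labelling assigns s given labels to s given vertices and avoids the excluded labels with
-- probability close to M^(−s), up to an error that vanishes for large M.
open Classical in
theorem mul_card_le_card_agrees {M a n : ℕ} {k : Knowledge} (hv : k.Valid M a n) {φ : ℕ → V}
    (hM : n * a + n + Fintype.card V ≤ M) (hM0 : 0 < M)
    (hφ : ∀ x ∈ k.labels, ∀ y ∈ k.labels, φ x = φ y → x = y) :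
    (Fintype.card (V ↪ Fin M) : ℝ) *
        ((1 - Fintype.card V * ((n * a + n + Fintype.card V : ℕ) : ℝ) / M) /
          (M : ℝ) ^ k.comps.length) ≤
      (Finset.univ.filter fun ι : V ↪ Fin M => Agrees (finIdent ι) k φ).card := by
  have hMr : (0 : ℝ) < M := by exact_mod_cast hM0
  have hnd : k.labels.Nodup := hv.comps.nodup_labels
  have hlen : k.labels.length = k.comps.length := by simp [Knowledge.labels]
  have hs : k.comps.length ≤ Fintype.card V := by
    rw [← hlen, ← List.toFinset_card_of_nodup hnd]
    refine Finset.card_le_card_of_injOn φ (fun _ _ => Finset.mem_univ _) ?_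
    intro x hx y hy he
    simp only [List.coe_toFinset, Set.mem_ofPred_eq] at hx hy
    exact hφ x hx y hy he
  have h1 := pow_le_card_agrees hv.labels hnd hφ
  rw [hlen] at h1
  set N := Fintype.card V
  set s := k.comps.length
  set X := n * a + n + N with hX
  have hsX : s + k.absent.length + N ≤ X := by
    have := hv.length_comps
    have := hv.length_absent
    omega
  have h2 : (M : ℝ) - X ≤ ((M - (s + k.absent.length + N) : ℕ) : ℝ) := by
    rw [Nat.cast_sub (by omega)]
    have : ((s + k.absent.length + N : ℕ) : ℝ) ≤ X := by exact_mod_cast hsX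
    linarith
  have hXM : (X : ℝ) ≤ M := by exact_mod_cast hM
  have h3 : ((M : ℝ) - X) ^ (N - s) ≤
      (Finset.univ.filter fun ι : V ↪ Fin M => Agrees (finIdent ι) k φ).card := by
    refine le_trans (pow_le_pow_left₀ (by linarith) h2 _) ?_
    exact_mod_cast h1
  refine le_trans ?_ h3
  have hq0 : 0 ≤ (X : ℝ) / M := by positivity
  have hq1 : (X : ℝ) / M ≤ 1 := by
    rw [div_le_one hMr]
    exact hXM
  have h4 : 1 - N * (X : ℝ) / M ≤ (1 - (X : ℝ) / M) ^ (N - s) := by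
    have hb := one_add_mul_le_pow (show (-2 : ℝ) ≤ -((X : ℝ) / M) by linarith) N
    calc 1 - N * (X : ℝ) / M = 1 + N * -((X : ℝ) / M) := by ring
      _ ≤ (1 + -((X : ℝ) / M)) ^ N := hb
      _ = (1 - (X : ℝ) / M) ^ N := by ring
      _ ≤ _ := pow_le_pow_of_le_one (by linarith) (by linarith) (Nat.sub_le _ _)
  have h5 : (Fintype.card (V ↪ Fin M) : ℝ) ≤ (M : ℝ) ^ N := by
    rw [Fintype.card_embedding_eq, Fintype.card_fin]
    exact_mod_cast Nat.descFactorial_le_pow _ _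
  have h6 : (M : ℝ) ^ N = (M : ℝ) ^ (N - s) * (M : ℝ) ^ s := by
    rw [← pow_add, Nat.sub_add_cancel hs]
  calc (Fintype.card (V ↪ Fin M) : ℝ) * ((1 - N * (X : ℝ) / M) / (M : ℝ) ^ s)
      ≤ (Fintype.card (V ↪ Fin M) : ℝ) * ((1 - (X : ℝ) / M) ^ (N - s) / (M : ℝ) ^ s) := by gcongr
    _ ≤ (M : ℝ) ^ N * ((1 - (X : ℝ) / M) ^ (N - s) / (M : ℝ) ^ s) := by
      have : 0 ≤ (1 - (X : ℝ) / M) ^ (N - s) := pow_nonneg (by linarith) _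
      gcongr
    _ = ((M : ℝ) - X) ^ (N - s) := by
      have h7 : (M : ℝ) - X = M * (1 - (X : ℝ) / M) := by field_simp
      rw [h7, mul_pow, h6]
      field_simp

/-- The total number of placements. -/
theorem placeSum_one {M a : ℕ} (hM0 : 0 < M) {cs : List (ℕ × ℕ)} (h : ValidComps cs) :
    placeSum cls a cs (fun _ => 1) =
      ((regularVerts cls a).card : ℝ) ^ numRoots cs * (M : ℝ) ^ cs.length * compWeight M a cs := by
  have hMr : (M : ℝ) ≠ 0 := by exact_mod_cast hM0.ne'
  induction cs with
  | nil => simp [placeSum, numRoots, compWeight]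
  | cons p cs ih =>
    rw [placeSum_cons_of_old cls a h (fun _ => 1) fun _ _ => rfl, ih h.2.2, compWeight,
      List.length_cons, pow_succ]
    by_cases hp : p.1 = p.2
    · have : numRoots (p :: cs) = numRoots cs + 1 := by simp [numRoots, hp]
      rw [if_pos hp, if_pos hp, this, pow_succ]
      field_simp
    · have : numRoots (p :: cs) = numRoots cs := by simp [numRoots, hp]
      rw [if_neg hp, if_neg hp, this]
      field_simp

open Classical in
/-- Averaged over the labellings, the likelihood of a history is almost as large as in the ideal
process, if most placements are separated. -/
theorem mul_idealWeight_le_meanLikelihood {M a n : ℕ} (ha : 2 ≤ a)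
    (hM : n * a + n + Fintype.card V ≤ M) (hM0 : 0 < M) (h : List (Query × Answer))
    (hn : h.length ≤ n) (c : ℝ) (hc : 0 ≤ c)
    (hlab : Fintype.card V * ((n * a + n + Fintype.card V : ℕ) : ℝ) ≤ M)
    (hsep : ∀ k w, Reveals M a h k w → c * placeSum cls a k.comps (fun _ => 1) ≤
      placeSum cls a k.comps fun φ => if Separated cls k.comps k.sep φ then 1 else 0) :
    ENNReal.ofReal (c * (((regularVerts cls a).card : ℝ) / Fintype.card V) ^ n *
        (1 - Fintype.card V * ((n * a + n + Fintype.card V : ℕ) : ℝ) / M)) * idealWeight M a h ≤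
      meanLikelihood (fun ι : V ↪ Fin M => clusterInput cls hcls (finIdent ι)) h := by
  have hMr : (0 : ℝ) < M := by exact_mod_cast hM0
  have hN : (0 : ℝ) < Fintype.card V := by exact_mod_cast Fintype.card_pos
  have hne : Nonempty (V ↪ Fin M) :=
    Function.Embedding.nonempty_of_card_le (by rw [Fintype.card_fin]; omega)
  have hΩ : (0 : ℝ) < Fintype.card (V ↪ Fin M) := by exact_mod_cast Fintype.card_pos
  set e : ℝ := 1 - Fintype.card V * ((n * a + n + Fintype.card V : ℕ) : ℝ) / M with he
  have he0 : 0 ≤ e := by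
    rw [he, sub_nonneg, div_le_one hMr]
    exact hlab
  rw [idealWeight]
  simp only [ENNReal.mul_iSup]
  refine iSup_le fun k => iSup_le fun w => iSup_le fun hk => ?_
  have hv := hk.valid (by omega)
  have hw := hk.nonneg (by omega)
  have hvn : k.Valid M a n :=
    { hv with
      length_comps := hv.length_comps.trans (by gcongr)
      length_absent := hv.length_absent.trans hn
      length_sep := hv.length_sep.trans hn
      roots := hv.roots.trans hn }
  set p : ℝ := w / (Fintype.card V : ℝ) ^ numRoots k.comps with hp
  have hp0 : 0 ≤ p := by positivity
  -- A double count of pairs of a labelling and a separated placement that agree: each labelling has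
  -- at most one such placement, and each separated placement agrees with many labellings.
  let good (ι : V ↪ Fin M) (φ : ℕ → V) : ℝ :=
    (if Separated cls k.comps k.sep φ then 1 else 0) * if Agrees (finIdent ι) k φ then 1 else 0
  have hgood0 : ∀ ι φ, 0 ≤ good ι φ := fun ι φ => by
    simp only [good]
    split_ifs <;> norm_num
  have hι : ∀ ι : V ↪ Fin M, ENNReal.ofReal (p * placeSum cls a k.comps (good ι)) ≤
      likelihood (clusterInput cls hcls (finIdent ι)) h := by
    intro ι
    by_cases hex : ∃ φ, IsPlacement cls a k.comps φ ∧ Separated cls k.comps k.sep φ ∧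
        Agrees (finIdent ι) k φ
    · obtain ⟨φ, h1, h2, h3⟩ := hex
      refine le_trans (ENNReal.ofReal_le_ofReal ?_) (hk.le_likelihood hcls (finIdent ι) ha h1 h2 h3)
      refine mul_le_of_le_one_right hp0 ?_
      refine le_trans (placeSum_mono hv.comps fun φ _ => ?_)
        (placeSum_agree_le_one cls a hv.comps (finIdent ι) (finIdent ι).injective)
      simp only [good]
      by_cases hag : Agrees (finIdent ι) k φ
      · have hag' : ∀ x ∈ k.comps.map Prod.fst, finIdent ι (φ x) = x := hag.1
        rw [if_pos hag, if_pos hag']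
        split_ifs <;> norm_num
      · rw [if_neg hag, mul_zero]
        split_ifs <;> norm_num
    · have h0 : placeSum cls a k.comps (good ι) = placeSum cls a k.comps (fun φ => 0 * good ι φ) := by
        refine placeSum_congr hv.comps fun φ hφ => ?_
        simp only [good]
        by_cases h2 : Separated cls k.comps k.sep φ
        · by_cases h3 : Agrees (finIdent ι) k φ
          · exact absurd ⟨φ, hφ, h2, h3⟩ hex
          · simp [h3]
        · simp [h2]
      rw [h0, placeSum_mul]
      simp
  have hsum : (Fintype.card (V ↪ Fin M) : ℝ) * (e / (M : ℝ) ^ k.comps.length) *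
      (c * placeSum cls a k.comps (fun _ => 1)) ≤ ∑ ι : V ↪ Fin M, placeSum cls a k.comps (good ι) := by
    rw [← placeSum_sum]
    refine le_trans (mul_le_mul_of_nonneg_left (hsep k w hk) (by positivity)) ?_
    rw [← placeSum_mul]
    refine placeSum_mono hv.comps fun φ hφ => ?_
    simp only [good, ← Finset.mul_sum]
    rw [mul_comm]
    by_cases hs : Separated cls k.comps k.sep φ
    · rw [if_pos hs, one_mul, one_mul, Finset.sum_boole]
      refine mul_card_le_card_agrees hvn hM hM0 fun x hx y hy hxy => ?_
      obtain ⟨r, hr⟩ := k.mem_labels.1 hx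
      obtain ⟨r', hr'⟩ := k.mem_labels.1 hy
      by_cases hrr : r = r'
      · subst hrr
        exact hφ.2 x y r hr hr' hxy
      · exact absurd hxy (hs.1 x r y r' hr hr' hrr)
    · rw [if_neg hs, zero_mul, zero_mul]
  have hreg : ((regularVerts cls a).card : ℝ) / Fintype.card V ≤ 1 := by
    rw [div_le_one hN]
    exact_mod_cast Finset.card_le_univ _
  rw [meanLikelihood, ← ENNReal.ofReal_natCast, ← ENNReal.ofReal_inv_of_pos hΩ]
  refine le_trans ?_ (mul_le_mul_right (Finset.sum_le_sum fun ι _ => hι ι) _)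
  rw [← ENNReal.ofReal_sum_of_nonneg fun ι _ =>
      mul_nonneg hp0 (placeSum_nonneg cls a hv.comps (hgood0 ι)),
    ← ENNReal.ofReal_mul (by positivity), ← ENNReal.ofReal_mul (by positivity)]
  refine ENNReal.ofReal_le_ofReal ?_
  rw [← Finset.mul_sum]
  refine le_trans ?_ (mul_le_mul_of_nonneg_left (mul_le_mul_of_nonneg_left hsum hp0)
    (inv_nonneg.2 hΩ.le))
  -- The powers of M cancel. Each root leaves the fraction of regular vertices, and there are at
  -- most n roots.
  rw [placeSum_one hM0 hv.comps]
  have hpow : (((regularVerts cls a).card : ℝ) / Fintype.card V) ^ n ≤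
      (((regularVerts cls a).card : ℝ) / Fintype.card V) ^ numRoots k.comps :=
    pow_le_pow_of_le_one (by positivity) hreg hvn.roots
  have hW : 0 ≤ w * compWeight M a k.comps := mul_nonneg hw hv.weight
  calc c * (((regularVerts cls a).card : ℝ) / Fintype.card V) ^ n * e *
        (w * compWeight M a k.comps)
      ≤ c * (((regularVerts cls a).card : ℝ) / Fintype.card V) ^ numRoots k.comps * e *
        (w * compWeight M a k.comps) := by gcongr
    _ = _ := by
      rw [hp, div_pow]
      field_simp

end ClusterInput


/-! ### Lower bounds for disjoint unions of cliques -/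

section Indistinguishable

variable {V K : Type} [Fintype V] [Nonempty V] [DecidableEq V] [DecidableEq K]

open Classical in
/-- For all histories of length at most `T` with the property `P`, at least the fraction `c` of
the placements is separated. -/
def MostlySeparated (cls : V → K) (a T : ℕ) (P : List (Query × Answer) → Prop) (c : ℝ) : Prop :=
  ∀ M h k w, P h → h.length ≤ T → Reveals M a h k w →
    c * placeSum cls a k.comps (fun _ => 1) ≤
      placeSum cls a k.comps fun φ => if Separated cls k.comps k.sep φ then 1 else 0

set_option linter.unusedSectionVars false in
theorem mostlySeparated_zero (cls : V → K) (a : ℕ) (P : List (Query × Answer) → Prop) :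
    MostlySeparated cls a 0 P 1 := by
  intro M h k w _ hh hk
  obtain rfl : h = [] := List.length_eq_zero_iff.1 (by omega)
  cases hk
  simp [placeSum, Separated]

/-- The bound ℓ on the number of labels is T without full neighborhood queries, and T · a in
general. -/
theorem mostlySeparated_of_le {cls : V → K} {a T : ℕ} (ha : 1 ≤ a)
    {P : List (Query × Answer) → Prop} (ℓ : ℕ)
    (hℓ : ∀ M h k w, P h → h.length ≤ T → Reveals M a h k w → k.comps.length ≤ ℓ)
    (hw : 0 < (regularVerts cls a).card)
    (h : 100 * ((ℓ : ℝ) ^ 2 + T * a) ≤ (regularVerts cls a).card) :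
    MostlySeparated cls a T P (99 / 100) := by
  intro M hist k w hP hT hk
  have hv := hk.valid ha
  have h1 := le_placeSum_separated cls a hv.comps hv.sep
  have hK : 0 ≤ placeSum cls a k.comps (fun _ => 1) :=
    placeSum_nonneg cls a hv.comps fun _ => zero_le_one
  have hwr : (0 : ℝ) < (regularVerts cls a).card := by exact_mod_cast hw
  have h2 : (k.comps.length : ℝ) ^ 2 ≤ (ℓ : ℝ) ^ 2 := by
    gcongr
    exact hℓ M hist k w hP hT hk
  have h3 : (k.sep.length : ℝ) * a ≤ T * a := by
    gcongr
    exact hv.length_sep.trans hT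
  refine le_of_mul_le_mul_left (le_trans ?_ h1) hwr
  rw [← mul_assoc]
  gcongr
  linarith

/-- At most one root per query, so T²a takes the place of the square of the number of labels, which
could reach (Ta)². -/
theorem mostlySeparated_of_roots {cls : V → K} {a T : ℕ} (ha : 1 ≤ a)
    (P : List (Query × Answer) → Prop)
    (hw : 0 < (regularVerts cls a).card)
    (h : 100 * ((T : ℝ) ^ 2 * a) ≤ (regularVerts cls a).card) :
    MostlySeparated cls a T P (99 / 100) := by
  intro M hist k w hP hT hk
  have hv := hk.valid ha
  have h1 := le_placeSum_separated_of_roots cls a hv.comps hv.sep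
  have hK : 0 ≤ placeSum cls a k.comps (fun _ => 1) :=
    placeSum_nonneg cls a hv.comps fun _ => zero_le_one
  have hwr : (0 : ℝ) < (regularVerts cls a).card := by exact_mod_cast hw
  have h2 : ((k.comps.filter fun p => p.1 = p.2).length : ℝ) ^ 2 * a ≤ (T : ℝ) ^ 2 * a := by
    gcongr
    exact hv.roots.trans hT
  refine le_of_mul_le_mul_left (le_trans ?_ h1) hwr
  rw [← mul_assoc]
  gcongr
  linarith

variable {V' K' : Type} [Fintype V'] [Nonempty V'] [DecidableEq V'] [DecidableEq K']

/-- Two disjoint unions of cliques that mostly consist of cliques of size `a` cannot be told apart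
by few queries. -/
theorem exists_ident_probMoreQueries (A : Algorithm) (T a : ℕ) (ha : 2 ≤ a)
    (cls : V → K) (hcls : ∀ v, ∃ w, w ≠ v ∧ cls w = cls v)
    (cls' : V' → K') (hcls' : ∀ v, ∃ w, w ≠ v ∧ cls' w = cls' v)
    (P : List (Query × Answer) → Prop) (hP0 : P [])
    (hP : ∀ h q a, P h → Sum.inl q ∈ (A h).support → P ((q, a) :: h))
    (c c' : ℝ) (hc : 0 ≤ c) (hc' : 0 ≤ c')
    (hsep : MostlySeparated cls a T P c) (hsep' : MostlySeparated cls' a T P c')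
    (hreg : 97 / 100 ≤ c * (((regularVerts cls a).card : ℝ) / Fintype.card V) ^ T)
    (hreg' : 97 / 100 ≤ c' * (((regularVerts cls' a).card : ℝ) / Fintype.card V') ^ T)
    {S S' : Set ℝ} (hS : Disjoint S S')
    (hI : ∀ ident, ∃ t, 2 / 3 < A.probOutput (clusterInput cls hcls ident) t S)
    (hI' : ∀ ident, ∃ t, 2 / 3 < A.probOutput (clusterInput cls' hcls' ident) t S') :
    ∃ ident, 1 / 4 ≤ A.probMoreQueries (clusterInput cls hcls ident) T := by
  set N := Fintype.card V with hN
  set N' := Fintype.card V' with hN'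
  set X := T * a + T + a + N + N' with hX
  -- The label range is so large that every error from collisions or guessed labels is at most
  -- 1/100.
  set M := 100 * ((N + N' + a * T + 1) * X) with hM
  have hNpos : 0 < N := Fintype.card_pos
  have hX0 : 0 < X := by omega
  have hMX : 100 * X ≤ M := by
    rw [hM]
    gcongr
    exact Nat.le_mul_of_pos_left _ (by omega)
  have hM0 : 0 < M := by omega
  have hMr : (0 : ℝ) < M := by exact_mod_cast hM0
  have hfrac : ∀ m Y : ℕ, m ≤ N + N' + a * T → Y ≤ X → 100 * ((m : ℝ) * (Y : ℝ)) ≤ M := by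
    intro m Y hm hY
    have : 100 * (m * Y) ≤ M := by
      rw [hM]
      gcongr
      omega
    exact_mod_cast this
  have hne : ∀ n : ℕ, n ≤ X → n ≤ M := fun n hn => by omega
  have hemb : Nonempty (V ↪ Fin M) :=
    Function.Embedding.nonempty_of_card_le (by rw [Fintype.card_fin]; omega)
  have hemb' : Nonempty (V' ↪ Fin M) :=
    Function.Embedding.nonempty_of_card_le (by rw [Fintype.card_fin]; omega)
  have hdom : ∀ (p : ℝ) (n : ℕ), 97 / 100 ≤ p → n ≤ N + N' → T * a + T + n ≤ X →
      24 / 25 ≤ p * (1 - (n : ℝ) * ((T * a + T + n : ℕ) : ℝ) / M) := by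
    intro p n hp hn hnX
    have h1 := hfrac n (T * a + T + n) (by omega) hnX
    have h2 : (n : ℝ) * ((T * a + T + n : ℕ) : ℝ) / M ≤ 1 / 100 := by
      rw [div_le_iff₀ hMr]
      linarith
    nlinarith
  suffices ∃ ι : V ↪ Fin M, 1 / 4 ≤ A.probMoreQueries (clusterInput cls hcls (finIdent ι)) T from
    this.imp' _ fun _ h => h
  refine exists_probMoreQueries A
    (fun ι : V ↪ Fin M => clusterInput cls hcls (finIdent ι))
    (fun ι : V' ↪ Fin M => clusterInput cls' hcls' (finIdent ι)) T hS
    (fun ι => hI _) (fun ι => hI' _) P hP0 hP (idealWeight M a) ?_ ?_ ?_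
  · intro h hPh hlen
    refine le_trans (mul_le_mul_left (ENNReal.ofReal_le_ofReal ?_) _)
      (mul_idealWeight_le_meanLikelihood hcls ha (by omega) hM0 h hlen c hc ?_
        fun k w hk => hsep M h k w hPh hlen hk)
    · exact hdom _ N hreg (by omega) (by omega)
    · have := hfrac N (T * a + T + N) (by omega) (by omega)
      have h0 : (0 : ℝ) ≤ N * ((T * a + T + N : ℕ) : ℝ) := by positivity
      linarith
  · intro h hPh hlen
    refine le_trans (mul_le_mul_left (ENNReal.ofReal_le_ofReal ?_) _)
      (mul_idealWeight_le_meanLikelihood hcls' ha (by omega) hM0 h hlen c' hc' ?_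
        fun k w hk => hsep' M h k w hPh hlen hk)
    · exact hdom _ N' hreg' (by omega) (by omega)
    · have := hfrac N' (T * a + T + N') (by omega) (by omega)
      have h0 : (0 : ℝ) ≤ N' * ((T * a + T + N' : ℕ) : ℝ) := by positivity
      linarith
  -- Each of the T answers preserves the fraction ρ^a of the ideal weight, and by Bernoulli's
  -- inequality ρ^(aT) ≥ 1 − aTY/M ≥ 99/100.
  · set Y := T * a + T + a with hY
    set ρ : ℝ := 1 - ((Y : ℕ) : ℝ) / M with hρ
    have hYM : (Y : ℝ) / M ≤ 1 := by
      rw [div_le_one hMr]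
      exact_mod_cast hne Y (by omega)
    have hY0 : 0 ≤ (Y : ℝ) / M := by positivity
    have hρa : ENNReal.ofReal (ρ ^ a) ≤ 1 := by
      rw [ENNReal.ofReal_le_one]
      exact pow_le_one₀ (by linarith) (by linarith)
    refine le_trans ?_ (le_weightedRun_univ A (Ψ := idealWeight M a) (ENNReal.ofReal (ρ ^ a)) hρa T
      (fun h q hh => mul_idealWeight_le_tsum ha (hne Y (by omega)) hM0 h hh.le q) T [] (by simp))
    refine le_trans ?_ (mul_le_mul_right (idealWeight_nil M a) _)
    rw [mul_one, ← ENNReal.ofReal_pow (pow_nonneg (by linarith) _)]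
    refine ENNReal.ofReal_le_ofReal ?_
    rw [← pow_mul]
    have hb := one_add_mul_le_pow (show (-2 : ℝ) ≤ -((Y : ℝ) / M) by linarith) (a * T)
    have h1 := hfrac (a * T) Y (by omega) (by omega)
    have h2 : ((a * T : ℕ) : ℝ) * ((Y : ℝ) / M) ≤ 1 / 100 := by
      rw [← mul_div_assoc, div_le_iff₀ hMr]
      linarith
    calc (24 / 25 : ℝ) ≤ 1 + ((a * T : ℕ) : ℝ) * -((Y : ℝ) / M) := by linarith
      _ ≤ _ := hb
      _ = _ := by rw [hρ, sub_eq_add_neg]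

end Indistinguishable

theorem clusterInput_avgDegree {V K : Type} [Fintype V] [Nonempty V] [DecidableEq V]
    [DecidableEq K] (cls : V → K) (hcls : ∀ v, ∃ w, w ≠ v ∧ cls w = cls v) (ident : V ↪ ℕ) :
    (clusterInput cls hcls ident).avgDegree =
      (∑ v, (((cluster cls v).card - 1 : ℕ) : ℝ)) / Fintype.card V := by
  have h := (clusterInput cls hcls ident).sum_card_nbrs
  have hN : ((clusterInput cls hcls ident).numVerts : ℝ) = Fintype.card V := rfl
  rw [eq_div_iff (by exact_mod_cast Fintype.card_pos.ne'), mul_comm, ← hN, ← h]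
  exact Finset.sum_congr rfl fun v _ => by
    exact congrArg Nat.cast (clusterInput_card_nbrs cls hcls ident v)

/-! ### Cliques of equal size and one larger clique -/

section Blocks

variable {n : ℕ} (a b : ℕ)

/-- The partition into `b` blocks of size `a` and the rest. -/
def blockOf (v : Fin n) : ℕ := min (v / a) b

variable {a b}

theorem card_filter_fin {lo hi : ℕ} (hhi : hi ≤ n) :
    (Finset.univ.filter fun w : Fin n => lo ≤ (w : ℕ) ∧ (w : ℕ) < hi).card = hi - lo := by
  rw [← Nat.card_Ico, ← Finset.card_map Fin.valEmbedding]
  congr 1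
  ext x
  simp only [Finset.mem_map, Finset.mem_filter, Finset.mem_univ, true_and, Finset.mem_Ico,
    Fin.valEmbedding_apply]
  constructor
  · rintro ⟨w, hw, rfl⟩
    exact hw
  · intro hx
    exact ⟨⟨x, by omega⟩, hx, rfl⟩

theorem card_cluster_block (ha : 2 ≤ a) (hn : (b + 1) * a ≤ n) {v : Fin n} (hv : (v : ℕ) < b * a) :
    (cluster (blockOf (n := n) a b) v).card = a := by
  have ha0 : 0 < a := by omega
  have hvb : (v : ℕ) / a < b := (Nat.div_lt_iff_lt_mul ha0).2 hv
  have h1 : ((v : ℕ) / a + 1) * a ≤ n := le_trans (Nat.mul_le_mul_right _ (by omega)) hn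
  have h2 : cluster (blockOf (n := n) a b) v =
      Finset.univ.filter fun w : Fin n => (v : ℕ) / a * a ≤ (w : ℕ) ∧ (w : ℕ) < ((v : ℕ) / a + 1) * a := by
    ext w
    rw [mem_cluster, Finset.mem_filter, ← Nat.le_div_iff_mul_le ha0, ← Nat.div_lt_iff_lt_mul ha0,
      blockOf, blockOf]
    simp only [Finset.mem_univ, true_and]
    omega
  rw [h2, card_filter_fin h1, Nat.add_mul, one_mul, Nat.add_sub_cancel_left]

theorem card_cluster_rest (ha : 2 ≤ a) {v : Fin n} (hv : b * a ≤ (v : ℕ)) :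
    (cluster (blockOf (n := n) a b) v).card = n - b * a := by
  have ha0 : 0 < a := by omega
  have hvb : b ≤ (v : ℕ) / a := (Nat.le_div_iff_mul_le ha0).2 hv
  have h2 : cluster (blockOf (n := n) a b) v =
      Finset.univ.filter fun w : Fin n => b * a ≤ (w : ℕ) ∧ (w : ℕ) < n := by
    ext w
    rw [mem_cluster, Finset.mem_filter, ← Nat.le_div_iff_mul_le ha0, blockOf, blockOf]
    simp only [Finset.mem_univ, true_and, w.2, and_true]
    omega
  rw [h2, card_filter_fin le_rfl]

theorem add_mul_le_of_succ_mul_le (hn : (b + 1) * a ≤ n) : a + b * a ≤ n := by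
  rw [add_comm, ← Nat.succ_mul]
  exact hn

theorem le_card_cluster_blockOf (ha : 2 ≤ a) (hn : (b + 1) * a ≤ n) (v : Fin n) :
    a ≤ (cluster (blockOf (n := n) a b) v).card := by
  have := add_mul_le_of_succ_mul_le hn
  by_cases hv : (v : ℕ) < b * a
  · exact (card_cluster_block ha hn hv).ge
  · rw [card_cluster_rest ha (by omega)]
    omega

theorem card_cluster_blockOf_le (ha : 2 ≤ a) (hn : (b + 1) * a ≤ n) (v : Fin n) :
    (cluster (blockOf (n := n) a b) v).card ≤ n - b * a := by
  have := add_mul_le_of_succ_mul_le hn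
  by_cases hv : (v : ℕ) < b * a
  · rw [card_cluster_block ha hn hv]
    omega
  · exact (card_cluster_rest ha (by omega)).le

theorem exists_ne_blockOf (ha : 2 ≤ a) (hn : (b + 1) * a ≤ n) (v : Fin n) :
    ∃ w, w ≠ v ∧ blockOf (n := n) a b w = blockOf (n := n) a b v := by
  have h := le_card_cluster_blockOf ha hn v
  obtain ⟨w, hw, hne⟩ := Finset.exists_mem_ne (show 1 < (cluster (blockOf (n := n) a b) v).card by omega) v
  exact ⟨w, hne, mem_cluster.1 hw⟩

theorem le_card_regularVerts (ha : 2 ≤ a) (hn : (b + 1) * a ≤ n) :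
    b * a ≤ (regularVerts (blockOf (n := n) a b) a).card := by
  have h1 := card_filter_fin (n := n) (lo := 0) (hi := b * a)
    (by have := add_mul_le_of_succ_mul_le hn; omega)
  rw [Nat.sub_zero] at h1
  rw [← h1]
  refine Finset.card_le_card fun v hv => ?_
  rw [mem_regularVerts]
  exact card_cluster_block ha hn (Finset.mem_filter.1 hv).2.2

end Blocks

/-- Bernoulli's inequality: T random vertices all miss a set of q vertices with probability at least
1 − Tq/N. -/
theorem pow_ratio_ge {w N q : ℝ} {T : ℕ} (hN : 0 < N) (hw : N - q ≤ w) (hq : q ≤ N) :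
    1 - T * q / N ≤ (w / N) ^ T := by
  have h1 : 1 - q / N ≤ w / N := by
    rw [le_div_iff₀ hN, sub_mul, div_mul_cancel₀ _ hN.ne']
    linarith
  have h0 : q / N ≤ 1 := by
    rw [div_le_one hN]
    exact hq
  have hb := one_add_mul_le_pow (show (-2 : ℝ) ≤ -(q / N) by linarith) T
  calc 1 - T * q / N = 1 + T * -(q / N) := by ring
    _ ≤ (1 + -(q / N)) ^ T := hb
    _ ≤ (w / N) ^ T := pow_le_pow_left₀ (by linarith) (by linarith) _

/-! ### The two graphs that are compared. -/

/-- A disjoint union of many cliques of size `a` and of one hidden clique that dominates the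
average degree. -/
theorem exists_hidden_clique (a T : ℕ) (ha : 2 ≤ a) (D : ℝ) :
    ∃ (n b : ℕ) (_ : (b + 1) * a ≤ n) (_ : Nonempty (Fin n)),
      (∀ P, MostlySeparated (blockOf (n := n) a b) a T P (99 / 100)) ∧
      97 / 100 ≤ 99 / 100 *
        (((regularVerts (blockOf (n := n) a b) a).card : ℝ) / Fintype.card (Fin n)) ^ T ∧
      D ≤ (∑ v, (((cluster (blockOf (n := n) a b) v).card - 1 : ℕ) : ℝ)) / Fintype.card (Fin n) := by
  -- The hidden clique of size L is the fraction 1/Q of n = Q · L vertices, hard to hit with T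
  -- queries. As Q does not depend on L, a large L makes its contribution (L − 1)/Q to the average
  -- degree exceed D.
  set Q := 200 * (T + 1) ^ 2 * a ^ 2 + 1 with hQ
  obtain ⟨m, hm⟩ := exists_nat_ge (Q * D)
  set L := m + a + 1 with hL
  set b := 200 * (T + 1) ^ 2 * a * L with hb
  set n := b * a + L with hn
  have hnQ : n = Q * L := by
    rw [hn, hb, hQ]
    ring
  have hbn : (b + 1) * a ≤ n := by
    rw [hn, Nat.succ_mul]
    omega
  have hL1 : 1 ≤ L := by omega
  have hn0 : 0 < n := by omega
  have hne : Nonempty (Fin n) := ⟨⟨0, hn0⟩⟩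
  have hw := le_card_regularVerts ha hbn
  have hba : 200 * ((T + 1) ^ 2 * a ^ 2) ≤ b * a := by
    calc 200 * ((T + 1) ^ 2 * a ^ 2) = 200 * (T + 1) ^ 2 * a * 1 * a := by ring
      _ ≤ 200 * (T + 1) ^ 2 * a * L * a := by gcongr
  have hTa : (T * a) ^ 2 + T * a ≤ 2 * ((T + 1) ^ 2 * a ^ 2) := by
    have h1 : T * a ≤ (T + 1) ^ 2 * a ^ 2 := by
      refine Nat.mul_le_mul ?_ ?_ <;> nlinarith
    have h2 : (T * a) ^ 2 ≤ (T + 1) ^ 2 * a ^ 2 := by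
      rw [mul_pow]
      gcongr
      omega
    omega
  have hwpos : 0 < (regularVerts (blockOf (n := n) a b) a).card := by
    have : 0 < (T + 1) ^ 2 * a ^ 2 := by positivity
    omega
  refine ⟨n, b, hbn, hne, fun P => ?_, ?_, ?_⟩
  · refine mostlySeparated_of_le (by omega) (T * a) (fun M h k w _ hh hk => ?_) hwpos ?_
    · exact (hk.valid (by omega)).length_comps.trans (by gcongr)
    · have : 100 * ((T * a) ^ 2 + T * a) ≤ (regularVerts (blockOf (n := n) a b) a).card := by omega
      exact_mod_cast this
  · rw [Fintype.card_fin]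
    have hnr : (0 : ℝ) < n := by exact_mod_cast hn0
    have h1 : (n : ℝ) - L ≤ (regularVerts (blockOf (n := n) a b) a).card := by
      have : n ≤ (regularVerts (blockOf (n := n) a b) a).card + L := by omega
      have : (n : ℝ) ≤ (regularVerts (blockOf (n := n) a b) a).card + L := by exact_mod_cast this
      linarith
    have h2 : (L : ℝ) ≤ n := by
      have : L ≤ n := by omega
      exact_mod_cast this
    have h3 := pow_ratio_ge (T := T) hnr h1 h2
    have h4 : (T : ℝ) * L / n ≤ 1 / 100 := by
      rw [div_le_iff₀ hnr]
      have : 100 * (T * L) ≤ n := by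
        rw [hnQ, ← mul_assoc]
        gcongr
        have : T ≤ (T + 1) ^ 2 * a ^ 2 := by nlinarith [Nat.one_le_pow 2 a (by omega)]
        rw [hQ]
        nlinarith
      have : (100 : ℝ) * (T * L) ≤ n := by exact_mod_cast this
      linarith
    linarith
  · have hQ0 : (0 : ℝ) < Q := by
      rw [hQ]
      positivity
    have hL0 : (0 : ℝ) < L := by exact_mod_cast hL1
    rw [Fintype.card_fin, le_div_iff₀ (by exact_mod_cast hn0)]
    have h1 : ∀ v : Fin n, b * a ≤ (v : ℕ) → (cluster (blockOf (n := n) a b) v).card - 1 = L - 1 := by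
      intro v hv
      rw [card_cluster_rest ha hv]
      omega
    have h2 := card_filter_fin (n := n) (lo := b * a) (hi := n) le_rfl
    have h3 : ((n - b * a : ℕ) : ℝ) * ((L - 1 : ℕ) : ℝ) ≤
        ∑ v, (((cluster (blockOf (n := n) a b) v).card - 1 : ℕ) : ℝ) := by
      rw [← h2, ← nsmul_eq_mul, ← Finset.sum_const]
      refine le_trans (le_of_eq (Finset.sum_congr rfl fun v hv => ?_))
        (Finset.sum_le_univ_sum_of_nonneg fun v => Nat.cast_nonneg _)
      rw [h1 v (Finset.mem_filter.1 hv).2.1]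
    refine le_trans ?_ h3
    have h4 : n - b * a = L := by omega
    rw [h4]
    have h5 : (m : ℝ) ≤ ((L - 1 : ℕ) : ℝ) := by
      have : m ≤ L - 1 := by omega
      exact_mod_cast this
    calc D * n = L * (Q * D) := by
          rw [hnQ, Nat.cast_mul]
          ring
      _ ≤ L * ((L - 1 : ℕ) : ℝ) := by gcongr; exact hm.trans h5

theorem disjoint_Icc_of_lt {c d d' : ℝ} (hc : 1 ≤ c) (h : c ^ 2 * d < d') :
    Disjoint (Set.Icc (d / c) (c * d)) (Set.Icc (d' / c) (c * d')) := by
  rw [Set.disjoint_left]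
  rintro x ⟨_, hx⟩ ⟨hx', _⟩
  rw [div_le_iff₀ (by linarith)] at hx'
  nlinarith

/-- The lower bound, for any bound `f` on the number of queries in terms of the number of vertices
and the average degree, such that so few queries are mostly separated. -/
theorem exists_input_probMoreQueries (c : ℝ) (hc : 1 ≤ c) (A : Algorithm)
    (hA : A.Approximates c) (P : List (Query × Answer) → Prop) (hP0 : P [])
    (hP : ∀ h q a, P h → Sum.inl q ∈ (A h).support → P ((q, a) :: h)) (f : ℝ → ℝ → ℕ)
    (hf : ∀ (n a b : ℕ) (avg : ℝ) [Nonempty (Fin n)], 2 ≤ a → (b + 1) * a ≤ n → n ≤ b * a + 2 * a →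
      (a : ℝ) - 1 ≤ avg → 0 < f n avg →
      500 * ((f n avg : ℝ) * a) ≤ n ∧
        (9 / 10 * (n : ℝ) ≤ (regularVerts (blockOf (n := n) a b) a).card →
          MostlySeparated (blockOf (n := n) a b) a (f n avg) P (99 / 100)))
    (n : ℕ) (d : ℝ) (hd : 1 ≤ d) (hdn : d ≤ (n : ℝ) - 1) :
    ∃ I : InputGraph, I.numVerts = n ∧ d / 2 ≤ I.avgDegree ∧ I.avgDegree ≤ 2 * d ∧
      1 / 4 ≤ A.probMoreQueries I (f I.numVerts I.avgDegree) := by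
  -- The regular degree is a − 1 = ⌊d⌋, which is at least d/2 because d ≥ 1.
  set a := ⌊d⌋₊ + 1 with ha'
  have hfl1 : 1 ≤ ⌊d⌋₊ := Nat.le_floor (by simpa using hd)
  have hfl : (⌊d⌋₊ : ℝ) ≤ d := Nat.floor_le (by linarith)
  have hfl2 : d < ⌊d⌋₊ + 1 := Nat.lt_floor_add_one d
  have ha : 2 ≤ a := by omega
  have hacast : (a : ℝ) = ⌊d⌋₊ + 1 := by rw [ha']; push_cast; ring
  have han : a ≤ n := by
    have : (a : ℝ) ≤ n := by linarith
    exact_mod_cast this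
  have hq1 : 1 ≤ n / a := (Nat.one_le_div_iff (by omega)).2 han
  -- One block fewer than would fit: the rest has between a and 2a − 1 vertices, so every degree
  -- lies between a − 1 and 2(a − 1).
  set b := n / a - 1 with hb
  have hb1 : b + 1 = n / a := by omega
  have hbn : (b + 1) * a ≤ n := by
    rw [hb1]
    exact Nat.div_mul_le_self n a
  have hnb : n < b * a + 2 * a := by
    have h1 := Nat.div_add_mod n a
    have h2 := Nat.mod_lt n (show 0 < a by omega)
    have h3 : a * (n / a) = b * a + a := by rw [← hb1]; ring
    omega
  have hne : Nonempty (Fin n) := ⟨⟨0, by omega⟩⟩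
  have hnr : (0 : ℝ) < n := by
    have : 0 < n := by omega
    exact_mod_cast this
  set cls := blockOf (n := n) a b with hcls_def
  have hcls := exists_ne_blockOf (n := n) ha hbn
  set avg : ℝ := (∑ v, (((cluster cls v).card - 1 : ℕ) : ℝ)) / Fintype.card (Fin n) with havg
  have havgI : ∀ ident, (clusterInput cls hcls ident).avgDegree = avg := fun ident =>
    clusterInput_avgDegree cls hcls ident
  have hlo : (a : ℝ) - 1 ≤ avg := by
    rw [havg, Fintype.card_fin, le_div_iff₀ hnr]
    have h1 : ∑ v : Fin n, ((a : ℝ) - 1) ≤ ∑ v, (((cluster cls v).card - 1 : ℕ) : ℝ) := by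
      refine Finset.sum_le_sum fun v _ => ?_
      have : a ≤ (cluster cls v).card := le_card_cluster_blockOf ha hbn v
      have h2 : a - 1 ≤ (cluster cls v).card - 1 := by omega
      have h3 : ((a - 1 : ℕ) : ℝ) = (a : ℝ) - 1 := by
        rw [Nat.cast_sub (by omega), Nat.cast_one]
      rw [← h3]
      exact_mod_cast h2
    rw [Finset.sum_const, Finset.card_univ, Fintype.card_fin, nsmul_eq_mul] at h1
    linarith
  have hhi : avg ≤ 2 * ((a : ℝ) - 1) := by
    rw [havg, Fintype.card_fin, div_le_iff₀ hnr]
    have h1 : ∑ v, (((cluster cls v).card - 1 : ℕ) : ℝ) ≤ ∑ v : Fin n, (2 * ((a : ℝ) - 1)) := by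
      refine Finset.sum_le_sum fun v _ => ?_
      have : (cluster cls v).card ≤ n - b * a := card_cluster_blockOf_le ha hbn v
      have h2 : (cluster cls v).card - 1 ≤ 2 * (a - 1) := by omega
      have h3 : ((2 * (a - 1) : ℕ) : ℝ) = 2 * ((a : ℝ) - 1) := by
        rw [Nat.cast_mul, Nat.cast_sub (by omega), Nat.cast_one, Nat.cast_ofNat]
      rw [← h3]
      exact_mod_cast h2
    rw [Finset.sum_const, Finset.card_univ, Fintype.card_fin, nsmul_eq_mul] at h1
    linarith
  set T := f n avg with hT
  obtain ⟨n', b', hbn', hne', hsep', hreg', hD⟩ := exists_hidden_clique a T ha (c ^ 2 * avg + 1)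
  have hS := disjoint_Icc_of_lt hc (lt_of_lt_of_le (lt_add_one _) hD)
  have hex : ∃ e, 0 ≤ e ∧ MostlySeparated cls a T P e ∧
      97 / 100 ≤ e * (((regularVerts cls a).card : ℝ) / Fintype.card (Fin n)) ^ T := by
    -- For T = 0 there may be few or no regular vertices, but the empty history needs none; for T >
    -- 0 the bound 500Ta ≤ n makes at least the fraction 1 − 2/500 of the vertices regular.
    rcases Nat.eq_zero_or_pos T with h0 | hpos
    · refine ⟨1, zero_le_one, ?_, ?_⟩
      · rw [h0]
        exact mostlySeparated_zero cls a P
      · rw [h0]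
        norm_num
    · obtain ⟨h1, h2⟩ := hf n a b avg ha hbn hnb.le hlo hpos
      change 500 * ((T : ℝ) * a) ≤ n at h1
      have hT1 : (1 : ℝ) ≤ T := by exact_mod_cast hpos
      have ha0 : (0 : ℝ) ≤ a := Nat.cast_nonneg a
      have h3 : 500 * (a : ℝ) ≤ n := by nlinarith
      have h4 : (n : ℝ) - 2 * a ≤ (regularVerts cls a).card := by
        have h5 : b * a ≤ (regularVerts cls a).card := le_card_regularVerts ha hbn
        have h6 : n ≤ (regularVerts cls a).card + 2 * a := by omega
        have h7 : (n : ℝ) ≤ (regularVerts cls a).card + 2 * a := by exact_mod_cast h6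
        linarith
      refine ⟨99 / 100, by norm_num, h2 (by linarith), ?_⟩
      have h8 := pow_ratio_ge (T := T) hnr h4 (by linarith)
      have h9 : (T : ℝ) * (2 * a) / n ≤ 1 / 100 := by
        rw [div_le_iff₀ hnr]
        linarith
      rw [Fintype.card_fin]
      linarith
  obtain ⟨e, he0, hsep, hreg⟩ := hex
  obtain ⟨ident, hident⟩ := exists_ident_probMoreQueries A T a ha cls hcls
    (blockOf (n := n') a b') (exists_ne_blockOf ha hbn') P hP0 hP e (99 / 100) he0 (by norm_num)
    hsep (hsep' P) hreg hreg' hS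
    (fun ident => by
      have := hA (clusterInput cls hcls ident)
      rwa [havgI] at this)
    (fun ident => by
      have := hA (clusterInput (blockOf (n := n') a b') (exists_ne_blockOf ha hbn') ident)
      rwa [clusterInput_avgDegree] at this)
  have hnum : (clusterInput cls hcls ident).numVerts = n := Fintype.card_fin n
  refine ⟨clusterInput cls hcls ident, hnum, ?_, ?_, ?_⟩
  · rw [havgI]
    have : (1 : ℝ) ≤ ⌊d⌋₊ := by exact_mod_cast hfl1
    linarith
  · rw [havgI]
    linarith
  · rw [havgI, hnum]
    exact hident

theorem le_two_mul_of_sub_one_le {a : ℕ} {avg : ℝ} (ha : 2 ≤ a) (h : (a : ℝ) - 1 ≤ avg) :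
    (a : ℝ) ≤ 2 * avg := by
  have : (2 : ℝ) ≤ a := by exact_mod_cast ha
  linarith

/-- The lower bound in the standard model. -/
theorem standard_lower_bound (c : ℝ) (hc : 1 ≤ c) (A : Algorithm) (hs : A.IsStandard)
    (hA : A.Approximates c) (n : ℕ) (d : ℝ) (hd : 1 ≤ d) (hdn : d ≤ (n : ℝ) - 1) :
    ∃ I : InputGraph, I.numVerts = n ∧ d / 2 ≤ I.avgDegree ∧ I.avgDegree ≤ 2 * d ∧
      1 / 4 ≤ A.probMoreQueries I
        ⌊1 / 1000 * min (Real.sqrt I.numVerts) (I.numVerts / I.avgDegree)⌋₊ := by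
  refine exists_input_probMoreQueries c hc A hA
    (fun h => ∀ qa ∈ h, ∀ x, qa.1 ≠ .fullNbrHood x) (by simp) ?_
    (fun N avg => ⌊1 / 1000 * min (Real.sqrt N) (N / avg)⌋₊) ?_ n d hd hdn
  · intro h q ans hh hq qa hqa x
    rcases List.mem_cons.1 hqa with rfl | hqa
    · rintro rfl
      exact hs h x hq
    · exact hh qa hqa x
  · intro n a b avg _ ha hbn _ havg hpos
    have ha2 := le_two_mul_of_sub_one_le ha havg
    have hav : 0 < avg := by
      have : (2 : ℝ) ≤ a := by exact_mod_cast ha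
      linarith
    have hn0 : (0 : ℝ) ≤ n := Nat.cast_nonneg n
    set T := ⌊1 / 1000 * min (Real.sqrt n) (n / avg)⌋₊
    have hT : (T : ℝ) ≤ 1 / 1000 * min (Real.sqrt n) (n / avg) := Nat.floor_le (by positivity)
    have hT1 : (T : ℝ) ≤ 1 / 1000 * Real.sqrt n := hT.trans (by gcongr; exact min_le_left _ _)
    have hT2 : (T : ℝ) ≤ 1 / 1000 * (n / avg) := hT.trans (by gcongr; exact min_le_right _ _)
    have hT0 : (1 : ℝ) ≤ T := by exact_mod_cast hpos
    have h1 : (T : ℝ) * avg ≤ 1 / 1000 * n := by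
      calc (T : ℝ) * avg ≤ 1 / 1000 * (n / avg) * avg := by gcongr
        _ = 1 / 1000 * (n : ℝ) := by field_simp
    have h2 : (T : ℝ) ^ 2 ≤ 1 / 1000000 * n := by
      calc (T : ℝ) ^ 2 ≤ (1 / 1000 * Real.sqrt n) ^ 2 := by gcongr
        _ = 1 / 1000000 * (n : ℝ) := by rw [mul_pow, Real.sq_sqrt hn0]; norm_num
    -- The constant 1/1000 is used here: a is at most twice the average degree, so 500Ta is at most
    -- 1000 times T times the average degree.
    have h3 : 500 * ((T : ℝ) * a) ≤ n := by nlinarith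
    refine ⟨h3, fun hw => ?_⟩
    have hn1 : (0 : ℝ) < n := by nlinarith
    refine mostlySeparated_of_le (by omega) T
      (fun M h k w hh hl hk => (hk.length_comps_le hh).trans hl) ?_ ?_
    · have : (0 : ℝ) < (regularVerts (blockOf (n := n) a b) a).card := by linarith
      exact_mod_cast this
    · linarith

/-- The lower bound with full neighborhood access. -/
theorem fullNbrHood_lower_bound (c : ℝ) (hc : 1 ≤ c) (A : Algorithm)
    (hA : A.Approximates c) (n : ℕ) (d : ℝ) (hd : 1 ≤ d) (hdn : d ≤ (n : ℝ) - 1) :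
    ∃ I : InputGraph, I.numVerts = n ∧ d / 2 ≤ I.avgDegree ∧ I.avgDegree ≤ 2 * d ∧
      1 / 4 ≤ A.probMoreQueries I ⌊1 / 1000 * Real.sqrt (I.numVerts / I.avgDegree)⌋₊ := by
  refine exists_input_probMoreQueries c hc A hA (fun _ => True) trivial (by simp)
    (fun N avg => ⌊1 / 1000 * Real.sqrt (N / avg)⌋₊) ?_ n d hd hdn
  intro n a b avg _ ha hbn _ havg hpos
  have ha2 := le_two_mul_of_sub_one_le ha havg
  have hav : 0 < avg := by
    have : (2 : ℝ) ≤ a := by exact_mod_cast ha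
    linarith
  set T := ⌊1 / 1000 * Real.sqrt (n / avg)⌋₊
  have hT : (T : ℝ) ≤ 1 / 1000 * Real.sqrt (n / avg) := Nat.floor_le (by positivity)
  have hT0 : (1 : ℝ) ≤ T := by exact_mod_cast hpos
  have h1 : (T : ℝ) ^ 2 * avg ≤ 1 / 1000000 * n := by
    calc (T : ℝ) ^ 2 * avg ≤ (1 / 1000 * Real.sqrt (n / avg)) ^ 2 * avg := by gcongr
      _ = 1 / 1000000 * (n : ℝ) := by
        rw [mul_pow, Real.sq_sqrt (by positivity)]
        field_simp
        ring
  have ha0 : (0 : ℝ) < a := by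
    have : 0 < a := by omega
    exact_mod_cast this
  have h2 : (T : ℝ) ^ 2 * a ≤ 2 / 1000000 * n := by nlinarith [sq_nonneg (T : ℝ)]
  have h3 : (T : ℝ) * a ≤ (T : ℝ) ^ 2 * a := by
    gcongr
    nlinarith
  have hn0 : (0 : ℝ) < n := by nlinarith
  refine ⟨by linarith, fun hw => mostlySeparated_of_roots (by omega) _ ?_ (by linarith)⟩
  have : (0 : ℝ) < (regularVerts (blockOf (n := n) a b) a).card := by linarith
  exact_mod_cast this

end DegreeEstimation

end

theorem corollary4p4 :
    -- the upper bound in the standard model with `n` unknown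
    (∃ C : ℝ, 0 < C ∧ ∀ ε : ℝ, 0 < ε → ε < 1 →
      ∃ A : DegreeEstimation.Algorithm, A.IsStandard ∧
        ∀ I : DegreeEstimation.InputGraph,
          99 / 100 < A.probOutput I
            ⌊C * (ε ^ 2)⁻¹ * min (Real.sqrt I.numVerts) (I.numVerts / I.avgDegree)⌋₊
            (Set.Icc ((1 - ε) * I.avgDegree) ((1 + ε) * I.avgDegree))) ∧
    -- the lower bound in the standard model, for all `n` and `d`
    (∀ c : ℝ, 1 ≤ c → ∃ κ : ℝ, 0 < κ ∧
      ∀ A : DegreeEstimation.Algorithm, A.IsStandard → A.Approximates c →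
        ∀ (n : ℕ) (d : ℝ), 1 ≤ d → d ≤ (n : ℝ) - 1 →
          ∃ I : DegreeEstimation.InputGraph, I.numVerts = n ∧
            d / 2 ≤ I.avgDegree ∧ I.avgDegree ≤ 2 * d ∧
            1 / 4 ≤ A.probMoreQueries I
              ⌊κ * min (Real.sqrt I.numVerts) (I.numVerts / I.avgDegree)⌋₊) ∧
    -- the lower bound with full neighborhood access, for all `n` and `d`
    (∀ c : ℝ, 1 ≤ c → ∃ κ : ℝ, 0 < κ ∧
      ∀ A : DegreeEstimation.Algorithm, A.Approximates c →
        ∀ (n : ℕ) (d : ℝ), 1 ≤ d → d ≤ (n : ℝ) - 1 →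
          ∃ I : DegreeEstimation.InputGraph, I.numVerts = n ∧
            d / 2 ≤ I.avgDegree ∧ I.avgDegree ≤ 2 * d ∧
            1 / 4 ≤ A.probMoreQueries I
              ⌊κ * Real.sqrt (I.numVerts / I.avgDegree)⌋₊) := by
  refine ⟨DegreeEstimation.exists_estimation_algorithm, fun c hc => ?_, fun c hc => ?_⟩
  · exact ⟨1 / 1000, by norm_num, fun A hs hA n d hd hdn =>
      DegreeEstimation.standard_lower_bound c hc A hs hA n d hd hdn⟩
  · exact ⟨1 / 1000, by norm_num, fun A hA n d hd hdn =>
      DegreeEstimation.fullNbrHood_lower_bound c hc A hA n d hd hdn⟩
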